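/- Let $p_1,p_2\ge 2$ be integers with $n:=p_1+p_2\le 8$ and let $\lambda\in\mathbb R$. On $\mathbb R^6$ with coordinates $(x_1,y_1,x_2,y_2,\Gamma,\sigma)$ consider the soliton system $$x_\alpha'=-2x_\alpha y_\alpha,\qquad y_\alpha'=x_\alpha+(\Gamma+1-\lambda\sigma)y_\alpha+\Gamma+1,\qquad \Gamma'=\Gamma+\sum_{\alpha}p_\alpha(1+y_\alpha)^2,\qquad \sigma'=2\sigma\qquad(\alpha=1,2),$$ with its fixed points $$\mathfrak{gf}=(p_1-1,0,0,-1,-p_1,0)\ \text{ (good fill)},\qquad \mathfrak{rfc}=(n-1,0,n-1,0,-n,0)\ \text{ (Ricci-flat cone)},$$ and the function $J=\tfrac12\sum_\alpha p_\alpha\{x_\alpha+(1+y_\alpha)^2\}-\tfrac12\Gamma^2$. Let $W^u(\mathfrak{gf})$ be the set of points whose orbit exists for all $t\le 0$ and converges to $\mathfrak{gf}$ as $t\to-\infty$, and let $W^s(\mathfrak{rfc})$ be the set of points whose orbit exists for all $t\ge 0$ and converges to $\mathfrak{rfc}$ as $t\to+\infty$. The tangent space $T_pW^u(\mathfrak{gf})$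 (resp. $T_pW^s(\mathfrak{rfc})$) is the set of velocities at $p$ of the $C^1$ curves through $p$ in this set whose points converge to the fixed point uniformly along the curve as $t\to-\infty$ (resp. $t\to+\infty$). 1. There is a complete solution $\mathfrak B:\mathbb R\to\mathbb R^6$ (the Böhm orbit) with $\mathfrak B(t)\to\mathfrak{gf}$ as $t\to-\infty$, $\mathfrak B(t)\to\mathfrak{rfc}$ as $t\to+\infty$ and $W^u(\mathfrak{gf})\cap W^s(\mathfrak{rfc})=\{\mathfrak B(t):t\in\mathbb R\}$. Along it $W^u(\mathfrak{gf})$ and $W^s(\mathfrak{rfc})$ meet transversally: for every $t$, $T_{\mathfrak B(t)}W^u(\mathfrak{gf})$ and $T_{\mathfrak B(t)}W^s(\mathfrak{rfc})$ are linear subspaces of $\mathbb R^6$ of dimensions $3$ and $4$, and $$T_{\mathfrak B(t)}W^u(\mathfrak{gf})+T_{\mathfrak B(t)}W^s(\mathfrak{rfc})=\mathbb R^6.$$ 2. Every $p\in W^s(\mathfrak{rfc})$ satisfies $\sigma(p)=J(p)=0$ and has a neighborhood $N\subset\mathbb R^6$ with $$W^s(\mathfrak{rfc})\cap N=\{z\in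 N:\sigma(z)=J(z)=0\}.$$ -/

import Mathlib

open Set Filter Topology

section Dynamics

variable {E : Type*} [NormedAddCommGroup E] [NormedSpace ℝ E]

/-- The set of all points `p` whose orbit under the autonomous vector field `X` is defined on the
time set `S` and converges to `q` along the filter `l` of times. -/
def asymptoticSet (X : E → E) (S : Set ℝ) (l : Filter ℝ) (q : E) : Set E :=
  {p | ∃ γ : ℝ → E, γ 0 = p ∧ IsIntegralCurveOn γ (fun _ => X) S ∧ Tendsto γ l (𝓝 q)}

/-- The velocities `c'(0)` of the `C¹` curves `c` through `p` that run in `asymptoticSet X S l q`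
and are continuous for the intrinsic topology of this (immersed) submanifold, which is expressed by
asking that the orbits of the points `c r` converge to `q` uniformly in `r`. -/
def asymptoticTangent (X : E → E) (S : Set ℝ) (l : Filter ℝ) (q p : E) : Set E :=
  {v | ∃ ε > (0 : ℝ), ∃ (c : ℝ → E) (orb : ℝ → ℝ → E),
    ContDiffOn ℝ 1 c (Ioo (-ε) ε) ∧ c 0 = p ∧ HasDerivAt c v 0 ∧
    (∀ r ∈ Ioo (-ε) ε, orb r 0 = c r ∧ IsIntegralCurveOn (orb r) (fun _ => X) S) ∧
    TendstoUniformlyOn (fun t r => orb r t) (fun _ => q) l (Ioo (-ε) ε)}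

/-- The unstable manifold `W^u(q)`: points whose backward orbit is defined for all `t ≤ 0` and
tends to `q` as `t → -∞`. -/
def unstableManifold (X : E → E) (q : E) : Set E := asymptoticSet X (Iic 0) atBot q

/-- The stable manifold `W^s(q)`: points whose forward orbit is defined for all `t ≥ 0` and
tends to `q` as `t → +∞`. -/
def stableManifold (X : E → E) (q : E) : Set E := asymptoticSet X (Ici 0) atTop q

/-- The tangent space of `W^u(q)` at `p`. -/
def unstableTangent (X : E → E) (q p : E) : Set E := asymptoticTangent X (Iic 0) atBot q p

/-- The tangent space of `W^s(q)` at `p`. -/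
def stableTangent (X : E → E) (q p : E) : Set E := asymptoticTangent X (Ici 0) atTop q p

end Dynamics

noncomputable section Soliton

/-- The soliton vector field on `ℝ⁶`, in the coordinates `(x₁, y₁, x₂, y₂, Γ, σ)`. -/
def solitonField (p₁ p₂ : ℕ) (lam : ℝ) (z : Fin 6 → ℝ) : Fin 6 → ℝ :=
  ![-2 * z 0 * z 1,
    z 0 + (z 4 + 1 - lam * z 5) * z 1 + z 4 + 1,
    -2 * z 2 * z 3,
    z 2 + (z 4 + 1 - lam * z 5) * z 3 + z 4 + 1,
    z 4 + (p₁ * (1 + z 1) ^ 2 + p₂ * (1 + z 3) ^ 2),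
    2 * z 5]

/-- The good fill fixed point `(p₁ - 1, 0, 0, -1, -p₁, 0)`. -/
def goodFill (p₁ : ℕ) : Fin 6 → ℝ := ![(p₁ : ℝ) - 1, 0, 0, -1, -(p₁ : ℝ), 0]

/-- The Ricci-flat cone fixed point `(n - 1, 0, n - 1, 0, -n, 0)`, where `n = p₁ + p₂`. -/
def ricciFlatCone (p₁ p₂ : ℕ) : Fin 6 → ℝ :=
  ![(p₁ : ℝ) + p₂ - 1, 0, (p₁ : ℝ) + p₂ - 1, 0, -((p₁ : ℝ) + p₂), 0]

/-- `J = ½ ∑ p_α (x_α + (1 + y_α)²) - ½ Γ²`. -/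
def solitonJ (p₁ p₂ : ℕ) (z : Fin 6 → ℝ) : ℝ :=
  1 / 2 * (p₁ * (z 0 + (1 + z 1) ^ 2) + p₂ * (z 2 + (1 + z 3) ^ 2)) - 1 / 2 * (z 4) ^ 2

/-- The coordinate `σ`. -/
def solitonSigma (z : Fin 6 → ℝ) : ℝ := z 5

end Soliton

/-!
The proof has three ingredients.

*The stable side.* Along an orbit `σ' = 2 σ`, and `J' = 2 J` where `σ = 0`, so both vanish on
`W^s(𝔯𝔣𝔠)` (`solitonSigma_solitonJ_eq_zero`). Within the level set `σ = J = 0` the Ricci-flat cone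
is a sink; a quadratic Lyapunov function (`sinkForm_deriv_le`), together with continuous
dependence on initial data up to the time at which the orbit enters the basin, yields an open
subset of the level set that is attracted uniformly (`exists_uniform_orbits`). This gives the
local description of the stable manifold and its tangent space, the common kernel of `dσ` and `dJ`
(`stableTangent_eq`).

*The unstable side.* In the chart `(σ, x₂, J, 1 + y₂, Z, Γ + p₁)`, with `Z = Γ + ∑ p_α (1 + y_α)`,
the field is polynomial and its linear part at the good fill has the rates `2, 2, 2, 1 - p₁, 1 -
p₁, -1`, up to nilpotent terms that a rescaling by `d` makes small. Orbits that leave the good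
fill like `e^{2t}` have the form `u(t) = e^{2t} ω(e^t)` with `ω` continuous on `[0, 1]`, and are
the solutions of an integral equation `solitonInt ω = ξ` on the Banach space `C([0, 1])⁶`, where
`ξ ∈ ℝ³` is the unstable part of `ω(0)`. The derivative of `solitonInt` is invertible at every
`ω`, because the nonlinear term comes with a Volterra operator, which is small in a strongly
weighted norm (`exists_hasFDerivAt_solitonInt`). Hence, along any given orbit of this kind, the
inverse function theorem provides a `C¹` family of orbits on `(-∞, 0]` with parameter `ξ`
(`exists_family`). That this family exhausts the tangent space of `W^u(𝔤𝔣)` follows from a cone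
argument (`exists_eq_of_eq_unstable`): orbits that stay near the good fill for all negative times
are determined by their unstable components (`mem_range_familyDeriv`, `injective_familyDeriv`).

*The connecting orbit.* The member of the family with `ξ = (0, s, 0)`, `s > 0`, has `σ = J = Z =
0` and positive `x₁` and `x₂`. Such Ricci-flat data are attracted by the cone, by Böhm's monotone
quantity (`IsRicciFlatData.tendsto_ricciFlatCone`); this is the Böhm orbit (`exists_boehmOrbit`).
A second orbit in the intersection has `σ = J = 0` and `x₂ > 0` as well; since `x₂ → 0` at the
good fill, both orbits take a common small value of `x₂`, where the cone argument identifies them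
(`unstableManifold_inter_stableManifold`).

The intersection is transversal because on the family `σ = d² ξ₀`, and `J = d² ξ₂` where `ξ₀ = 0`:
the differentials of `σ` and `J` are independent on the unstable tangent space, and their common
kernel is the stable one (`exists_transversal_tangents`).
-/

/-! ### Integral curves of autonomous vector fields -/

section IntegralCurves

variable {E : Type*} [NormedAddCommGroup E] [NormedSpace ℝ E] {X : E → E} {γ η : ℝ → E}
  {S S' : Set ℝ}

theorem IsIntegralCurveOn.shift (h : IsIntegralCurveOn γ (fun _ => X) S) (a : ℝ)
    (hS : MapsTo (· + a) S' S) : IsIntegralCurveOn (fun t => γ (t + a)) (fun _ => X) S' := by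
  intro t ht
  have h1 := h (t + a) (hS ht)
  have h2 : HasDerivWithinAt (fun t : ℝ => t + a) 1 S' t :=
    ((hasDerivAt_id t).add_const a).hasDerivWithinAt
  simpa [Function.comp_def] using h1.scomp t h2 hS

theorem IsIntegralCurveOn.reverse (h : IsIntegralCurveOn γ (fun _ => X) S)
    (hS : MapsTo (fun t => -t) S' S) :
    IsIntegralCurveOn (fun t => γ (-t)) (fun _ => -X) S' := by
  intro t ht
  have h1 := h (-t) (hS ht)
  have h2 : HasDerivWithinAt (fun t : ℝ => -t) (-1) S' t :=
    (hasDerivAt_neg t).hasDerivWithinAt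
  simpa [Function.comp_def] using h1.scomp t h2 hS

theorem HasDerivWithinAt.Ici_of_Icc {f : ℝ → E} {f' : E} {a b t : ℝ}
    (h : HasDerivWithinAt f f' (Icc a b) t) (ht : t ∈ Ico a b) :
    HasDerivWithinAt f f' (Ici t) t :=
  (h.mono (Icc_subset_Icc_left ht.1)).mono_of_mem_nhdsWithin
    (Icc_mem_nhdsGE ht.2)

/-- Two integral curves of a `C¹` vector field with the same initial point agree: on a compact
time interval both stay in a ball, on which the field is Lipschitz. -/
theorem IsIntegralCurveOn.eqOn_Icc [FiniteDimensional ℝ E] (hX : ContDiff ℝ 1 X) {T : ℝ}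
    (h₁ : IsIntegralCurveOn γ (fun _ => X) (Icc 0 T))
    (h₂ : IsIntegralCurveOn η (fun _ => X) (Icc 0 T)) (h0 : γ 0 = η 0) :
    EqOn γ η (Icc 0 T) := by
  obtain ⟨R₁, hR₁⟩ := (isCompact_Icc.image_of_continuousOn h₁.continuousOn).isBounded.exists_norm_le
  obtain ⟨R₂, hR₂⟩ := (isCompact_Icc.image_of_continuousOn h₂.continuousOn).isBounded.exists_norm_le
  set R := max R₁ R₂
  obtain ⟨K, hK⟩ := hX.contDiffOn.exists_lipschitzOnWith one_ne_zero
    (convex_closedBall (0 : E) R) (isCompact_closedBall 0 R)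
  refine ODE_solution_unique_of_mem_Icc_right (v := fun _ => X)
    (s := fun _ => Metric.closedBall 0 R) (K := K) (fun _ _ => hK) h₁.continuousOn
    (fun t ht => ?_) (fun t ht => ?_) h₂.continuousOn (fun t ht => ?_) (fun t ht => ?_) h0
  · exact (h₁ t (Ico_subset_Icc_self ht)).Ici_of_Icc ht
  · exact mem_closedBall_zero_iff.2
      ((hR₁ _ (mem_image_of_mem _ (Ico_subset_Icc_self ht))).trans (le_max_left _ _))
  · exact (h₂ t (Ico_subset_Icc_self ht)).Ici_of_Icc ht
  · exact mem_closedBall_zero_iff.2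
      ((hR₂ _ (mem_image_of_mem _ (Ico_subset_Icc_self ht))).trans (le_max_right _ _))

theorem IsIntegralCurveOn.eqOn_Ici [FiniteDimensional ℝ E] (hX : ContDiff ℝ 1 X)
    (h₁ : IsIntegralCurveOn γ (fun _ => X) (Ici 0))
    (h₂ : IsIntegralCurveOn η (fun _ => X) (Ici 0)) (h0 : γ 0 = η 0) :
    EqOn γ η (Ici 0) := fun _ ht =>
  IsIntegralCurveOn.eqOn_Icc hX (h₁.mono Icc_subset_Ici_self) (h₂.mono Icc_subset_Ici_self) h0
    ⟨ht, le_rfl⟩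

theorem IsIntegralCurveOn.eqOn_Iic [FiniteDimensional ℝ E] (hX : ContDiff ℝ 1 X)
    (h₁ : IsIntegralCurveOn γ (fun _ => X) (Iic 0))
    (h₂ : IsIntegralCurveOn η (fun _ => X) (Iic 0)) (h0 : γ 0 = η 0) :
    EqOn γ η (Iic 0) := by
  intro t ht
  have hm : MapsTo (fun t : ℝ => -t) (Ici 0) (Iic 0) := fun s hs => by
    simpa using hs
  have := IsIntegralCurveOn.eqOn_Ici hX.neg (h₁.reverse hm) (h₂.reverse hm) (by simpa using h0)
    (show -t ∈ Ici (0 : ℝ) by simpa using ht)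
  simpa using this

/-- A bounded, globally Lipschitz vector field is complete. The orbit is glued from the
Picard–Lindelöf solutions on the intervals `(-n - 1, n + 1)`. -/
theorem exists_isIntegralCurve_of_lipschitzWith [CompleteSpace E] {K : NNReal}
    (hK : LipschitzWith K X) {L : NNReal} (hL : ∀ z, ‖X z‖ ≤ L) (p : E) :
    ∃ γ : ℝ → E, γ 0 = p ∧ IsIntegralCurve γ (fun _ => X) := by
  have key : ∀ n : ℕ, ∃ γ : ℝ → E, γ 0 = p ∧
      ∀ t ∈ Ioo (-(n + 1 : ℝ)) (n + 1), HasDerivAt γ (X (γ t)) t := by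
    intro n
    have h0 : (0 : ℝ) ∈ Icc (-(n + 1 : ℝ)) (n + 1) := ⟨by linarith [n.cast_nonneg (α := ℝ)],
      by positivity⟩
    have hP : IsPicardLindelof (fun _ => X) (⟨0, h0⟩ : Icc (-(n + 1 : ℝ)) (n + 1)) p
        (L * (n + 1)) 0 L K := by
      refine IsPicardLindelof.of_time_independent (fun x _ => hL x) hK.lipschitzOnWith ?_
      simp
    obtain ⟨γ, h1, h2⟩ := hP.exists_eq_forall_mem_Icc_hasDerivWithinAt₀
    exact ⟨γ, h1, fun t ht => (h2 t (Ioo_subset_Icc_self ht)).hasDerivAt (Icc_mem_nhds ht.1 ht.2)⟩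
  choose γ h0 hγ using key
  have agree : ∀ m n : ℕ, m ≤ n → EqOn (γ m) (γ n) (Ioo (-(m + 1 : ℝ)) (m + 1)) := by
    intro m n hmn
    have hmn' : (m : ℝ) ≤ n := by exact_mod_cast hmn
    refine ODE_solution_unique_of_mem_Ioo (v := fun _ => X) (s := fun _ => univ) (K := K) (t₀ := 0)
      (fun _ _ => hK.lipschitzOnWith) ⟨by linarith [m.cast_nonneg (α := ℝ)], by positivity⟩
      (fun t ht => ⟨hγ m t ht, trivial⟩)
      (fun t ht => ⟨hγ n t ⟨by linarith [ht.1], by linarith [ht.2]⟩, trivial⟩) (by rw [h0, h0])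
  have hmem : ∀ t : ℝ, t ∈ Ioo (-((⌈|t|⌉₊ : ℝ) + 1)) ((⌈|t|⌉₊ : ℝ) + 1) := by
    intro t
    rw [mem_Ioo, ← abs_lt]
    linarith [Nat.le_ceil |t|]
  refine ⟨fun t => γ ⌈|t|⌉₊ t, by simp [h0], fun t => ?_⟩
  refine (hγ _ t (hmem t)).congr_of_eventuallyEq ?_
  filter_upwards [Ioo_mem_nhds (hmem t).1 (hmem t).2] with s hs
  rcases le_total ⌈|s|⌉₊ ⌈|t|⌉₊ with h | h
  · exact agree _ _ h (hmem s)
  · exact (agree _ _ h hs).symm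

/-- Cutting off a `C¹` vector field outside a ball makes it Lipschitz and bounded. -/
theorem exists_lipschitzWith_eqOn_closedBall [FiniteDimensional ℝ E] (hX : ContDiff ℝ 1 X)
    (R : ℝ) : ∃ (Y : E → E) (K L : NNReal), LipschitzWith K Y ∧ (∀ z, ‖Y z‖ ≤ L) ∧
      EqOn Y X (Metric.closedBall 0 R) := by
  let f : ContDiffBump (0 : E) := ⟨max R 1, max R 1 + 1, by positivity, by linarith⟩
  have hc : HasCompactSupport (fun z => f z • X z) := f.hasCompactSupport.smul_right
  have hd : ContDiff ℝ 1 (fun z => f z • X z) := f.contDiff.smul hX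
  obtain ⟨K, hK⟩ := hd.lipschitzWith_of_hasCompactSupport hc one_ne_zero
  obtain ⟨L, hL⟩ := hc.exists_bound_of_continuous hd.continuous
  refine ⟨_, K, L.toNNReal, hK, fun z => (hL z).trans (Real.le_coe_toNNReal L), fun z hz => ?_⟩
  have : f z = 1 := f.one_of_mem_closedBall
    (Metric.closedBall_subset_closedBall (le_max_left _ _) hz)
  simp [this]

/-- Lipschitz dependence on the initial point along a compact piece of orbit, including the
existence of the nearby orbits. -/
theorem IsIntegralCurveOn.exists_nearby [FiniteDimensional ℝ E] (hX : ContDiff ℝ 1 X) {T : ℝ}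
    (hγ : IsIntegralCurveOn γ (fun _ => X) (Icc 0 T)) :
    ∃ C > 0, ∃ δ > 0, ∀ q, ‖q - γ 0‖ < δ → ∃ η : ℝ → E, η 0 = q ∧
      IsIntegralCurveOn η (fun _ => X) (Icc 0 T) ∧
      ∀ t ∈ Icc 0 T, ‖η t - γ t‖ ≤ C * ‖q - γ 0‖ := by
  obtain ⟨R, hR⟩ := (isCompact_Icc.image_of_continuousOn hγ.continuousOn).isBounded.exists_norm_le
  have hR' : ∀ t ∈ Icc 0 T, ‖γ t‖ ≤ R := fun t ht => hR _ (mem_image_of_mem _ ht)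
  obtain ⟨Y, K, L, hK, hL, hY⟩ := exists_lipschitzWith_eqOn_closedBall hX (R + 1)
  -- by Grönwall the nearby orbits stay in the unit neighbourhood of `γ`, where `Y = X`
  refine ⟨Real.exp (K * T), Real.exp_pos _, Real.exp (-(K * T)), Real.exp_pos _, fun q hq => ?_⟩
  obtain ⟨η, h0, hη⟩ := exists_isIntegralCurve_of_lipschitzWith hK hL q
  have hb : ∀ t ∈ Icc 0 T, ‖η t - γ t‖ ≤ Real.exp (K * T) * ‖q - γ 0‖ := by
    intro t ht
    have := dist_le_of_trajectories_ODE (v := fun _ => Y) (K := K) (f := η) (g := γ) (a := 0)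
      (b := T) (δ := ‖q - γ 0‖) (fun _ => hK) (hη.continuous.continuousOn)
      (fun s _ => (hη s).hasDerivWithinAt) hγ.continuousOn
      (fun s hs => by
        have hs' := Ico_subset_Icc_self hs
        have hz : γ s ∈ Metric.closedBall (0 : E) (R + 1) :=
          mem_closedBall_zero_iff.2 (by linarith [hR' s hs'])
        simp only [hY hz]
        exact (hγ s hs').Ici_of_Icc hs) (by rw [h0, dist_eq_norm]) t ht
    rw [dist_eq_norm] at this
    refine this.trans ?_
    rw [mul_comm]
    gcongr
    linarith [ht.2]
  refine ⟨η, h0, fun t ht => ?_, hb⟩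
  have h1 : ‖η t - γ t‖ ≤ 1 := by
    refine (hb t ht).trans ?_
    calc Real.exp (K * T) * ‖q - γ 0‖ ≤ Real.exp (K * T) * Real.exp (-(K * T)) := by gcongr
      _ = 1 := by rw [← Real.exp_add]; simp
  have hz : η t ∈ Metric.closedBall (0 : E) (R + 1) := by
    refine mem_closedBall_zero_iff.2 ?_
    calc ‖η t‖ = ‖γ t + (η t - γ t)‖ := by abel_nf
      _ ≤ ‖γ t‖ + ‖η t - γ t‖ := norm_add_le _ _
      _ ≤ R + 1 := add_le_add (hR' t ht) h1
  have := (hη t).hasDerivWithinAt (s := Icc 0 T)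
  simpa only [hY hz] using this

/-- An orbit that obeys an a priori bound as long as it exists, exists for all positive times. -/
theorem exists_isIntegralCurveOn_Ici [FiniteDimensional ℝ E] (hX : ContDiff ℝ 1 X) {p : E} {R : ℝ}
    (hR : ∀ T ≥ 0, ∀ η : ℝ → E, η 0 = p → IsIntegralCurveOn η (fun _ => X) (Icc 0 T) →
      ‖η T‖ ≤ R) :
    ∃ γ : ℝ → E, γ 0 = p ∧ IsIntegralCurveOn γ (fun _ => X) (Ici 0) := by
  obtain ⟨Y, K, L, hK, hL, hY⟩ := exists_lipschitzWith_eqOn_closedBall hX (R + 1)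
  obtain ⟨γ, h0, hγ⟩ := exists_isIntegralCurve_of_lipschitzWith hK hL p
  have step : ∀ T ≥ 0, (∀ t ∈ Icc 0 T, ‖γ t‖ ≤ R + 1) → ‖γ T‖ ≤ R := by
    intro T hT hb
    refine hR T hT γ h0 fun t ht => ?_
    have := (hγ t).hasDerivWithinAt (s := Icc 0 T)
    simpa only [hY (mem_closedBall_zero_iff.2 (hb t ht))] using this
  have hle : ∀ t ≥ 0, ‖γ t‖ ≤ R + 1 := by
    by_contra! hcon
    obtain ⟨t, ht, hlt⟩ := hcon
    -- the first time at which the orbit reaches the sphere of radius `R + 1`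
    set A := Icc 0 t ∩ {s | R + 1 ≤ ‖γ s‖}
    have hA : IsCompact A := isCompact_Icc.inter_right
      (isClosed_le continuous_const hγ.continuous.norm)
    obtain ⟨m, hm, hmin⟩ := hA.exists_isLeast ⟨t, ⟨ht, le_rfl⟩, hlt.le⟩
    have hlt' : ∀ s ∈ Ico 0 m, ‖γ s‖ < R + 1 := fun s hs => by
      by_contra! h
      exact absurd (hmin ⟨⟨hs.1, hs.2.le.trans hm.1.2⟩, h⟩) (not_le.2 hs.2)
    have hm1 : ‖γ m‖ ≤ R + 1 := by
      rcases hm.1.1.eq_or_lt with h | h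
      · have := hR 0 le_rfl γ h0 (fun s hs => by
          obtain rfl : s = 0 := le_antisymm hs.2 hs.1
          exact HasFDerivWithinAt.of_subsingleton (subsingleton_Icc_of_ge le_rfl))
        rw [← h]; linarith
      · refine le_of_tendsto (f := γ |> fun g s => ‖g s‖) (x := 𝓝[<] m)
          (hγ.continuous.norm.continuousAt.tendsto.mono_left nhdsWithin_le_nhds) ?_
        filter_upwards [Ioo_mem_nhdsLT h] with s hs using (hlt' s ⟨hs.1.le, hs.2⟩).le
    have := step m hm.1.1 fun s hs => by
      rcases hs.2.eq_or_lt with h | h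
      · rwa [h]
      · exact (hlt' s ⟨hs.1, h⟩).le
    have h2 : R + 1 ≤ ‖γ m‖ := hm.2
    linarith
  refine ⟨γ, h0, fun t ht => ?_⟩
  have := (hγ t).hasDerivWithinAt (s := Ici 0)
  simpa only [hY (mem_closedBall_zero_iff.2 (hle t ht))] using this

/-- Concatenation of two integral curves that meet at time `a`. -/
theorem IsIntegralCurveOn.concat {a : ℝ} (h₁ : IsIntegralCurveOn γ (fun _ => X) (S ∩ Iic a))
    (h₂ : IsIntegralCurveOn η (fun _ => X) (S ∩ Ici a)) (h : γ a = η a) :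
    IsIntegralCurveOn (fun t => if t ≤ a then γ t else η t) (fun _ => X) S := by
  intro t ht
  have e₁ : EqOn (fun t => if t ≤ a then γ t else η t) γ (S ∩ Iic a) := fun s hs => by
    simp [show s ≤ a from hs.2]
  have e₂ : EqOn (fun t => if t ≤ a then γ t else η t) η (S ∩ Ici a) := fun s hs => by
    rcases (show a ≤ s from hs.2).eq_or_lt with rfl | h'
    · simp [h]
    · simp [not_le.2 h']
  rcases lt_trichotomy t a with hta | rfl | hta
  · have h3 := (h₁ t ⟨ht, hta.le⟩).congr_of_mem e₁ ⟨ht, hta.le⟩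
    rw [hasDerivWithinAt_inter (Iic_mem_nhds hta)] at h3
    simpa [hta.le] using h3
  · have h3 := (h₁ t ⟨ht, le_refl t⟩).congr_of_mem e₁ ⟨ht, le_refl t⟩
    have h4 := (h₂ t ⟨ht, le_refl t⟩).congr_of_mem e₂ ⟨ht, le_refl t⟩
    rw [← h] at h4
    have h5 := h3.union h4
    rw [← inter_union_distrib_left, Iic_union_Ici, inter_univ] at h5
    simpa using h5
  · have h3 := (h₂ t ⟨ht, hta.le⟩).congr_of_mem e₂ ⟨ht, hta.le⟩
    rw [hasDerivWithinAt_inter (Ici_mem_nhds hta)] at h3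
    simpa [not_le.2 hta] using h3

/-- Integral curves on `(-∞, 0]` which agree at some time agree at time `0`. -/
theorem IsIntegralCurveOn.eq_zero_of_eq [FiniteDimensional ℝ E] (hX : ContDiff ℝ 1 X) {s : ℝ}
    (hs : s ≤ 0) (h₁ : IsIntegralCurveOn γ (fun _ => X) (Iic 0))
    (h₂ : IsIntegralCurveOn η (fun _ => X) (Iic 0)) (h : γ s = η s) : γ 0 = η 0 := by
  have hm : MapsTo (· + s) (Icc 0 (-s)) (Iic 0) := fun t ht => by
    have := ht.2
    simp only [mem_Iic]; linarith
  have := IsIntegralCurveOn.eqOn_Icc hX (h₁.shift s hm) (h₂.shift s hm) (by simpa using h)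
    (show -s ∈ Icc 0 (-s) from ⟨by linarith, le_rfl⟩)
  simpa using this

theorem IsIntegralCurve.isIntegralCurveOn_shift (h : IsIntegralCurve γ (fun _ => X)) (a : ℝ)
    (S : Set ℝ) : IsIntegralCurveOn (fun t => γ (t + a)) (fun _ => X) S :=
  (h.isIntegralCurveOn univ).shift a (mapsTo_univ _ _)

/-- Backward orbits depend Lipschitz continuously on their end point. -/
theorem IsIntegralCurveOn.exists_norm_sub_le_of_Iic [FiniteDimensional ℝ E] (hX : ContDiff ℝ 1 X)
    (hγ : IsIntegralCurveOn γ (fun _ => X) (Iic 0)) {s : ℝ} (hs : s ≤ 0) :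
    ∃ C > 0, ∃ δ > 0, ∀ η : ℝ → E, IsIntegralCurveOn η (fun _ => X) (Iic 0) →
      ‖η 0 - γ 0‖ < δ → ‖η s - γ s‖ ≤ C * ‖η 0 - γ 0‖ := by
  have hm : MapsTo (fun t : ℝ => -t) (Icc 0 (-s)) (Iic 0) := fun t ht => by
    have := ht.1
    simp only [mem_Iic]; linarith
  have hs' : -s ∈ Icc 0 (-s) := ⟨by linarith, le_rfl⟩
  obtain ⟨C, hC, δ, hδ, h⟩ := IsIntegralCurveOn.exists_nearby hX.neg (hγ.reverse hm)
  refine ⟨C, hC, δ, hδ, fun η hη h0 => ?_⟩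
  obtain ⟨ζ, hζ0, hζ, hζd⟩ := h (η 0) (by simpa using h0)
  have := hζd (-s) hs'
  rw [IsIntegralCurveOn.eqOn_Icc hX.neg hζ (hη.reverse hm) (by simpa using hζ0) hs'] at this
  simpa using this

end IntegralCurves

/-! ### Scalar differential inequalities -/

section Scalar

variable {f : ℝ → ℝ} {S : Set ℝ}

theorem Convex.eqOn_const_of_hasDerivWithinAt_zero (hS : Convex ℝ S)
    (h : ∀ t ∈ S, HasDerivWithinAt f 0 S t) {s t : ℝ} (hs : s ∈ S) (ht : t ∈ S) : f t = f s := by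
  have := hS.norm_image_sub_le_of_norm_hasDerivWithin_le (C := 0) h (by simp) hs ht
  simpa [sub_eq_zero] using this

theorem eq_mul_exp_integral_of_hasDerivWithinAt {a : ℝ → ℝ} (ha : Continuous a) (hS : Convex ℝ S)
    (h0 : 0 ∈ S) (h : ∀ t ∈ S, HasDerivWithinAt f (a t * f t) S t) {t : ℝ} (ht : t ∈ S) :
    f t = f 0 * Real.exp (∫ s in (0 : ℝ)..t, a s) := by
  have hA : ∀ t, HasDerivAt (fun t => ∫ s in (0 : ℝ)..t, a s) (a t) t := fun t =>
    intervalIntegral.integral_hasDerivAt_right (ha.intervalIntegrable _ _)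
      (ha.stronglyMeasurableAtFilter _ _) ha.continuousAt
  have := hS.eqOn_const_of_hasDerivWithinAt_zero
    (f := fun t => f t * Real.exp (-∫ s in (0 : ℝ)..t, a s))
    (fun s hs => ((h s hs).mul (hA s).neg.exp.hasDerivWithinAt).congr_deriv (by ring)) h0 ht
  simp only [intervalIntegral.integral_same, neg_zero, Real.exp_zero, mul_one] at this
  rw [← this, mul_assoc, ← Real.exp_add]
  simp

theorem eq_mul_exp_of_hasDerivWithinAt {k : ℝ} (hS : Convex ℝ S)
    (h0 : 0 ∈ S) (h : ∀ t ∈ S, HasDerivWithinAt f (k * f t) S t) {t : ℝ} (ht : t ∈ S) :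
    f t = f 0 * Real.exp (k * t) := by
  have := eq_mul_exp_integral_of_hasDerivWithinAt (a := fun _ => k) continuous_const hS h0 h ht
  simpa [mul_comm] using this

/-- A function with `f' ≤ -k f` decays like `exp (-k t)`. -/
theorem le_mul_exp_of_hasDerivWithinAt {f' : ℝ → ℝ} {k T : ℝ}
    (h : ∀ t ∈ Icc 0 T, HasDerivWithinAt f (f' t) (Icc 0 T) t)
    (hf' : ∀ t ∈ Icc 0 T, f' t ≤ -k * f t) {t : ℝ} (ht : t ∈ Icc 0 T) :
    f t ≤ f 0 * Real.exp (-k * t) := by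
  have hd : ∀ t ∈ Icc 0 T, HasDerivWithinAt (fun t => f t * Real.exp (k * t))
      (f' t * Real.exp (k * t) + f t * (Real.exp (k * t) * (k * 1))) (Icc 0 T) t := fun t ht =>
    (h t ht).mul ((hasDerivAt_id t).const_mul k).exp.hasDerivWithinAt
  have := image_le_of_deriv_right_le_deriv_boundary (B := fun _ => f 0) (B' := fun _ => 0)
    (fun s hs => (hd s hs).continuousWithinAt)
    (fun s hs => (hd s (Ico_subset_Icc_self hs)).Ici_of_Icc hs) (by simp) continuousOn_const
    (fun s _ => hasDerivWithinAt_const _ _ _) (fun s hs => by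
      have := mul_le_mul_of_nonneg_right (hf' s (Ico_subset_Icc_self hs)) (Real.exp_pos (k * s)).le
      linarith) ht
  calc f t = f t * Real.exp (k * t) * Real.exp (-k * t) := by
        rw [mul_assoc, ← Real.exp_add]; simp
    _ ≤ _ := by gcongr

/-- The previous decay estimate when the differential inequality is only known below the level
`ρ`: the function cannot climb to that level. -/
theorem le_mul_exp_of_hasDerivWithinAt_of_lt {f' : ℝ → ℝ} {k T ρ : ℝ} (hk : 0 < k) (hρ : 0 < ρ)
    (h : ∀ t ∈ Icc 0 T, HasDerivWithinAt f (f' t) (Icc 0 T) t)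
    (hf' : ∀ t ∈ Icc 0 T, f t ≤ ρ → f' t ≤ -k * f t) (h0 : f 0 ≤ ρ) {t : ℝ} (ht : t ∈ Icc 0 T) :
    f t ≤ f 0 * Real.exp (-k * t) := by
  have hle : ∀ t ∈ Icc 0 T, f t ≤ ρ := fun t ht =>
    image_le_of_deriv_right_lt_deriv_boundary' (B := fun _ => ρ) (B' := fun _ => 0)
      (fun s hs => (h s hs).continuousWithinAt)
      (fun s hs => (h s (Ico_subset_Icc_self hs)).Ici_of_Icc hs) h0 continuousOn_const
      (fun s _ => hasDerivWithinAt_const _ _ _) (fun s hs e => by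
        have := hf' s (Ico_subset_Icc_self hs) e.le
        rw [e] at this
        nlinarith) ht
  exact le_mul_exp_of_hasDerivWithinAt h (fun s hs => hf' s hs (hle s hs)) ht

/-- A function on `(-∞, 0]` that is bounded above and satisfies `f' ≤ -f` is nonpositive: otherwise
it would grow backwards in time. -/
theorem nonpos_of_hasDerivWithinAt_le_neg {f f' : ℝ → ℝ} {M : ℝ}
    (h : ∀ t ∈ Iic (0 : ℝ), HasDerivWithinAt f (f' t) (Iic 0) t)
    (hf' : ∀ t ∈ Iic (0 : ℝ), f' t ≤ -f t) (hM : ∀ t ∈ Iic (0 : ℝ), f t ≤ M) {t : ℝ}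
    (ht : t ≤ 0) : f t ≤ 0 := by
  have key : ∀ s ≥ 0, f t ≤ M * Real.exp (-s) := by
    intro s hs
    have hm : MapsTo (· + (t - s)) (Icc 0 s) (Iic 0) := fun r hr => by
      have := hr.2
      simp only [mem_Iic]; linarith
    have h1 : ∀ r ∈ Icc 0 s, HasDerivWithinAt (fun r => f (r + (t - s))) (f' (r + (t - s)))
        (Icc 0 s) r := fun r hr => by
      have h2 : HasDerivWithinAt (fun r : ℝ => r + (t - s)) 1 (Icc 0 s) r :=
        ((hasDerivAt_id r).add_const _).hasDerivWithinAt
      simpa [Function.comp_def] using (h _ (hm hr)).scomp r h2 hm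
    have h3 := le_mul_exp_of_hasDerivWithinAt (k := 1) h1
      (fun r hr => by simpa using hf' _ (hm hr)) (right_mem_Icc.2 hs)
    simp only [add_sub_cancel, zero_add, neg_mul, one_mul] at h3
    refine h3.trans ?_
    gcongr
    exact hM _ (by simp only [mem_Iic]; linarith)
  have hlim : Tendsto (fun s => M * Real.exp (-s)) atTop (𝓝 (M * 0)) :=
    Real.tendsto_exp_neg_atTop_nhds_zero.const_mul M
  rw [mul_zero] at hlim
  exact ge_of_tendsto hlim (eventually_atTop.2 ⟨0, key⟩)

/-- Solutions of the scalar linear equation `f' = a f` keep their sign. The retraction `π` of `ℝ`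
onto the time set `S` serves to extend the coefficient `a` continuously. -/
theorem exists_pos_eq_mul_of_hasDerivWithinAt {f a π : ℝ → ℝ} {S : Set ℝ} (hS : Convex ℝ S)
    (h0 : 0 ∈ S) (hπ : Continuous π) (hπS : ∀ t, π t ∈ S) (hid : ∀ t ∈ S, π t = t)
    (ha : ContinuousOn a S) (h : ∀ t ∈ S, HasDerivWithinAt f (a t * f t) S t) {t : ℝ} (ht : t ∈ S) :
    ∃ c > 0, f t = f 0 * c :=
  ⟨_, Real.exp_pos _, eq_mul_exp_integral_of_hasDerivWithinAt (a := a ∘ π)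
    (ha.comp_continuous hπ hπS) hS h0 (fun t ht => by simpa [hid t ht] using h t ht) ht⟩

/-- Barbalat's lemma: if `f` converges and `f'` has a bounded derivative then `f' → 0`. -/
theorem tendsto_deriv_zero_of_tendsto {f g g' : ℝ → ℝ} {ℓ M : ℝ} (hM : 0 < M)
    (hf : ∀ t > 0, HasDerivAt f (g t) t) (hg : ∀ t > 0, HasDerivAt g (g' t) t)
    (hb : ∀ t > 0, |g' t| ≤ M) (hlim : Tendsto f atTop (𝓝 ℓ)) : Tendsto g atTop (𝓝 0) := by
  rw [Metric.tendsto_nhds]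
  intro ε hε
  set h := ε / (2 * M) with hh
  have hh0 : 0 < h := by positivity
  have h1 : Tendsto (fun t => f (t + h) - f t) atTop (𝓝 (ℓ - ℓ)) :=
    (hlim.comp (tendsto_atTop_add_const_right _ _ tendsto_id)).sub hlim
  rw [sub_self, Metric.tendsto_nhds] at h1
  filter_upwards [h1 (ε / 2 * h) (by positivity), eventually_gt_atTop 0] with t ht ht0
  rw [dist_zero_right, Real.norm_eq_abs] at ht ⊢
  obtain ⟨c, hc, hfc⟩ := exists_hasDerivAt_eq_slope f g (by linarith : t < t + h)
    (fun s hs => (hf s (by linarith [hs.1])).continuousAt.continuousWithinAt)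
    (fun s hs => hf s (by linarith [hs.1]))
  have h2 : |g c| < ε / 2 := by
    rw [hfc, add_sub_cancel_left, abs_div, abs_of_pos hh0, div_lt_iff₀ hh0]
    exact ht
  have h3 : |g c - g t| ≤ M * (c - t) := by
    have := (convex_Icc t c).norm_image_sub_le_of_norm_hasDerivWithin_le (C := M) (f := g)
      (fun s hs => (hg s (by linarith [hs.1])).hasDerivWithinAt)
      (fun s hs => hb s (by linarith [hs.1])) (left_mem_Icc.2 hc.1.le) (right_mem_Icc.2 hc.1.le)
    rwa [Real.norm_eq_abs, Real.norm_eq_abs, abs_of_pos (by linarith [hc.1] : 0 < c - t)] at this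
  have h4 : M * (c - t) ≤ ε / 2 := by
    calc M * (c - t) ≤ M * h := by gcongr; linarith [hc.2]
      _ = ε / 2 := by rw [hh]; field_simp
  calc |g t| = |g c - (g c - g t)| := by ring_nf
    _ ≤ |g c| + |g c - g t| := abs_sub _ _
    _ < ε := by linarith

/-- Solutions of `f' ≤ -k f + e` with a forcing term `e → 0` tend to zero. -/
theorem tendsto_zero_of_deriv_le {f f' e : ℝ → ℝ} {k : ℝ} (hk : 0 < k) (h0 : ∀ t > 0, 0 ≤ f t)
    (hf : ∀ t > 0, HasDerivAt f (f' t) t) (hf' : ∀ t > 0, f' t ≤ -k * f t + e t)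
    (he : Tendsto e atTop (𝓝 0)) : Tendsto f atTop (𝓝 0) := by
  rw [Metric.tendsto_nhds]
  intro ε hε
  obtain ⟨T, hT, hT0⟩ := ((eventually_forall_ge_atTop.2
    (he.eventually (gt_mem_nhds (by positivity : 0 < k * (ε / 2))))).and
      (eventually_gt_atTop 0)).exists
  have key : ∀ s ≥ 0, f (s + T) - ε / 2 ≤ (f (0 + T) - ε / 2) * Real.exp (-k * s) := fun s hs =>
    le_mul_exp_of_hasDerivWithinAt (T := s) (f := fun s => f (s + T) - ε / 2)
      (f' := fun s => f' (s + T))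
      (fun t ht => ((hf (t + T) (by linarith [ht.1])).comp_add_const t T).sub_const _
        |>.hasDerivWithinAt)
      (fun t ht => by
        have h1 := hf' (t + T) (by linarith [ht.1])
        have h2 := hT (t + T) (by linarith [ht.1])
        linarith) ⟨hs, le_rfl⟩
  have hlim : Tendsto (fun t => (f (0 + T) - ε / 2) * Real.exp (-k * (t - T))) atTop
      (𝓝 ((f (0 + T) - ε / 2) * 0)) := by
    refine Tendsto.const_mul _ (Real.tendsto_exp_atBot.comp ?_)
    exact (tendsto_id.atTop_add tendsto_const_nhds).const_mul_atTop_of_neg (by linarith)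
  rw [mul_zero] at hlim
  filter_upwards [hlim.eventually (gt_mem_nhds (by positivity : 0 < ε / 2)),
    eventually_ge_atTop T] with t ht htT
  have := key (t - T) (by linarith)
  rw [sub_add_cancel] at this
  rw [dist_zero_right, Real.norm_of_nonneg (h0 t (by linarith))]
  linarith

end Scalar

/-! ### The soliton system in the coordinates `(σ, x₂, J, a₂, Z, Γ)` -/

section SolitonChart

theorem contDiff_solitonField (p₁ p₂ : ℕ) (lam : ℝ) {n : WithTop ℕ∞} :
    ContDiff ℝ n (solitonField p₁ p₂ lam) := by
  rw [contDiff_pi]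
  intro i
  fin_cases i <;> simp [solitonField] <;> fun_prop

/-- The scaled chart `(σ/d², x₂/d², J/d², a₂/d, Z/d, Γ + p₁)` of `ℝ⁶`, where `a₂ = 1 + y₂` and
`Z = Γ + ∑ p_α (1 + y_α)`. It is centred at the good fill. The variable `x₁`, which is recovered
from `J`, does not occur in the field in this chart. -/
noncomputable def solitonChart (p₁ p₂ : ℕ) (d : ℝ) (z : Fin 6 → ℝ) : Fin 6 → ℝ :=
  ![z 5 / d ^ 2, z 2 / d ^ 2, solitonJ p₁ p₂ z / d ^ 2, (1 + z 3) / d,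
    (z 4 + (p₁ * (1 + z 1) + p₂ * (1 + z 3))) / d, z 4 + p₁]

/-- The inverse of `solitonChart`. -/
noncomputable def solitonChartInv (p₁ p₂ : ℕ) (d : ℝ) (u : Fin 6 → ℝ) : Fin 6 → ℝ :=
  ![(2 * (d ^ 2 * u 2) + (u 5 - p₁) ^ 2 - (d * u 4 - u 5 + p₁ - p₂ * (d * u 3)) ^ 2 / p₁
      - p₂ * (d ^ 2 * u 1) - p₂ * (d * u 3) ^ 2) / p₁,
    (d * u 4 - u 5 + p₁ - p₂ * (d * u 3)) / p₁ - 1,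
    d ^ 2 * u 1, d * u 3 - 1, u 5 - p₁, d ^ 2 * u 0]

/-- The soliton field in the chart `solitonChart p₁ p₂ d`. -/
noncomputable def solitonChartField (p₁ p₂ : ℕ) (lam d : ℝ) (u : Fin 6 → ℝ) : Fin 6 → ℝ :=
  ![2 * u 0,
    2 * u 1 - 2 * d * u 1 * u 3,
    2 * u 2 - lam * u 0 * ((d * u 4 - u 5 - p₂ * d * u 3)
      + (d * u 4 - u 5 - p₂ * d * u 3) ^ 2 / p₁ + p₂ * d ^ 2 * u 3 ^ 2 - p₂ * d * u 3),
    -(p₁ - 1) * u 3 + d * (u 1 + lam * u 0) + (u 5 * u 3 - lam * d ^ 2 * u 0 * u 3),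
    -(p₁ - 1) * u 4 + d * (2 * u 2 + lam * p₂ * u 0)
      + (u 5 * u 4 - lam * d * u 0 * (d * u 4 - u 5)),
    -u 5 + d * (2 * u 4 - 2 * p₂ * u 3)
      + ((d * u 4 - u 5 - p₂ * d * u 3) ^ 2 / p₁ + p₂ * d ^ 2 * u 3 ^ 2)]

variable {p₁ p₂ : ℕ} {lam d : ℝ}

theorem continuous_solitonJ : Continuous (solitonJ p₁ p₂) := by
  unfold solitonJ; fun_prop

theorem contDiff_solitonChart {n : WithTop ℕ∞} : ContDiff ℝ n (solitonChart p₁ p₂ d) := by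
  rw [contDiff_pi]
  intro i
  fin_cases i <;> simp [solitonChart, solitonJ] <;> fun_prop

theorem continuous_solitonChart : Continuous (solitonChart p₁ p₂ d) :=
  (contDiff_solitonChart (n := 0)).continuous

theorem contDiff_solitonChartInv {n : WithTop ℕ∞} : ContDiff ℝ n (solitonChartInv p₁ p₂ d) := by
  rw [contDiff_pi]
  intro i
  fin_cases i <;> simp [solitonChartInv] <;> fun_prop

theorem solitonChartInv_solitonChart (hp₁ : p₁ ≠ 0) (hd : d ≠ 0) (z : Fin 6 → ℝ) :
    solitonChartInv p₁ p₂ d (solitonChart p₁ p₂ d z) = z := by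
  have h : (p₁ : ℝ) ≠ 0 := by exact_mod_cast hp₁
  ext i
  fin_cases i <;> simp [solitonChartInv, solitonChart, solitonJ] <;> field_simp <;> ring

theorem solitonChart_solitonChartInv (hp₁ : p₁ ≠ 0) (hd : d ≠ 0) (u : Fin 6 → ℝ) :
    solitonChart p₁ p₂ d (solitonChartInv p₁ p₂ d u) = u := by
  have h : (p₁ : ℝ) ≠ 0 := by exact_mod_cast hp₁
  ext i
  fin_cases i <;> simp [solitonChartInv, solitonChart, solitonJ] <;> field_simp <;> ring

theorem solitonChart_goodFill : solitonChart p₁ p₂ d (goodFill p₁) = 0 := by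
  ext i
  fin_cases i <;> simp [solitonChart, goodFill, solitonJ]
  left; ring

theorem solitonChartInv_zero (hp₁ : p₁ ≠ 0) (hd : d ≠ 0) :
    solitonChartInv p₁ p₂ d 0 = goodFill p₁ := by
  rw [← solitonChart_goodFill (p₂ := p₂) (d := d), solitonChartInv_solitonChart hp₁ hd]

/-- Along the soliton flow `J' = 2 J - λ σ ∑ p_α y_α (1 + y_α)`. -/
theorem hasDerivWithinAt_solitonJ {z : ℝ → Fin 6 → ℝ} {S : Set ℝ} {t : ℝ}
    (h : HasDerivWithinAt z (solitonField p₁ p₂ lam (z t)) S t) :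
    HasDerivWithinAt (fun s => solitonJ p₁ p₂ (z s)) (2 * solitonJ p₁ p₂ (z t)
      - lam * z t 5 * (p₁ * z t 1 * (1 + z t 1) + p₂ * z t 3 * (1 + z t 3))) S t := by
  rw [hasDerivWithinAt_pi] at h
  have h0 := h 0
  have h1 := h 1
  have h2 := h 2
  have h3 := h 3
  have h4 := h 4
  simp only [solitonField, Matrix.cons_val] at h0 h1 h2 h3 h4
  have := (((h0.add ((h1.const_add 1).pow 2)).const_mul (p₁ : ℝ)).add
    ((h2.add ((h3.const_add 1).pow 2)).const_mul (p₂ : ℝ))).const_mul (1 / 2 : ℝ) |>.sub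
    ((h4.pow 2).const_mul (1 / 2 : ℝ))
  refine (this.congr_deriv ?_).congr_of_eventuallyEq (.of_forall fun s => ?_) ?_
  · simp [solitonJ]; ring
  · simp [solitonJ]
  · simp [solitonJ]

/-- The chart carries integral curves of the soliton field to those of `solitonChartField`. -/
theorem hasDerivWithinAt_solitonChart (hp₁ : p₁ ≠ 0) (hd : d ≠ 0) {z : ℝ → Fin 6 → ℝ} {S : Set ℝ}
    {t : ℝ} (h : HasDerivWithinAt z (solitonField p₁ p₂ lam (z t)) S t) :
    HasDerivWithinAt (fun s => solitonChart p₁ p₂ d (z s))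
      (solitonChartField p₁ p₂ lam d (solitonChart p₁ p₂ d (z t))) S t := by
  have hp : (p₁ : ℝ) ≠ 0 := by exact_mod_cast hp₁
  have hJ := hasDerivWithinAt_solitonJ h
  rw [hasDerivWithinAt_pi] at h ⊢
  have h1 := h 1
  have h2 := h 2
  have h3 := h 3
  have h4 := h 4
  have h5 := h 5
  simp only [solitonField, Matrix.cons_val] at h1 h2 h3 h4 h5
  intro i
  fin_cases i <;> simp only [solitonChart, solitonChartField, Matrix.cons_val, Fin.reduceFinMk,
    Fin.zero_eta, Fin.mk_one]
  · exact (h5.div_const _).congr_deriv (by ring)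
  · exact (h2.div_const _).congr_deriv (by field_simp; ring)
  · exact (hJ.div_const _).congr_deriv (by field_simp; ring)
  · exact ((h3.const_add 1).div_const _).congr_deriv (by field_simp; ring)
  · exact ((h4.add (((h1.const_add 1).const_mul (p₁ : ℝ)).add
      ((h3.const_add 1).const_mul (p₂ : ℝ)))).div_const _).congr_deriv
      (by simp only [solitonJ]; field_simp; ring)
  · exact (h4.add_const _).congr_deriv (by field_simp; ring)

/-- The inverse chart carries integral curves of `solitonChartField` to those of the soliton
field. -/
theorem hasDerivWithinAt_solitonChartInv (hp₁ : p₁ ≠ 0) {u : ℝ → Fin 6 → ℝ}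
    {S : Set ℝ} {t : ℝ} (h : HasDerivWithinAt u (solitonChartField p₁ p₂ lam d (u t)) S t) :
    HasDerivWithinAt (fun s => solitonChartInv p₁ p₂ d (u s))
      (solitonField p₁ p₂ lam (solitonChartInv p₁ p₂ d (u t))) S t := by
  have hp : (p₁ : ℝ) ≠ 0 := by exact_mod_cast hp₁
  rw [hasDerivWithinAt_pi] at h ⊢
  have h0 := h 0
  have h1 := h 1
  have h2 := h 2
  have h3 := h 3
  have h4 := h 4
  have h5 := h 5
  simp only [solitonChartField, Matrix.cons_val] at h0 h1 h2 h3 h4 h5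
  have ha := (((h4.const_mul d).sub h5).add_const (p₁ : ℝ)).sub
    ((h3.const_mul d).const_mul (p₂ : ℝ))
  intro i
  fin_cases i <;> simp only [solitonChartInv, solitonField, Matrix.cons_val, Fin.reduceFinMk,
    Fin.zero_eta, Fin.mk_one]
  · have := ((((((h2.const_mul (d ^ 2)).const_mul 2).add ((h5.sub_const (p₁ : ℝ)).pow 2)).sub
      ((ha.pow 2).div_const (p₁ : ℝ))).sub ((h1.const_mul (d ^ 2)).const_mul (p₂ : ℝ))).sub
      (((h3.const_mul d).pow 2).const_mul (p₂ : ℝ))).div_const (p₁ : ℝ)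
    exact this.congr_deriv (by simp only [Pi.sub_apply]; field_simp; ring)
  · exact ((ha.div_const (p₁ : ℝ)).sub_const 1).congr_deriv (by field_simp; ring)
  · exact (h1.const_mul _).congr_deriv (by ring)
  · exact ((h3.const_mul _).sub_const 1).congr_deriv (by ring)
  · exact (h5.sub_const _).congr_deriv (by field_simp; ring)
  · exact (h0.const_mul _).congr_deriv (by ring)

end SolitonChart

/-! ### The Ricci-flat cone is a sink of the level set `σ = J = 0` -/

section Sink

/-- A quadratic Lyapunov function at the Ricci-flat cone in the coordinates
`ξ = x₂ - m`, `b = y₂`, `Z` and `h = Γ + n`, where `m = n - 1`. -/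
noncomputable def sinkForm (m ξ b Z h : ℝ) : ℝ :=
  ξ ^ 2 / 2 + m * b ^ 2 - ξ * b / 2 + 3 * h ^ 2 + 3 * Z ^ 2

theorem le_sinkForm {m ξ b Z h : ℝ} (hm : 3 ≤ m) :
    ξ ^ 2 / 4 + b ^ 2 + h ^ 2 + Z ^ 2 ≤ sinkForm m ξ b Z h := by
  unfold sinkForm
  nlinarith [sq_nonneg (ξ - b), sq_nonneg b, sq_nonneg Z, sq_nonneg h]

/-- The derivative of `sinkForm` along the linearization of the soliton field on `σ = J = 0`. -/
theorem sinkForm_linear_deriv_le {m ξ b Z h : ℝ} (hm : 3 ≤ m) :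
    -(2 * m ^ 2 - m) * b ^ 2 - ξ ^ 2 / 2 + m * ξ * b / 2 + 2 * m * b * h - ξ * h / 2
      + 6 * h * (-h + 2 * Z) - 6 * m * Z ^ 2 ≤ -(1 / 8) * (ξ ^ 2 + b ^ 2 + h ^ 2 + Z ^ 2) := by
  have e1 : m * ξ * b / 2 ≤ ξ ^ 2 / 4 + m ^ 2 * b ^ 2 / 4 := by nlinarith [sq_nonneg (ξ - m * b)]
  have e2 : 2 * m * b * h ≤ m ^ 2 * b ^ 2 / 2 + 2 * h ^ 2 := by
    nlinarith [sq_nonneg (m * b - 2 * h)]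
  have e3 : -(ξ * h / 2) ≤ ξ ^ 2 / 8 + h ^ 2 / 2 := by nlinarith [sq_nonneg (ξ + 2 * h)]
  have e4 : 12 * h * Z ≤ 3 * h ^ 2 + 12 * Z ^ 2 := by nlinarith [sq_nonneg (h - 2 * Z)]
  have e5 : 18 * Z ^ 2 ≤ 6 * m * Z ^ 2 := by nlinarith [sq_nonneg Z]
  have e6 : b ^ 2 ≤ (5 / 4 * m ^ 2 - m) * b ^ 2 :=
    le_mul_of_one_le_left (sq_nonneg b) (by nlinarith)
  linarith [sq_nonneg h, sq_nonneg Z, sq_nonneg b]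

/-- The derivative of `sinkForm` along the soliton field on `σ = J = 0`: near the cone the nonlinear
terms are absorbed by the linear ones. No bound on `Z` is needed, since it occurs in the cubic terms
only with the factor `h`. -/
theorem sinkForm_deriv_le {m p P ξ b Z h r : ℝ} (hm : 3 ≤ m) (hm7 : m ≤ 7) (hp : 2 ≤ p) (hP : 0 ≤ P)
    (hP6 : P ≤ 6) (hr : r ≤ 1 / 16000) (h1 : |ξ| ≤ r) (h2 : |b| ≤ r) (h4 : |h| ≤ r) :
    ξ * (-2 * m * b - 2 * ξ * b) + 2 * m * b * (ξ + h - m * b + h * b)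
      - ((-2 * m * b - 2 * ξ * b) * b + ξ * (ξ + h - m * b + h * b)) / 2
      + 6 * h * (-h + 2 * Z + (Z - h - P * b) ^ 2 / p + P * b ^ 2) + 6 * Z * ((-m + h) * Z)
      ≤ -(1 / 128) * sinkForm m ξ b Z h := by
  have hr0 : 0 ≤ r := (abs_nonneg _).trans h1
  set s := ξ ^ 2 + b ^ 2 + h ^ 2 + Z ^ 2 with hs
  have hs0 : 0 ≤ s := by positivity
  have prod : ∀ x y c : ℝ, |x| ≤ r → |y| ≤ c → x * y ≤ r * c := fun x y c hx hy =>
    (le_abs_self _).trans ((abs_mul x y).trans_le (mul_le_mul hx hy (abs_nonneg _) hr0))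
  have prod' : ∀ x y c : ℝ, |x| ≤ r → 0 ≤ y → y ≤ c → x * y ≤ r * c := fun x y c hx hy hc =>
    prod x y c hx (by rwa [abs_of_nonneg hy])
  have hξ := sq_nonneg ξ
  have hb := sq_nonneg b
  have hZ := sq_nonneg Z
  have hh := sq_nonneg h
  have lin := sinkForm_linear_deriv_le (ξ := ξ) (b := b) (Z := Z) (h := h) hm
  rw [← hs] at lin
  have hq0 : 0 ≤ (Z - h - P * b) ^ 2 / p := by positivity
  have hPb : (P * b) ^ 2 ≤ 36 * b ^ 2 := by
    rw [mul_pow]; gcongr; nlinarith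
  have hq : (Z - h - P * b) ^ 2 / p ≤ 54 * s := by
    have e : (Z - h - P * b) ^ 2 ≤ 108 * s := by
      linarith [sq_nonneg (Z + h), sq_nonneg (Z + P * b), sq_nonneg (h - P * b), sq_nonneg ξ,
        sq_nonneg Z, sq_nonneg h]
    rw [div_le_iff₀ (by linarith)]
    linarith [mul_nonneg hs0 (sub_nonneg.2 hp)]
  generalize (Z - h - P * b) ^ 2 / p = Q at hq0 hq ⊢
  have hPb2 : P * b ^ 2 ≤ 6 * s := by
    linarith [mul_nonneg (sub_nonneg.2 hP6) hb]
  have n1 : -b * (2 * ξ ^ 2) ≤ r * (2 * s) :=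
    prod' _ _ _ (by rwa [abs_neg]) (by linarith) (by linarith)
  have n2 : ξ * b ^ 2 ≤ r * s := prod' _ _ _ h1 hb (by linarith)
  have n3 : h * (2 * m * b ^ 2) ≤ r * (14 * s) :=
    prod' _ _ _ h4 (by positivity) (by linarith [mul_nonneg (sub_nonneg.2 hm7) hb])
  have n4 : h * (-(ξ * b) / 2) ≤ r * s := prod _ _ _ h4 (by
    rw [abs_le]; constructor <;> linarith [sq_nonneg (ξ + b), sq_nonneg (ξ - b)])
  have n5 : h * (6 * (Q + P * b ^ 2)) ≤ r * (360 * s) :=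
    prod' _ _ _ h4 (by positivity) (by linarith)
  have n6 : h * (6 * Z ^ 2) ≤ r * (6 * s) := prod' _ _ _ h4 (by positivity) (by linarith)
  have hrs : r * s ≤ 1 / 16000 * s := by gcongr
  have hV : sinkForm m ξ b Z h ≤ 8 * s := by
    unfold sinkForm
    linarith [sq_nonneg (ξ + b), mul_nonneg (sub_nonneg.2 hm7) hb]
  linarith

variable {p₁ p₂ : ℕ} {lam : ℝ}

/-- The Lyapunov function `sinkForm` on `ℝ⁶`. -/
noncomputable def sinkFunction (p₁ p₂ : ℕ) (z : Fin 6 → ℝ) : ℝ :=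
  sinkForm (p₁ + p₂ - 1) (solitonChart p₁ p₂ 1 z 1 - (p₁ + p₂ - 1)) (solitonChart p₁ p₂ 1 z 3 - 1)
    (solitonChart p₁ p₂ 1 z 4) (solitonChart p₁ p₂ 1 z 5 + p₂)

theorem continuous_sinkFunction : Continuous (sinkFunction p₁ p₂) := by
  have h := continuous_pi_iff.1 (continuous_solitonChart (p₁ := p₁) (p₂ := p₂) (d := 1))
  have h1 := h 1
  have h3 := h 3
  have h4 := h 4
  have h5 := h 5
  unfold sinkFunction sinkForm
  fun_prop

theorem sinkFunction_ricciFlatCone : sinkFunction p₁ p₂ (ricciFlatCone p₁ p₂) = 0 := by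
  simp [sinkFunction, sinkForm, solitonChart, ricciFlatCone]

theorem solitonJ_ricciFlatCone : solitonJ p₁ p₂ (ricciFlatCone p₁ p₂) = 0 := by
  simp [solitonJ, ricciFlatCone]
  ring

/-- On the level set `σ = J = 0` the sublevel sets of the Lyapunov function shrink to the
Ricci-flat cone. -/
theorem exists_sinkFunction_lt (hp₁ : 2 ≤ p₁) (hp₂ : 2 ≤ p₂) {ε : ℝ} (hε : 0 < ε) :
    ∃ s > 0, ∀ z, solitonSigma z = 0 → solitonJ p₁ p₂ z = 0 → sinkFunction p₁ p₂ z < s →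
      dist z (ricciFlatCone p₁ p₂) < ε := by
  have h1 : (2 : ℝ) ≤ p₁ := by exact_mod_cast hp₁
  have h2 : (2 : ℝ) ≤ p₂ := by exact_mod_cast hp₂
  have hc := (contDiff_solitonChartInv (p₁ := p₁) (p₂ := p₂) (d := 1)
    (n := 0)).continuous.continuousAt (x := solitonChart p₁ p₂ 1 (ricciFlatCone p₁ p₂))
  have hinv := solitonChartInv_solitonChart (p₁ := p₁) (p₂ := p₂) (d := 1) (by omega) one_ne_zero
  obtain ⟨δ, hδ, hc⟩ := Metric.continuousAt_iff.1 hc ε hε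
  refine ⟨δ ^ 2 / 4, by positivity, fun z hσ hJ hV => ?_⟩
  have := hc (x := solitonChart p₁ p₂ 1 z) ?_
  · rwa [hinv, hinv] at this
  have hle := le_sinkForm (m := p₁ + p₂ - 1) (ξ := solitonChart p₁ p₂ 1 z 1 - (p₁ + p₂ - 1))
    (b := solitonChart p₁ p₂ 1 z 3 - 1) (Z := solitonChart p₁ p₂ 1 z 4)
    (h := solitonChart p₁ p₂ 1 z 5 + p₂) (by linarith)
  change _ ≤ sinkFunction p₁ p₂ z at hle
  rw [dist_pi_lt_iff hδ]
  intro i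
  rw [Real.dist_eq]
  refine abs_lt_of_sq_lt_sq ?_ hδ.le
  have e : solitonChart p₁ p₂ 1 z 2 - solitonChart p₁ p₂ 1 (ricciFlatCone p₁ p₂) 2 = 0 := by
    change solitonJ p₁ p₂ z / 1 ^ 2 - solitonJ p₁ p₂ (ricciFlatCone p₁ p₂) / 1 ^ 2 = 0
    rw [hJ, solitonJ_ricciFlatCone]; simp
  have hδ2 : 0 < δ ^ 2 := by positivity
  fin_cases i
  on_goal 3 => simpa [e] using hδ2
  all_goals simp [solitonChart, ricciFlatCone] at hle ⊢
  · simp only [solitonSigma] at hσ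
    rw [hσ]; simpa using hδ2
  · nlinarith [sq_nonneg (1 + z 3 - 1), sq_nonneg (z 4 + p₁ + p₂),
      sq_nonneg (z 4 + (p₁ * (1 + z 1) + p₂ * (1 + z 3)))]
  · nlinarith [sq_nonneg (z 2 - (p₁ + p₂ - 1)), sq_nonneg (z 4 + p₁ + p₂),
      sq_nonneg (z 4 + (p₁ * (1 + z 1) + p₂ * (1 + z 3))), sq_nonneg (z 3)]
  · nlinarith [sq_nonneg (z 2 - (p₁ + p₂ - 1)), sq_nonneg (z 4 + p₁ + p₂),
      sq_nonneg (z 4 + (p₁ * (1 + z 1) + p₂ * (1 + z 3))), sq_nonneg (z 3)]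
  · nlinarith [sq_nonneg (z 2 - (p₁ + p₂ - 1)), sq_nonneg (z 4 + p₁ + p₂),
      sq_nonneg (z 4 + (p₁ * (1 + z 1) + p₂ * (1 + z 3))), sq_nonneg (z 3)]

end Sink

/-! ### The stable manifold of the Ricci-flat cone -/

section SinkDynamics

variable {p₁ p₂ : ℕ} {lam : ℝ} {z : ℝ → Fin 6 → ℝ} {S : Set ℝ}

theorem solitonSigma_eq_mul_exp (hz : IsIntegralCurveOn z (fun _ => solitonField p₁ p₂ lam) S)
    (hS : Convex ℝ S) (h0 : 0 ∈ S) {t : ℝ} (ht : t ∈ S) :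
    solitonSigma (z t) = solitonSigma (z 0) * Real.exp (2 * t) :=
  eq_mul_exp_of_hasDerivWithinAt (f := fun t => solitonSigma (z t)) hS h0
    (fun t ht => hasDerivWithinAt_pi.1 (hz t ht) 5) ht

theorem solitonJ_eq_mul_exp (hz : IsIntegralCurveOn z (fun _ => solitonField p₁ p₂ lam) S)
    (hS : Convex ℝ S) (h0 : 0 ∈ S) (hσ : solitonSigma (z 0) = 0) {t : ℝ} (ht : t ∈ S) :
    solitonJ p₁ p₂ (z t) = solitonJ p₁ p₂ (z 0) * Real.exp (2 * t) := by
  refine eq_mul_exp_of_hasDerivWithinAt (f := fun t => solitonJ p₁ p₂ (z t)) hS h0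
    (fun t ht => (hasDerivWithinAt_solitonJ (hz t ht)).congr_deriv ?_) ht
  have := solitonSigma_eq_mul_exp hz hS h0 ht
  rw [hσ, zero_mul, solitonSigma] at this
  rw [this]; ring

/-- A forward orbit converging to the Ricci-flat cone lies in `σ = J = 0`, since these quantities
grow like `exp (2 t)`. -/
theorem solitonSigma_solitonJ_eq_zero
    (hz : IsIntegralCurveOn z (fun _ => solitonField p₁ p₂ lam) (Ici 0))
    (hlim : Tendsto z atTop (𝓝 (ricciFlatCone p₁ p₂))) :
    solitonSigma (z 0) = 0 ∧ solitonJ p₁ p₂ (z 0) = 0 := by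
  have key : ∀ (f : ℝ → ℝ) (c : ℝ), Tendsto f atTop (𝓝 0) →
      (∀ t ∈ Ici (0 : ℝ), f t = c * Real.exp (2 * t)) → c = 0 := by
    intro f c hf h
    have h1 : Tendsto (fun t => f t * Real.exp (-(2 * t))) atTop (𝓝 (0 * 0)) :=
      hf.mul (Real.tendsto_exp_neg_atTop_nhds_zero.comp
        (tendsto_id.const_mul_atTop (by norm_num : (0 : ℝ) < 2)))
    have h2 : Tendsto (fun t => f t * Real.exp (-(2 * t))) atTop (𝓝 c) := by
      refine tendsto_const_nhds.congr' ?_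
      filter_upwards [eventually_ge_atTop 0] with t ht
      rw [h t ht, mul_assoc, ← Real.exp_add]
      simp
    simpa using tendsto_nhds_unique h2 h1
  have hσ : solitonSigma (z 0) = 0 := by
    refine key (fun t => solitonSigma (z t)) _ ?_ fun t ht =>
      solitonSigma_eq_mul_exp hz (convex_Ici 0) self_mem_Ici ht
    have := (tendsto_pi_nhds.1 hlim) 5
    simpa [solitonSigma, ricciFlatCone] using this
  refine ⟨hσ, key (fun t => solitonJ p₁ p₂ (z t)) _ ?_ fun t ht =>
    solitonJ_eq_mul_exp hz (convex_Ici 0) self_mem_Ici hσ ht⟩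
  have := ((continuous_solitonJ (p₁ := p₁) (p₂ := p₂)).tendsto _).comp hlim
  rwa [solitonJ_ricciFlatCone] at this

/-- The level `(1 / 16000)² / 4` confines `x₂ - m`, `y₂` and `Γ + n` to the radius `1 / 16000`
required by `sinkForm_deriv_le`. -/
theorem sinkFunction_le_mul_exp (hp₁ : 2 ≤ p₁) (hp₂ : 2 ≤ p₂) (hn : p₁ + p₂ ≤ 8) {T : ℝ}
    (hz : IsIntegralCurveOn z (fun _ => solitonField p₁ p₂ lam) (Icc 0 T))
    (hσ : solitonSigma (z 0) = 0) (hJ : solitonJ p₁ p₂ (z 0) = 0)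
    (h0 : sinkFunction p₁ p₂ (z 0) ≤ (1 / 16000) ^ 2 / 4) {t : ℝ} (ht : t ∈ Icc 0 T) :
    sinkFunction p₁ p₂ (z t) ≤ sinkFunction p₁ p₂ (z 0) * Real.exp (-(1 / 128) * t) := by
  have h1 : (2 : ℝ) ≤ p₁ := by exact_mod_cast hp₁
  have h2 : (2 : ℝ) ≤ p₂ := by exact_mod_cast hp₂
  have hn' : (p₁ : ℝ) + p₂ ≤ 8 := by exact_mod_cast hn
  have hT : (0 : ℝ) ∈ Icc 0 T := ⟨le_rfl, ht.1.trans ht.2⟩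
  set m : ℝ := p₁ + p₂ - 1 with hm
  set u := fun t => solitonChart p₁ p₂ 1 (z t) with hu
  have hd : ∀ t ∈ Icc 0 T, HasDerivWithinAt (fun t => sinkFunction p₁ p₂ (z t))
      ((u t 1 - m) * (-2 * m * (u t 3 - 1) - 2 * (u t 1 - m) * (u t 3 - 1))
      + 2 * m * (u t 3 - 1) * ((u t 1 - m) + (u t 5 + p₂) - m * (u t 3 - 1)
        + (u t 5 + p₂) * (u t 3 - 1))
      - ((-2 * m * (u t 3 - 1) - 2 * (u t 1 - m) * (u t 3 - 1)) * (u t 3 - 1)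
        + (u t 1 - m) * ((u t 1 - m) + (u t 5 + p₂) - m * (u t 3 - 1)
          + (u t 5 + p₂) * (u t 3 - 1))) / 2
      + 6 * (u t 5 + p₂) * (-(u t 5 + p₂) + 2 * u t 4
        + (u t 4 - (u t 5 + p₂) - p₂ * (u t 3 - 1)) ^ 2 / p₁ + p₂ * (u t 3 - 1) ^ 2)
      + 6 * u t 4 * ((-m + (u t 5 + p₂)) * u t 4)) (Icc 0 T) t := by
    intro t ht
    have hc := hasDerivWithinAt_pi.1
      (hasDerivWithinAt_solitonChart (d := 1) (by omega : p₁ ≠ 0) one_ne_zero (hz t ht))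
    have hσt : u t 0 = 0 := by
      have := solitonSigma_eq_mul_exp hz (convex_Icc 0 T) hT ht
      rw [hσ, zero_mul] at this
      simpa [hu, solitonChart, solitonSigma] using this
    have hJt : u t 2 = 0 := by
      have := solitonJ_eq_mul_exp hz (convex_Icc 0 T) hT hσ ht
      rw [hJ, zero_mul] at this
      simpa [hu, solitonChart] using this
    have c1 := (hc 1).sub_const m
    have c3 := (hc 3).sub_const 1
    have c4 := hc 4
    have c5 := (hc 5).add_const (p₂ : ℝ)
    have := (((((c1.pow 2).div_const 2).add ((c3.pow 2).const_mul m)).sub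
      ((c1.mul c3).div_const 2)).add ((c5.pow 2).const_mul 3)).add ((c4.pow 2).const_mul 3)
    refine this.congr_deriv ?_
    simp only [solitonChartField, Matrix.cons_val]
    rw [show solitonChart p₁ p₂ 1 (z t) = u t from rfl]
    simp only [hσt, hJt, hm]
    field_simp
    ring
  refine le_mul_exp_of_hasDerivWithinAt_of_lt (by norm_num) (by norm_num) hd
    (fun t ht hle => ?_) h0 ht
  have hV := le_sinkForm (m := m) (ξ := u t 1 - m) (b := u t 3 - 1) (Z := u t 4) (h := u t 5 + p₂)
    (by linarith)
  have hV' : _ ≤ (1 / 16000 : ℝ) ^ 2 / 4 := hV.trans hle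
  refine sinkForm_deriv_le (r := 1 / 16000) (by linarith) (by linarith) h1 (by linarith)
    (by linarith) le_rfl ?_ ?_ ?_ <;>
  · refine abs_le_of_sq_le_sq ?_ (by norm_num)
    linarith [sq_nonneg (u t 1 - m), sq_nonneg (u t 3 - 1), sq_nonneg (u t 4),
      sq_nonneg (u t 5 + p₂)]

/-- Orbits in `σ = J = 0` starting near the Ricci-flat cone exist for all positive times and decay
to it exponentially, as measured by the Lyapunov function. -/
theorem exists_orbit_of_sinkFunction_le (hp₁ : 2 ≤ p₁) (hp₂ : 2 ≤ p₂) (hn : p₁ + p₂ ≤ 8)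
    {q : Fin 6 → ℝ} (hσ : solitonSigma q = 0) (hJ : solitonJ p₁ p₂ q = 0)
    (h0 : sinkFunction p₁ p₂ q ≤ (1 / 16000) ^ 2 / 4) :
    ∃ γ : ℝ → Fin 6 → ℝ, γ 0 = q ∧
      IsIntegralCurveOn γ (fun _ => solitonField p₁ p₂ lam) (Ici 0) ∧
      ∀ t ≥ 0, solitonSigma (γ t) = 0 ∧ solitonJ p₁ p₂ (γ t) = 0 ∧
        sinkFunction p₁ p₂ (γ t) ≤ (1 / 16000) ^ 2 / 4 * Real.exp (-(1 / 128) * t) := by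
  have h1 : (2 : ℝ) ≤ p₁ := by exact_mod_cast hp₁
  have h2 : (2 : ℝ) ≤ p₂ := by exact_mod_cast hp₂
  obtain ⟨R, hR⟩ := ((isCompact_closedBall (0 : Fin 6 → ℝ) 16).image
    (contDiff_solitonChartInv (p₁ := p₁) (p₂ := p₂) (d := 1)
      (n := 0)).continuous).isBounded.exists_norm_le
  have inv : ∀ (γ : ℝ → Fin 6 → ℝ) (T : ℝ), 0 ≤ T → γ 0 = q →
      IsIntegralCurveOn γ (fun _ => solitonField p₁ p₂ lam) (Icc 0 T) →
      solitonSigma (γ T) = 0 ∧ solitonJ p₁ p₂ (γ T) = 0 ∧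
        sinkFunction p₁ p₂ (γ T) ≤ (1 / 16000) ^ 2 / 4 * Real.exp (-(1 / 128) * T) := by
    intro γ T hT hγ0 hγ
    subst hγ0
    have hT0 : (0 : ℝ) ∈ Icc 0 T := ⟨le_rfl, hT⟩
    have hTT : T ∈ Icc 0 T := ⟨hT, le_rfl⟩
    refine ⟨?_, ?_, ?_⟩
    · rw [solitonSigma_eq_mul_exp hγ (convex_Icc 0 T) hT0 hTT, hσ, zero_mul]
    · rw [solitonJ_eq_mul_exp hγ (convex_Icc 0 T) hT0 hσ hTT, hJ, zero_mul]
    · exact (sinkFunction_le_mul_exp hp₁ hp₂ hn hγ hσ hJ h0 hTT).trans (by gcongr)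
  obtain ⟨γ, hγ0, hγ⟩ := exists_isIntegralCurveOn_Ici (p := q) (R := R)
    (contDiff_solitonField p₁ p₂ lam) fun T hT η hη0 hη => by
      obtain ⟨a, b, c⟩ := inv η T hT hη0 hη
      refine hR _ ⟨solitonChart p₁ p₂ 1 (η T), ?_,
        solitonChartInv_solitonChart (by omega) one_ne_zero _⟩
      have hle := le_sinkForm (m := p₁ + p₂ - 1)
        (ξ := solitonChart p₁ p₂ 1 (η T) 1 - (p₁ + p₂ - 1)) (b := solitonChart p₁ p₂ 1 (η T) 3 - 1)
        (Z := solitonChart p₁ p₂ 1 (η T) 4) (h := solitonChart p₁ p₂ 1 (η T) 5 + p₂) (by linarith)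
      have hexp : Real.exp (-(1 / 128) * T) ≤ 1 := Real.exp_le_one_iff.2 (by linarith)
      have hle' : _ ≤ (1 : ℝ) / 4 := (hle.trans c).trans (by
        nlinarith [Real.exp_pos (-(1 / 128) * T)])
      have hn' : (p₁ : ℝ) + p₂ ≤ 8 := by exact_mod_cast hn
      rw [mem_closedBall_zero_iff, pi_norm_le_iff_of_nonneg (by norm_num)]
      intro i
      have g1 : |solitonChart p₁ p₂ 1 (η T) 1 - (p₁ + p₂ - 1)| ≤ 1 :=
        abs_le_of_sq_le_sq (by nlinarith) one_pos.le
      have g3 : |solitonChart p₁ p₂ 1 (η T) 3 - 1| ≤ 1 :=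
        abs_le_of_sq_le_sq (by nlinarith) one_pos.le
      have g4 : |solitonChart p₁ p₂ 1 (η T) 4| ≤ 1 :=
        abs_le_of_sq_le_sq (by nlinarith) one_pos.le
      have g5 : |solitonChart p₁ p₂ 1 (η T) 5 + p₂| ≤ 1 :=
        abs_le_of_sq_le_sq (by nlinarith) one_pos.le
      rw [abs_le] at g1 g3 g4 g5
      rw [Real.norm_eq_abs, abs_le]
      have g0 : solitonChart p₁ p₂ 1 (η T) 0 = 0 := by
        simpa [solitonChart, solitonSigma] using a
      have g2 : solitonChart p₁ p₂ 1 (η T) 2 = 0 := by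
        simpa [solitonChart] using b
      fin_cases i <;> simp only [Fin.reduceFinMk, Fin.zero_eta, Fin.mk_one, g0, g2] <;>
        constructor <;> linarith
  exact ⟨γ, hγ0, hγ, fun t ht => inv γ t ht hγ0 (hγ.mono Icc_subset_Ici_self)⟩

/-- Near a point of the stable manifold of the Ricci-flat cone, all orbits in `σ = J = 0` exist for
all positive times and converge to the cone, uniformly. -/
theorem exists_uniform_orbits (hp₁ : 2 ≤ p₁) (hp₂ : 2 ≤ p₂) (hn : p₁ + p₂ ≤ 8)
    {p : Fin 6 → ℝ} (hp : p ∈ stableManifold (solitonField p₁ p₂ lam) (ricciFlatCone p₁ p₂)) :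
    ∃ N ∈ 𝓝 p, ∃ orb : (Fin 6 → ℝ) → ℝ → Fin 6 → ℝ,
      (∀ q ∈ N, solitonSigma q = 0 → solitonJ p₁ p₂ q = 0 → orb q 0 = q ∧
        IsIntegralCurveOn (orb q) (fun _ => solitonField p₁ p₂ lam) (Ici 0)) ∧
      TendstoUniformlyOn (fun t q => orb q t) (fun _ => ricciFlatCone p₁ p₂) atTop
        {q ∈ N | solitonSigma q = 0 ∧ solitonJ p₁ p₂ q = 0} := by
  obtain ⟨γ, rfl, hγ, hlim⟩ := hp
  set ρ : ℝ := (1 / 16000) ^ 2 / 4 with hρ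
  have hU : {z | sinkFunction p₁ p₂ z < ρ} ∈ 𝓝 (ricciFlatCone p₁ p₂) :=
    (isOpen_lt continuous_sinkFunction continuous_const).mem_nhds
      (by simp [sinkFunction_ricciFlatCone, hρ])
  obtain ⟨T, hT0, hT⟩ := ((eventually_ge_atTop 0).and (hlim hU)).exists
  obtain ⟨r, hr, hball⟩ := Metric.isOpen_iff.1
    (isOpen_lt (continuous_sinkFunction (p₁ := p₁) (p₂ := p₂)) continuous_const) (γ T) hT
  obtain ⟨C, hC, δ, hδ, near⟩ := (hγ.mono Icc_subset_Ici_self :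
    IsIntegralCurveOn γ (fun _ => solitonField p₁ p₂ lam) (Icc 0 T)).exists_nearby
      (contDiff_solitonField p₁ p₂ lam)
  -- nearby orbits in `σ = J = 0` enter the basin of the cone at time `T`
  have step : ∀ q, ‖q - γ 0‖ < min δ (r / C) → solitonSigma q = 0 → solitonJ p₁ p₂ q = 0 →
      ∃ η : ℝ → Fin 6 → ℝ, η 0 = q ∧
        IsIntegralCurveOn η (fun _ => solitonField p₁ p₂ lam) (Ici 0) ∧
        ∀ t ≥ T, solitonSigma (η t) = 0 ∧ solitonJ p₁ p₂ (η t) = 0 ∧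
          sinkFunction p₁ p₂ (η t) ≤ ρ * Real.exp (-(1 / 128) * (t - T)) := by
    intro q hq hσ hJ
    obtain ⟨η, h0, hη, hb⟩ := near q (hq.trans_le (min_le_left _ _))
    have hTT : T ∈ Icc 0 T := ⟨hT0, le_rfl⟩
    have h00 : (0 : ℝ) ∈ Icc 0 T := ⟨le_rfl, hT0⟩
    have hV : sinkFunction p₁ p₂ (η T) < ρ := by
      refine hball ?_
      rw [Metric.mem_ball, dist_eq_norm]
      refine (hb T hTT).trans_lt ?_
      have := hq.trans_le (min_le_right _ _)
      rwa [lt_div_iff₀' hC] at this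
    have hσT : solitonSigma (η T) = 0 := by
      rw [solitonSigma_eq_mul_exp hη (convex_Icc 0 T) h00 hTT, h0, hσ, zero_mul]
    have hJT : solitonJ p₁ p₂ (η T) = 0 := by
      rw [solitonJ_eq_mul_exp hη (convex_Icc 0 T) h00 (by rw [h0, hσ]) hTT, h0, hJ, zero_mul]
    obtain ⟨ζ, hζ0, hζ, hζd⟩ :=
      exists_orbit_of_sinkFunction_le (lam := lam) hp₁ hp₂ hn hσT hJT hV.le
    have hs : IsIntegralCurveOn (fun t => ζ (t + -T)) (fun _ => solitonField p₁ p₂ lam)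
        (Ici 0 ∩ Ici T) := hζ.shift _ fun t ht => by
      simpa using ht.2
    refine ⟨_, ?_, (IsIntegralCurveOn.concat (a := T) (hη.mono fun t ht => ⟨ht.1, ht.2⟩) hs
      (by simp [hζ0])), fun t ht => ?_⟩
    · simp [hT0, h0]
    · have : (if t ≤ T then η t else ζ (t + -T)) = ζ (t - T) := by
        rcases ht.lt_or_eq with h | h
        · simp [not_le.2 h, sub_eq_add_neg]
        · simp [← h, hζ0]
      simp only [this]
      exact hζd (t - T) (by linarith [ht.le])
  choose! orb h0 horb hd using step
  refine ⟨Metric.ball (γ 0) (min δ (r / C)), Metric.ball_mem_nhds _ (by positivity), orb,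
    fun q hq hσ hJ => ?_, ?_⟩
  · rw [Metric.mem_ball, dist_eq_norm] at hq
    exact ⟨h0 q hq hσ hJ, horb q hq hσ hJ⟩
  · rw [Metric.tendstoUniformlyOn_iff]
    intro ε hε
    obtain ⟨s, hs, hclose⟩ := exists_sinkFunction_lt hp₁ hp₂ hε
    have hlim' : Tendsto (fun t : ℝ => ρ * Real.exp (-(1 / 128) * (t - T))) atTop (𝓝 (ρ * 0)) := by
      refine Tendsto.const_mul _ (Real.tendsto_exp_atBot.comp ?_)
      exact (tendsto_id.atTop_add tendsto_const_nhds).const_mul_atTop_of_neg (by norm_num)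
    rw [mul_zero] at hlim'
    filter_upwards [hlim'.eventually (gt_mem_nhds hs), eventually_ge_atTop T] with t ht htT q hq
    have hq1 := hq.1
    rw [Metric.mem_ball, dist_eq_norm] at hq1
    obtain ⟨a, b, c⟩ := hd q hq1 hq.2.1 hq.2.2 t htT
    rw [dist_comm]
    exact hclose _ a b (c.trans_lt ht)

/-- Locally the stable manifold of the Ricci-flat cone is the level set `σ = J = 0`. -/
theorem stableManifold_inter_eq (hp₁ : 2 ≤ p₁) (hp₂ : 2 ≤ p₂) (hn : p₁ + p₂ ≤ 8)
    {p : Fin 6 → ℝ} (hp : p ∈ stableManifold (solitonField p₁ p₂ lam) (ricciFlatCone p₁ p₂)) :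
    ∃ N ∈ 𝓝 p, stableManifold (solitonField p₁ p₂ lam) (ricciFlatCone p₁ p₂) ∩ N =
      {z | solitonSigma z = 0 ∧ solitonJ p₁ p₂ z = 0} ∩ N := by
  obtain ⟨N, hN, orb, horb, hlim⟩ := exists_uniform_orbits hp₁ hp₂ hn hp
  refine ⟨N, hN, Subset.antisymm ?_ ?_⟩
  · rintro q ⟨⟨γ, rfl, hγ, hγl⟩, hq⟩
    exact ⟨solitonSigma_solitonJ_eq_zero hγ hγl, hq⟩
  · rintro q ⟨⟨hσ, hJ⟩, hq⟩
    exact ⟨⟨orb q, (horb q hq hσ hJ).1, (horb q hq hσ hJ).2,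
      hlim.tendsto_at ⟨hq, hσ, hJ⟩⟩, hq⟩

theorem differentiable_solitonJ : Differentiable ℝ (solitonJ p₁ p₂) := by
  unfold solitonJ; fun_prop

/-- Points of `ℝ⁶` are moved to the level set `J = 0` by changing `x₁`, on which `J` depends
affinely. -/
noncomputable def solitonJProj (p₁ p₂ : ℕ) (z : Fin 6 → ℝ) : Fin 6 → ℝ :=
  z - (2 / p₁ * solitonJ p₁ p₂ z) • Pi.single 0 1

theorem solitonJ_solitonJProj (hp₁ : p₁ ≠ 0) (z : Fin 6 → ℝ) :
    solitonJ p₁ p₂ (solitonJProj p₁ p₂ z) = 0 := by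
  have h : (p₁ : ℝ) ≠ 0 := by exact_mod_cast hp₁
  simp [solitonJProj, solitonJ]
  field_simp
  ring

/-- The tangent space of the stable manifold of the Ricci-flat cone is the tangent space of the
level set `σ = J = 0`. -/
theorem stableTangent_eq (hp₁ : 2 ≤ p₁) (hp₂ : 2 ≤ p₂) (hn : p₁ + p₂ ≤ 8)
    {p : Fin 6 → ℝ} (hp : p ∈ stableManifold (solitonField p₁ p₂ lam) (ricciFlatCone p₁ p₂)) :
    stableTangent (solitonField p₁ p₂ lam) (ricciFlatCone p₁ p₂) p =
      {v | v 5 = 0 ∧ fderiv ℝ (solitonJ p₁ p₂) p v = 0} := by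
  have hdJ : ∀ z, HasFDerivAt (solitonJ p₁ p₂) (fderiv ℝ (solitonJ p₁ p₂) z) z := fun z =>
    (differentiable_solitonJ z).hasFDerivAt
  apply Subset.antisymm
  · rintro v ⟨ε, hε, c, orb, -, rfl, hv, horb, hlim⟩
    have hmem : Ioo (-ε) ε ∈ 𝓝 (0 : ℝ) := Ioo_mem_nhds (by linarith) hε
    have h0 : ∀ r ∈ Ioo (-ε) ε, solitonSigma (c r) = 0 ∧ solitonJ p₁ p₂ (c r) = 0 := by
      intro r hr
      have := solitonSigma_solitonJ_eq_zero (horb r hr).2 (hlim.tendsto_at hr)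
      rwa [(horb r hr).1] at this
    constructor
    · refine (hasDerivAt_pi.1 hv 5).unique
        ((hasDerivAt_const (0 : ℝ) (0 : ℝ)).congr_of_eventuallyEq ?_)
      filter_upwards [hmem] with r hr using (h0 r hr).1
    · refine ((hdJ (c 0)).comp_hasDerivAt 0 hv).unique
        ((hasDerivAt_const (0 : ℝ) (0 : ℝ)).congr_of_eventuallyEq ?_)
      filter_upwards [hmem] with r hr using (h0 r hr).2
  · rintro v ⟨hv5, hvJ⟩
    obtain ⟨N, hN, orb, horb, hlim⟩ := exists_uniform_orbits hp₁ hp₂ hn hp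
    obtain ⟨hpσ, hpJ⟩ : solitonSigma p = 0 ∧ solitonJ p₁ p₂ p = 0 := by
      obtain ⟨γ, rfl, hγ, hγl⟩ := hp
      exact solitonSigma_solitonJ_eq_zero hγ hγl
    set c : ℝ → Fin 6 → ℝ := fun r => solitonJProj p₁ p₂ (p + r • v) with hc
    have hc0 : c 0 = p := by simp [hc, solitonJProj, hpJ]
    have hcd : ContDiff ℝ 1 c := by
      simp only [hc, solitonJProj, solitonJ]
      fun_prop
    have hcN : c ⁻¹' N ∈ 𝓝 (0 : ℝ) := hcd.continuous.continuousAt.preimage_mem_nhds (by rwa [hc0])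
    obtain ⟨ε, hε, hεN⟩ := Metric.mem_nhds_iff.1 hcN
    rw [Real.ball_eq_Ioo, zero_sub, zero_add] at hεN
    have hσ : ∀ r, solitonSigma (c r) = 0 := fun r => by
      have : p 5 = 0 := hpσ
      simp [hc, solitonJProj, solitonSigma, this, hv5]
    have hJ : ∀ r, solitonJ p₁ p₂ (c r) = 0 := fun r => solitonJ_solitonJProj (by omega) _
    refine ⟨ε, hε, c, fun r => orb (c r), hcd.contDiffOn, hc0, ?_,
      fun r hr => horb _ (hεN hr) (hσ r) (hJ r), ?_⟩
    · have h1 : HasDerivAt (fun r : ℝ => p + r • v) v 0 := by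
        simpa using ((hasDerivAt_id (0 : ℝ)).smul_const v).const_add p
      have h2 := (hdJ (p + (0 : ℝ) • v)).comp_hasDerivAt 0 h1
      simp only [zero_smul, add_zero, hvJ] at h2
      have h3 := h1.sub ((h2.const_mul (2 / (p₁ : ℝ))).smul_const (Pi.single 0 1 : Fin 6 → ℝ))
      simp only [zero_smul, mul_zero, sub_zero] at h3
      exact h3
    · intro s hs
      filter_upwards [hlim s hs] with t ht r hr using ht (c r) ⟨hεN hr, hσ r, hJ r⟩

end SinkDynamics

/-! ### Ricci-flat orbits converge to the Ricci-flat cone -/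

section RicciFlat

variable {p₁ p₂ : ℕ} {lam : ℝ} {z : ℝ → Fin 6 → ℝ}

/-- The Ricci-flat equations `σ = J = Z = 0`, positivity of `x₁` and `x₂`, and bounds on the mean
curvature `-Γ` which confine it to an invariant interval around the values `p₁` and `n` at the two
fixed points. -/
structure IsRicciFlatData (p₁ p₂ : ℕ) (z : Fin 6 → ℝ) : Prop where
  sigma : solitonSigma z = 0
  J : solitonJ p₁ p₂ z = 0
  Z : z 4 + (p₁ * (1 + z 1) + p₂ * (1 + z 3)) = 0
  x₁ : 0 < z 0
  x₂ : 0 < z 2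
  one_le : 1 ≤ -z 4
  le_add_one : -z 4 ≤ p₁ + p₂ + 1

/-- With positive radii, `J = 0` gives `∑ p_α (1 + y_α)² < Γ²`. -/
theorem IsRicciFlatData.sq_lt {z : Fin 6 → ℝ} (hz : IsRicciFlatData p₁ p₂ z) (hp₁ : 2 ≤ p₁) :
    p₁ * (1 + z 1) ^ 2 + p₂ * (1 + z 3) ^ 2 < z 4 ^ 2 := by
  have h1 : (2 : ℝ) ≤ p₁ := by exact_mod_cast hp₁
  have := hz.J
  unfold solitonJ at this
  nlinarith [mul_pos (by linarith : (0 : ℝ) < p₁) hz.x₁,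
    mul_nonneg (Nat.cast_nonneg p₂ : (0 : ℝ) ≤ p₂) hz.x₂.le]

/-- The inequality `Γ² ≤ n ∑ p_α (1 + y_α)²`, with its defect. -/
theorem IsRicciFlatData.sq_eq {z : Fin 6 → ℝ} (hz : IsRicciFlatData p₁ p₂ z) :
    ((p₁ : ℝ) + p₂) * (p₁ * (1 + z 1) ^ 2 + p₂ * (1 + z 3) ^ 2) =
      z 4 ^ 2 + p₁ * p₂ * (z 1 - z 3) ^ 2 := by
  have : z 4 = -(p₁ * (1 + z 1) + p₂ * (1 + z 3)) := by linarith [hz.Z]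
  rw [this]; ring

/-- The conditions `IsRicciFlatData` are invariant under the forward soliton flow. -/
theorem IsRicciFlatData.of_isIntegralCurveOn (hp₁ : 2 ≤ p₁) {T : ℝ}
    (hz : IsIntegralCurveOn z (fun _ => solitonField p₁ p₂ lam) (Icc 0 T))
    (h0 : IsRicciFlatData p₁ p₂ (z 0)) {t : ℝ} (ht : t ∈ Icc 0 T) :
    IsRicciFlatData p₁ p₂ (z t) := by
  have h1 : (2 : ℝ) ≤ p₁ := by exact_mod_cast hp₁
  have hT : (0 : ℝ) ∈ Icc 0 T := ⟨le_rfl, ht.1.trans ht.2⟩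
  have hS : Convex ℝ (Icc 0 T) := convex_Icc 0 T
  have hσ : ∀ t ∈ Icc 0 T, solitonSigma (z t) = 0 := fun t ht => by
    rw [solitonSigma_eq_mul_exp hz hS hT ht, h0.sigma, zero_mul]
  have hJ : ∀ t ∈ Icc 0 T, solitonJ p₁ p₂ (z t) = 0 := fun t ht => by
    rw [solitonJ_eq_mul_exp hz hS hT h0.sigma ht, h0.J, zero_mul]
  have hc : ∀ i, ContinuousOn (fun t => z t i) (Icc 0 T) := continuousOn_pi.1 hz.continuousOn
  have hd : ∀ t ∈ Icc 0 T, ∀ i, HasDerivWithinAt (fun t => z t i)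
    (solitonField p₁ p₂ lam (z t) i) (Icc 0 T) t := fun t ht => hasDerivWithinAt_pi.1 (hz t ht)
  have sign : ∀ (f a : ℝ → ℝ), ContinuousOn a (Icc 0 T) →
      (∀ t ∈ Icc 0 T, HasDerivWithinAt f (a t * f t) (Icc 0 T) t) → ∀ t ∈ Icc 0 T,
        ∃ c > 0, f t = f 0 * c := fun f a ha h t ht =>
    exists_pos_eq_mul_of_hasDerivWithinAt (π := fun t => max 0 (min T t)) hS hT
      (by fun_prop) (fun t => ⟨le_max_left _ _, max_le hT.2 (min_le_left _ _)⟩)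
      (fun t ht => by simp [ht.1, ht.2]) ha h ht
  have hZ : ∀ t ∈ Icc 0 T, z t 4 + (p₁ * (1 + z t 1) + p₂ * (1 + z t 3)) = 0 := by
    intro t ht
    obtain ⟨c, -, h⟩ := sign (fun t => z t 4 + (p₁ * (1 + z t 1) + p₂ * (1 + z t 3)))
      (fun t => z t 4 + 1) ((hc 4).add continuousOn_const) (fun t ht => by
        have := (hd t ht 4).add ((((hd t ht 1).const_add 1).const_mul (p₁ : ℝ)).add
          (((hd t ht 3).const_add 1).const_mul (p₂ : ℝ)))
        refine this.congr_deriv ?_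
        have e1 : z t 5 = 0 := hσ t ht
        have e2 := hJ t ht
        unfold solitonJ at e2
        simp only [solitonField, Matrix.cons_val, e1]
        linear_combination 2 * e2) t ht
    rw [h, h0.Z, zero_mul]
  have hx₁ : ∀ t ∈ Icc 0 T, 0 < z t 0 := by
    intro t ht
    obtain ⟨c, hc0, h⟩ := sign (fun t => z t 0) (fun t => -2 * z t 1)
      ((hc 1).const_smul (-2 : ℝ)) (fun t ht => (hd t ht 0).congr_deriv (by
        simp only [solitonField, Matrix.cons_val]; ring)) t ht
    rw [h]; exact mul_pos h0.x₁ hc0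
  have hx₂ : ∀ t ∈ Icc 0 T, 0 < z t 2 := by
    intro t ht
    obtain ⟨c, hc0, h⟩ := sign (fun t => z t 2) (fun t => -2 * z t 3)
      ((hc 3).const_smul (-2 : ℝ)) (fun t ht => (hd t ht 2).congr_deriv (by
        simp only [solitonField, Matrix.cons_val]; ring)) t ht
    rw [h]; exact mul_pos h0.x₂ hc0
  have hsq : ∀ t ∈ Icc 0 T, p₁ * (1 + z t 1) ^ 2 + p₂ * (1 + z t 3) ^ 2 < z t 4 ^ 2 := by
    intro t ht
    have := hJ t ht
    unfold solitonJ at this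
    nlinarith [mul_pos (by linarith : (0 : ℝ) < p₁) (hx₁ t ht),
      mul_nonneg (Nat.cast_nonneg p₂ : (0 : ℝ) ≤ p₂) (hx₂ t ht).le]
  refine ⟨hσ t ht, hJ t ht, hZ t ht, hx₁ t ht, hx₂ t ht, ?_, ?_⟩
  -- at `Γ = -1` the bound `∑ p_α (1 + y_α)² < Γ²` gives `Γ' < 0`
  · have := image_le_of_deriv_right_lt_deriv_boundary' (f := fun t => z t 4) (B := fun _ => -1)
      (B' := fun _ => 0) (hc 4) (fun s hs => (hd s (Ico_subset_Icc_self hs) 4).Ici_of_Icc hs)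
      (by linarith [h0.one_le]) continuousOn_const (fun s _ => hasDerivWithinAt_const _ _ _)
      (fun s hs e => by
        have := hsq s (Ico_subset_Icc_self hs)
        simp only [solitonField, Matrix.cons_val]
        rw [e] at this ⊢
        linarith) ht
    linarith
  -- at `Γ = -(n + 1)` the bound `Γ² ≤ n ∑ p_α (1 + y_α)²` gives `Γ' > 0`
  · have := image_le_of_deriv_right_lt_deriv_boundary' (f := fun t => -z t 4)
      (B := fun _ => (p₁ : ℝ) + p₂ + 1)
      (B' := fun _ => 0) (hc 4).neg
      (fun s hs => ((hd s (Ico_subset_Icc_self hs) 4).Ici_of_Icc hs).neg)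
      h0.le_add_one continuousOn_const (fun s _ => hasDerivWithinAt_const _ _ _)
      (fun s hs e => by
        have hs' := Ico_subset_Icc_self hs
        have e3 : z s 4 = -(p₁ * (1 + z s 1) + p₂ * (1 + z s 3)) := by linarith [hZ s hs']
        simp only [solitonField, Matrix.cons_val]
        have hP : (0 : ℝ) ≤ p₂ := Nat.cast_nonneg _
        by_contra! hcon
        have e4 : ((p₁ : ℝ) + p₂) * (p₁ * (1 + z s 1) ^ 2 + p₂ * (1 + z s 3) ^ 2) =
            z s 4 ^ 2 + p₁ * p₂ * (z s 1 - z s 3) ^ 2 := by rw [e3]; ring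
        have e5 : 0 ≤ (p₁ : ℝ) * p₂ * (z s 1 - z s 3) ^ 2 := by positivity
        have e6 : z s 4 = -(p₁ + p₂ + 1) := by linarith
        rw [e6] at hcon e4
        nlinarith) ht
    exact this

theorem IsRicciFlatData.bounds {z : Fin 6 → ℝ} (hz : IsRicciFlatData p₁ p₂ z) (hp₁ : 2 ≤ p₁)
    (hp₂ : 2 ≤ p₂) (hn : p₁ + p₂ ≤ 8) : z 0 ≤ 81 ∧ z 2 ≤ 81 ∧ |1 + z 1| ≤ 9 ∧ |1 + z 3| ≤ 9 ∧
      -z 4 ≤ 9 := by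
  have h1 : (2 : ℝ) ≤ p₁ := by exact_mod_cast hp₁
  have h2 : (2 : ℝ) ≤ p₂ := by exact_mod_cast hp₂
  have hn' : (p₁ : ℝ) + p₂ ≤ 8 := by exact_mod_cast hn
  have hH : -z 4 ≤ 9 := by linarith [hz.le_add_one]
  have hH2 : z 4 ^ 2 ≤ 81 := by nlinarith [hz.one_le]
  have hJ := hz.J
  unfold solitonJ at hJ
  have b1 : 2 * z 0 ≤ p₁ * z 0 := by nlinarith [hz.x₁]
  have b2 : 2 * z 2 ≤ p₂ * z 2 := by nlinarith [hz.x₂]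
  have b3 : 2 * (1 + z 1) ^ 2 ≤ p₁ * (1 + z 1) ^ 2 := by nlinarith [sq_nonneg (1 + z 1)]
  have b4 : 2 * (1 + z 3) ^ 2 ≤ p₂ * (1 + z 3) ^ 2 := by nlinarith [sq_nonneg (1 + z 3)]
  have c1 := hz.x₁
  have c2 := hz.x₂
  refine ⟨?_, ?_, abs_le_of_sq_le_sq ?_ (by norm_num), abs_le_of_sq_le_sq ?_ (by norm_num), hH⟩ <;>
    nlinarith [sq_nonneg (1 + z 1), sq_nonneg (1 + z 3)]

/-- Böhm's monotone quantity `2 log (-Γ) - (1/n) ∑ p_α log x_α`, whose derivative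
`-(2 p₁ p₂ / n) (y₁ - y₂)² / (-Γ)` is nonpositive, controls Ricci-flat orbits: they converge to the
Ricci-flat cone. -/
theorem IsRicciFlatData.tendsto_ricciFlatCone (hp₁ : 2 ≤ p₁) (hp₂ : 2 ≤ p₂) (hn : p₁ + p₂ ≤ 8)
    (hz : IsIntegralCurveOn z (fun _ => solitonField p₁ p₂ lam) (Ici 0))
    (h0 : IsRicciFlatData p₁ p₂ (z 0)) : Tendsto z atTop (𝓝 (ricciFlatCone p₁ p₂)) := by
  have h1 : (2 : ℝ) ≤ p₁ := by exact_mod_cast hp₁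
  have h2 : (2 : ℝ) ≤ p₂ := by exact_mod_cast hp₂
  have hn' : (p₁ : ℝ) + p₂ ≤ 8 := by exact_mod_cast hn
  set n : ℝ := p₁ + p₂ with hndef
  have hn4 : 4 ≤ n := by linarith
  have hn0 : n ≠ 0 := by linarith
  have D : ∀ t ≥ 0, IsRicciFlatData p₁ p₂ (z t) := fun t ht =>
    IsRicciFlatData.of_isIntegralCurveOn hp₁ (T := t) (hz.mono Icc_subset_Ici_self) h0 ⟨ht, le_rfl⟩
  have hd : ∀ t > 0, ∀ i, HasDerivAt (fun t => z t i) (solitonField p₁ p₂ lam (z t) i) t :=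
    fun t ht i => (hasDerivWithinAt_pi.1 (hz t ht.le) i).hasDerivAt (Ici_mem_nhds ht)
  have hσ : ∀ t ≥ 0, z t 5 = 0 := fun t ht => (D t ht).sigma
  set Q : ℝ → ℝ := fun t => p₁ * (1 + z t 1) ^ 2 + p₂ * (1 + z t 3) ^ 2 with hQ
  set w : ℝ → ℝ := fun t => z t 1 - z t 3 with hw
  set g : ℝ → ℝ := fun t => z t 0 - z t 2 + (z t 4 + 1) * w t with hg
  have hQe : ∀ t ≥ 0, n * Q t = z t 4 ^ 2 + p₁ * p₂ * w t ^ 2 := fun t ht => (D t ht).sq_eq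
  have dw : ∀ t > 0, HasDerivAt w (g t) t := fun t ht =>
    ((hd t ht 1).sub (hd t ht 3)).congr_deriv (by
      simp only [solitonField, Matrix.cons_val, hσ t ht.le, hg, hw]; ring)
  have d4 : ∀ t > 0, HasDerivAt (fun t => z t 4) (z t 4 + Q t) t := fun t ht => hd t ht 4
  have dg : ∀ t > 0, HasDerivAt g (-2 * z t 0 * z t 1 - -2 * z t 2 * z t 3
      + ((z t 4 + Q t) * w t + (z t 4 + 1) * g t)) t := fun t ht =>
    ((hd t ht 0).sub (hd t ht 2)).add (((d4 t ht).add_const 1).mul (dw t ht))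
  -- a priori bounds
  have bw : ∀ t ≥ 0, |w t| ≤ 18 := by
    intro t ht
    obtain ⟨-, -, b1, b3, -⟩ := (D t ht).bounds hp₁ hp₂ hn
    calc |w t| = |(1 + z t 1) - (1 + z t 3)| := by simp [hw]
      _ ≤ |1 + z t 1| + |1 + z t 3| := abs_sub _ _
      _ ≤ 18 := by linarith
  have b4 : ∀ t ≥ 0, |z t 4 + 1| ≤ 8 := by
    intro t ht
    obtain ⟨-, -, -, -, b⟩ := (D t ht).bounds hp₁ hp₂ hn
    have := (D t ht).one_le
    rw [abs_le]; constructor <;> linarith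
  have bQ : ∀ t ≥ 0, |z t 4 + Q t| ≤ 81 := by
    intro t ht
    obtain ⟨-, -, -, -, b⟩ := (D t ht).bounds hp₁ hp₂ hn
    have e1 := (D t ht).one_le
    have e2 := (D t ht).sq_lt hp₁
    have e3 : 0 ≤ Q t := by positivity
    rw [abs_le]; constructor
    · linarith
    · change Q t < _ at e2
      nlinarith
  have bx : ∀ t ≥ 0, |z t 0| ≤ 81 ∧ |z t 2| ≤ 81 ∧ |z t 1| ≤ 10 ∧ |z t 3| ≤ 10 := by
    intro t ht
    obtain ⟨b0, b2, b1, b3, -⟩ := (D t ht).bounds hp₁ hp₂ hn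
    have x1 := (D t ht).x₁
    have x2 := (D t ht).x₂
    rw [abs_le] at b1 b3
    refine ⟨by rwa [abs_of_pos x1], by rwa [abs_of_pos x2], ?_, ?_⟩ <;> rw [abs_le] <;>
      constructor <;> linarith [b1.1, b1.2, b3.1, b3.2]
  have bg : ∀ t ≥ 0, |g t| ≤ 306 := by
    intro t ht
    obtain ⟨b0, b2, -, -⟩ := bx t ht
    calc |g t| ≤ |z t 0 - z t 2| + |(z t 4 + 1) * w t| := abs_add_le _ _
      _ ≤ (|z t 0| + |z t 2|) + |z t 4 + 1| * |w t| := by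
        rw [abs_mul]; gcongr; exact abs_sub _ _
      _ ≤ (81 + 81) + 8 * 18 := by gcongr <;> [exact b4 t ht; exact bw t ht]
      _ = 306 := by norm_num
  have bg' : ∀ t > 0, |-2 * z t 0 * z t 1 - -2 * z t 2 * z t 3
      + ((z t 4 + Q t) * w t + (z t 4 + 1) * g t)| ≤ 10000 := by
    intro t ht
    obtain ⟨b0, b2, b1, b3⟩ := bx t ht.le
    calc _ ≤ |-2 * z t 0 * z t 1 - -2 * z t 2 * z t 3|
          + |(z t 4 + Q t) * w t + (z t 4 + 1) * g t| := abs_add_le _ _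
      _ ≤ (|-2 * z t 0 * z t 1| + |-2 * z t 2 * z t 3|)
          + (|(z t 4 + Q t) * w t| + |(z t 4 + 1) * g t|) :=
        add_le_add (abs_sub _ _) (abs_add_le _ _)
      _ = 2 * |z t 0| * |z t 1| + 2 * |z t 2| * |z t 3|
          + (|z t 4 + Q t| * |w t| + |z t 4 + 1| * |g t|) := by simp [abs_mul]
      _ ≤ 2 * 81 * 10 + 2 * 81 * 10 + (81 * 18 + 8 * 306) := by
        gcongr <;> [exact bQ t ht.le; exact bw t ht.le; exact b4 t ht.le; exact bg t ht.le]
      _ ≤ 10000 := by norm_num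
  -- the monotone quantity
  set W : ℝ → ℝ := fun t => 2 * Real.log (-z t 4) - p₁ / n * Real.log (z t 0)
    - p₂ / n * Real.log (z t 2) with hW
  set G : ℝ → ℝ := fun t => 2 * p₁ * p₂ / n * (w t ^ 2 / z t 4) with hG
  have n4 : ∀ t ≥ 0, z t 4 ≤ -1 := fun t ht => by linarith [(D t ht).one_le]
  have dW : ∀ t > 0, HasDerivAt W (G t) t := by
    intro t ht
    have x1 := (D t ht.le).x₁
    have x2 := (D t ht.le).x₂
    have z4 := n4 t ht.le
    have z40 : z t 4 ≠ 0 := by linarith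
    have := ((((d4 t ht).neg.log (by simpa using z40)).const_mul 2).sub
      (((hd t ht 0).log x1.ne').const_mul (p₁ / n : ℝ))).sub
      (((hd t ht 2).log x2.ne').const_mul (p₂ / n : ℝ))
    refine this.congr_deriv ?_
    have e1 := hQe t ht.le
    have e2 := (D t ht.le).Z
    simp only [solitonField, Matrix.cons_val, hG, Pi.neg_apply]
    field_simp
    linear_combination e1 + z t 4 * e2 + z t 4 * hndef
  have dG : ∀ t > 0, HasDerivAt G (2 * p₁ * p₂ / n * ((2 * w t ^ (2 - 1) * g t * z t 4
      - w t ^ 2 * (z t 4 + Q t)) / z t 4 ^ 2)) t := by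
    intro t ht
    have z4 := n4 t ht.le
    have := (((dw t ht).pow 2).div (d4 t ht) (by linarith)).const_mul (2 * p₁ * p₂ / n : ℝ)
    exact this
  have hpp : 2 * (p₁ : ℝ) * p₂ / n ≤ 18 := by
    rw [div_le_iff₀ (by linarith)]
    nlinarith
  have hpp0 : 2 ≤ 2 * (p₁ : ℝ) * p₂ / n := by
    rw [le_div_iff₀ (by linarith)]
    nlinarith
  have bG' : ∀ t > 0, |2 * p₁ * p₂ / n * ((2 * w t ^ (2 - 1) * g t * z t 4
      - w t ^ 2 * (z t 4 + Q t)) / z t 4 ^ 2)| ≤ 10 ^ 7 := by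
    intro t ht
    have z4 := n4 t ht.le
    have z4' : |z t 4| ≤ 9 := by
      obtain ⟨-, -, -, -, b⟩ := (D t ht.le).bounds hp₁ hp₂ hn
      rw [abs_le]; constructor <;> linarith
    have hsq : 1 ≤ z t 4 ^ 2 := by nlinarith
    rw [abs_mul, abs_of_nonneg (by linarith), abs_div,
      abs_of_nonneg (by positivity : 0 ≤ z t 4 ^ 2)]
    calc _ ≤ 18 * |2 * w t ^ (2 - 1) * g t * z t 4 - w t ^ 2 * (z t 4 + Q t)| :=
          mul_le_mul hpp (div_le_self (abs_nonneg _) hsq) (by positivity) (by norm_num)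
      _ ≤ 18 * (|2 * w t ^ (2 - 1) * g t * z t 4| + |w t ^ 2 * (z t 4 + Q t)|) := by
          gcongr; exact abs_sub _ _
      _ = 18 * (2 * |w t| * |g t| * |z t 4| + |w t| ^ 2 * |z t 4 + Q t|) := by
          simp [abs_mul]
      _ ≤ 18 * (2 * 18 * 306 * 9 + 18 ^ 2 * 81) := by
          gcongr <;> [exact bw t ht.le; exact bg t ht.le; exact bw t ht.le; exact bQ t ht.le]
      _ ≤ 10 ^ 7 := by norm_num
  have hWlim : ∃ ℓ, Tendsto W atTop (𝓝 ℓ) := by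
    have hanti : AntitoneOn W (Ici 1) := by
      refine antitoneOn_of_deriv_nonpos (convex_Ici 1)
        (fun t ht => (dW t (by linarith [mem_Ici.1 ht])).continuousAt.continuousWithinAt)
        (fun t ht => ?_) (fun t ht => ?_) <;> rw [interior_Ici] at ht <;>
        have ht0 : 0 < t := by linarith [mem_Ioi.1 ht]
      · exact (dW t ht0).differentiableAt.differentiableWithinAt
      · rw [(dW t ht0).deriv]
        refine mul_nonpos_of_nonneg_of_nonpos (by linarith) ?_
        exact div_nonpos_of_nonneg_of_nonpos (sq_nonneg _) (by linarith [n4 t ht0.le])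
    have hanti' : Antitone fun t => W (max 1 t) := fun s t hst =>
      hanti (mem_Ici.2 (le_max_left _ _)) (mem_Ici.2 (le_max_left _ _)) (max_le_max le_rfl hst)
    have hbdd : BddBelow (range fun t => W (max 1 t)) := by
      refine ⟨-(p₁ / n * Real.log 81) - p₂ / n * Real.log 81, ?_⟩
      rintro _ ⟨t, rfl⟩
      have ht : 0 ≤ max 1 t := le_trans zero_le_one (le_max_left _ _)
      obtain ⟨b0, b2, -, -, -⟩ := (D _ ht).bounds hp₁ hp₂ hn
      have l1 := Real.log_nonneg (D _ ht).one_le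
      have l2 := Real.log_le_log (D _ ht).x₁ b0
      have l3 := Real.log_le_log (D _ ht).x₂ b2
      have m1 : p₁ / n * Real.log (z (max 1 t) 0) ≤ p₁ / n * Real.log 81 := by gcongr
      have m2 : p₂ / n * Real.log (z (max 1 t) 2) ≤ p₂ / n * Real.log 81 := by gcongr
      simp only [hW]
      linarith
    refine ⟨_, (tendsto_atTop_ciInf hanti' hbdd).congr' ?_⟩
    filter_upwards [eventually_ge_atTop 1] with t ht
    rw [max_eq_right ht]
  obtain ⟨ℓ, hℓ⟩ := hWlim
  -- Barbalat's lemma gives `y₁ - y₂ → 0`, and once more `x₁ - x₂ → 0`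
  have hG0 : Tendsto G atTop (𝓝 0) :=
    tendsto_deriv_zero_of_tendsto (by norm_num) dW dG bG' hℓ
  have hw2 : Tendsto (fun t => w t ^ 2) atTop (𝓝 0) := by
    have hG1 : Tendsto (fun t => -9 * G t) atTop (𝓝 (-9 * 0)) := hG0.const_mul _
    rw [mul_zero] at hG1
    refine squeeze_zero' (.of_forall fun t => sq_nonneg _) ?_ hG1
    filter_upwards [eventually_ge_atTop 0] with t ht
    have z4 := n4 t ht
    obtain ⟨-, -, -, -, b⟩ := (D t ht).bounds hp₁ hp₂ hn
    have e : w t ^ 2 ≤ 9 * (w t ^ 2 / -z t 4) := by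
      rw [← mul_div_assoc, le_div_iff₀ (by linarith)]
      nlinarith [sq_nonneg (w t)]
    have e2 : 0 ≤ w t ^ 2 / -z t 4 := div_nonneg (sq_nonneg _) (by linarith)
    rw [div_neg] at e e2
    simp only [hG]
    nlinarith
  have hw0 : Tendsto w atTop (𝓝 0) := by
    rw [tendsto_zero_iff_abs_tendsto_zero]
    have := hw2.sqrt
    simpa [Function.comp_def, Real.sqrt_sq_eq_abs] using this
  have hg0 : Tendsto g atTop (𝓝 0) :=
    tendsto_deriv_zero_of_tendsto (by norm_num) dw dg bg' hw0
  have hbdd : ∀ f : ℝ → ℝ, Tendsto f atTop (𝓝 0) →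
      Tendsto (fun t => (z t 4 + 1) * f t) atTop (𝓝 0) := by
    intro f hf
    rw [tendsto_zero_iff_abs_tendsto_zero] at hf ⊢
    have h8 := hf.const_mul 8
    rw [mul_zero] at h8
    refine squeeze_zero' (.of_forall fun t => abs_nonneg _) ?_ h8
    filter_upwards [eventually_ge_atTop 0] with t ht
    rw [Function.comp_apply, abs_mul]
    exact mul_le_mul_of_nonneg_right (b4 t ht) (abs_nonneg _)
  have hu0 : Tendsto (fun t => z t 0 - z t 2) atTop (𝓝 0) := by
    have := hg0.sub (hbdd w hw0)
    simpa [hg] using this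
  -- up to terms that tend to zero, `Γ' = Γ (Γ + n) / n`
  have hΓ : Tendsto (fun t => z t 4) atTop (𝓝 (-n)) := by
    have hsq : Tendsto (fun t => (z t 4 + n) ^ 2) atTop (𝓝 0) := by
      have he : Tendsto (fun t => 2 * p₁ * p₂ / n * ((z t 4 + 1) * w t ^ 2 + (n - 1) * w t ^ 2))
          atTop (𝓝 (2 * p₁ * p₂ / n * (0 + (n - 1) * 0))) :=
        ((hbdd _ hw2).add (hw2.const_mul _)).const_mul _
      rw [mul_zero, add_zero, mul_zero] at he
      refine tendsto_zero_of_deriv_le (k := 1 / 4) (by norm_num) (fun t _ => sq_nonneg _)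
        (fun t ht => ((d4 t ht).add_const n).pow 2) (fun t ht => ?_) he
      have e1 : Q t = (z t 4 ^ 2 + p₁ * p₂ * w t ^ 2) / n := by
        rw [eq_div_iff hn0, ← hQe t ht.le]; ring
      have e2 : 2 * (z t 4 + n) * (z t 4 + Q t) = 2 / n * z t 4 * (z t 4 + n) ^ 2
          + 2 * p₁ * p₂ / n * ((z t 4 + 1) * w t ^ 2 + (n - 1) * w t ^ 2) := by
        rw [e1]; field_simp; ring
      have e3 : 2 / n * z t 4 ≤ -(1 / 4) := by
        have : 1 / 4 ≤ 2 / n := by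
          rw [le_div_iff₀ (by linarith)]; linarith
        nlinarith [n4 t ht.le]
      have := mul_le_mul_of_nonneg_right e3 (sq_nonneg (z t 4 + n))
      simp only [Nat.cast_ofNat, Nat.add_one_sub_one, pow_one]
      linarith
    have habs : Tendsto (fun t => z t 4 + n) atTop (𝓝 0) := by
      rw [tendsto_zero_iff_abs_tendsto_zero]
      have := hsq.sqrt
      simpa [Function.comp_def, Real.sqrt_sq_eq_abs] using this
    simpa using habs.sub_const n
  -- the remaining coordinates are functions of `Γ`, `y₁ - y₂` and `x₁ - x₂` by `J = Z = 0`
  have ev : ∀ {f h : ℝ → ℝ} {a b : ℝ}, Tendsto f atTop (𝓝 a) → (∀ t ≥ 0, f t = h t) → a = b →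
      Tendsto h atTop (𝓝 b) := fun hf h e => by
    rw [← e]
    refine hf.congr' ?_
    filter_upwards [eventually_ge_atTop 0] with t ht using h t ht
  have hQlim := ((hΓ.pow 2).add (hw2.const_mul (p₁ * p₂ : ℝ))).div_const n
  rw [tendsto_pi_nhds]
  intro i
  fin_cases i <;> simp only [ricciFlatCone, Matrix.cons_val, Fin.reduceFinMk,
    Fin.zero_eta, Fin.mk_one]
  · refine ev ((((hΓ.pow 2).sub hQlim).add (hu0.const_mul (p₂ : ℝ))).div_const n)
      (fun t ht => ?_) ?_
    · have e1 := hQe t ht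
      have e2 := (D t ht).J
      unfold solitonJ at e2
      simp only [hQ] at e1
      rw [← e1]
      field_simp
      linear_combination -2 * e2
    · field_simp; ring
  · refine ev (((hΓ.neg.add (hw0.const_mul (p₂ : ℝ))).div_const n).sub_const 1)
      (fun t ht => ?_) ?_
    · have e1 := (D t ht).Z
      simp only [hw]
      field_simp
      linear_combination -e1
    · field_simp; ring
  · refine ev ((((hΓ.pow 2).sub hQlim).sub (hu0.const_mul (p₁ : ℝ))).div_const n)
      (fun t ht => ?_) ?_
    · have e1 := hQe t ht
      have e2 := (D t ht).J
      unfold solitonJ at e2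
      simp only [hQ] at e1
      rw [← e1]
      field_simp
      linear_combination -2 * e2
    · field_simp; ring
  · refine ev (((hΓ.neg.sub (hw0.const_mul (p₁ : ℝ))).div_const n).sub_const 1)
      (fun t ht => ?_) ?_
    · have e1 := (D t ht).Z
      simp only [hw]
      field_simp
      linear_combination -e1
    · field_simp; ring
  · exact hΓ
  · exact ev tendsto_const_nhds (fun t ht => (hσ t ht).symm) rfl

/-- A Ricci-flat orbit exists for all positive times and converges to the Ricci-flat cone. -/
theorem IsRicciFlatData.exists_orbit (hp₁ : 2 ≤ p₁) (hp₂ : 2 ≤ p₂) (hn : p₁ + p₂ ≤ 8)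
    {q : Fin 6 → ℝ} (hq : IsRicciFlatData p₁ p₂ q) :
    ∃ γ : ℝ → Fin 6 → ℝ, γ 0 = q ∧
      IsIntegralCurveOn γ (fun _ => solitonField p₁ p₂ lam) (Ici 0) ∧
      Tendsto γ atTop (𝓝 (ricciFlatCone p₁ p₂)) := by
  obtain ⟨γ, h0, hγ⟩ := exists_isIntegralCurveOn_Ici (p := q) (R := 81)
    (contDiff_solitonField p₁ p₂ lam) fun T hT η hη0 hη => by
      have hD := IsRicciFlatData.of_isIntegralCurveOn hp₁ hη (by rwa [hη0]) ⟨hT, le_rfl⟩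
      obtain ⟨b0, b2, b1, b3, b4⟩ := hD.bounds hp₁ hp₂ hn
      have e0 := hD.x₁
      have e2 := hD.x₂
      have e4 := hD.one_le
      have e5 : η T 5 = 0 := hD.sigma
      rw [pi_norm_le_iff_of_nonneg (by norm_num)]
      rw [abs_le] at b1 b3
      intro i
      rw [Real.norm_eq_abs, abs_le]
      fin_cases i <;> simp only [Fin.reduceFinMk, Fin.zero_eta, Fin.mk_one, e5] <;>
        constructor <;> linarith [b1.1, b1.2, b3.1, b3.2]
  exact ⟨γ, h0, hγ, IsRicciFlatData.tendsto_ricciFlatCone hp₁ hp₂ hn hγ (by rwa [h0])⟩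

end RicciFlat

/-! ### Radial averages on `C([0, 1])` -/

section Averaging

open unitInterval

/-- The continuous extension of a function on `[0, 1]` to `ℝ` by its boundary values. -/
noncomputable def unitExtend (f : C(I, ℝ)) (r : ℝ) : ℝ := f (projIcc 0 1 zero_le_one r)

theorem continuous_unitExtend (f : C(I, ℝ)) : Continuous (unitExtend f) :=
  f.continuous.comp continuous_projIcc

theorem abs_unitExtend_le (f : C(I, ℝ)) (r : ℝ) : |unitExtend f r| ≤ ‖f‖ := f.norm_coe_le_norm _

theorem unitExtend_coe (f : C(I, ℝ)) (x : I) : unitExtend f x = f x := by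
  simp [unitExtend, projIcc_val]

theorem abs_integral_pow_mul_le {k : ℕ} {g : ℝ → ℝ} {C : ℝ} (hg : ∀ θ, |g θ| ≤ C) :
    |∫ θ in (0 : ℝ)..1, θ ^ k * g θ| ≤ C := by
  have := intervalIntegral.norm_integral_le_of_norm_le_const (a := (0 : ℝ)) (b := 1) (C := C)
    (f := fun θ => θ ^ k * g θ) (fun θ hθ => by
      rw [uIoc_of_le zero_le_one] at hθ
      rw [norm_mul, Real.norm_eq_abs, Real.norm_eq_abs, abs_of_nonneg (pow_nonneg hθ.1.le _)]
      exact (mul_le_of_le_one_left (abs_nonneg _) (pow_le_one₀ hθ.1.le hθ.2)).trans (hg θ))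
  simpa using this

/-- The average `(A_k f)(ρ) = ∫₀¹ θ^k f(ρ θ) dθ`. -/
noncomputable def radialAverage (k : ℕ) : C(I, ℝ) →L[ℝ] C(I, ℝ) :=
  LinearMap.mkContinuous
    { toFun := fun f => ⟨fun x => ∫ θ in (0 : ℝ)..1, θ ^ k * unitExtend f (x * θ),
        intervalIntegral.continuous_parametric_intervalIntegral_of_continuous' (by
          have := continuous_unitExtend f
          fun_prop) 0 1⟩
      map_add' := fun f g => by
        ext x
        have hf := continuous_unitExtend f
        have hg := continuous_unitExtend g
        have := intervalIntegral.integral_add (μ := MeasureTheory.volume) (a := 0) (b := 1)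
          (f := fun θ : ℝ => θ ^ k * unitExtend f (x * θ))
          (g := fun θ : ℝ => θ ^ k * unitExtend g (x * θ))
          (Continuous.intervalIntegrable (by fun_prop) _ _)
          (Continuous.intervalIntegrable (by fun_prop) _ _)
        simp only [ContinuousMap.coe_mk, ContinuousMap.add_apply, ← this]
        refine intervalIntegral.integral_congr fun θ _ => ?_
        simp [unitExtend, mul_add]
      map_smul' := fun c f => by
        ext x
        simp only [ContinuousMap.coe_mk, ContinuousMap.smul_apply, RingHom.id_apply, smul_eq_mul,
          ← intervalIntegral.integral_const_mul]
        refine intervalIntegral.integral_congr fun θ _ => ?_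
        simp [unitExtend]
        ring } 1 fun f => by
    rw [one_mul, ContinuousMap.norm_le _ (norm_nonneg _)]
    intro x
    exact abs_integral_pow_mul_le fun θ => abs_unitExtend_le f _

theorem radialAverage_apply (k : ℕ) (f : C(I, ℝ)) (x : I) :
    radialAverage k f x = ∫ θ in (0 : ℝ)..1, θ ^ k * unitExtend f (x * θ) := rfl

/-- In the variable `t = log ρ` the average `A_k` inverts `d/dt + (k + 1)`. -/
theorem hasDerivAt_integral_pow_mul_comp_exp (k : ℕ) {g : ℝ → ℝ} (hg : Continuous g) (t : ℝ) :
    HasDerivAt (fun t => ∫ θ in (0 : ℝ)..1, θ ^ k * g (Real.exp t * θ))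
      (g (Real.exp t) - (k + 1) * ∫ θ in (0 : ℝ)..1, θ ^ k * g (Real.exp t * θ)) t := by
  have hc : Continuous fun r : ℝ => r ^ k * g r := by fun_prop
  have key : ∀ t : ℝ, ∫ θ in (0 : ℝ)..1, θ ^ k * g (Real.exp t * θ) =
      Real.exp (-((k + 1) * t)) * ∫ r in (0 : ℝ)..Real.exp t, r ^ k * g r := by
    intro t
    have h1 := intervalIntegral.integral_comp_mul_left (a := 0) (b := 1)
      (fun r : ℝ => r ^ k * g r) (Real.exp_pos t).ne'
    simp only [mul_zero, mul_one, mul_pow, mul_assoc] at h1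
    rw [intervalIntegral.integral_const_mul, smul_eq_mul] at h1
    have h2 : Real.exp t ^ k * Real.exp (-((k + 1) * t)) * Real.exp t = 1 := by
      rw [← Real.exp_nat_mul, ← Real.exp_add, ← Real.exp_add, Real.exp_eq_one_iff]; ring
    have h3 : Real.exp t * (Real.exp t)⁻¹ = 1 := mul_inv_cancel₀ (Real.exp_pos t).ne'
    set Y := ∫ θ in (0 : ℝ)..1, θ ^ k * g (Real.exp t * θ)
    set Z := ∫ r in (0 : ℝ)..Real.exp t, r ^ k * g r
    linear_combination (-Y) * h2 + Real.exp (-((k + 1) * t)) * Real.exp t * h1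
      + Real.exp (-((k + 1) * t)) * Z * h3
  have hF : HasDerivAt (fun t => ∫ r in (0 : ℝ)..Real.exp t, r ^ k * g r)
      (Real.exp t ^ k * g (Real.exp t) * Real.exp t) t :=
    (intervalIntegral.integral_hasDerivAt_right (hc.intervalIntegrable _ _)
      (hc.stronglyMeasurableAtFilter _ _) hc.continuousAt).comp t (Real.hasDerivAt_exp t)
  have hE : HasDerivAt (fun t : ℝ => Real.exp (-((k + 1) * t)))
      (Real.exp (-((k + 1) * t)) * (-((k + 1) * 1))) t :=
    ((hasDerivAt_id t).const_mul ((k : ℝ) + 1)).neg.exp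
  rw [funext key]
  refine (hE.mul hF).congr_deriv ?_
  rw [key t]
  have h2 : Real.exp t ^ k * Real.exp (-((k + 1) * t)) * Real.exp t = 1 := by
    rw [← Real.exp_nat_mul, ← Real.exp_add, ← Real.exp_add, Real.exp_eq_one_iff]; ring
  linear_combination g (Real.exp t) * h2

/-- The weight `exp (-M ρ²)`, as a unit of the algebra `C([0, 1])`. -/
noncomputable def gaussWeight (M : ℝ) : C(I, ℝ) :=
  ⟨fun x => Real.exp (-M * (x : ℝ) ^ 2), by fun_prop⟩

theorem gaussWeight_mul_neg (M : ℝ) : gaussWeight M * gaussWeight (-M) = 1 := by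
  ext x
  simp [gaussWeight, ← Real.exp_add]

/-- Conjugation by the weight does not increase the norm of an average. -/
theorem norm_weighted_radialAverage_le {M : ℝ} (hM : 0 ≤ M) (k : ℕ) (f : C(I, ℝ)) :
    ‖gaussWeight M * radialAverage k (gaussWeight (-M) * f)‖ ≤ ‖f‖ := by
  rw [ContinuousMap.norm_le _ (norm_nonneg _)]
  intro x
  rw [ContinuousMap.mul_apply, radialAverage_apply, ← intervalIntegral.integral_const_mul]
  have := intervalIntegral.norm_integral_le_of_norm_le_const (a := (0 : ℝ)) (b := 1) (C := ‖f‖)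
    (f := fun θ => gaussWeight M x * (θ ^ k * unitExtend (gaussWeight (-M) * f) (x * θ)))
    (fun θ hθ => by
      rw [uIoc_of_le zero_le_one] at hθ
      have hx : (x : ℝ) * θ ∈ Icc (0 : ℝ) 1 :=
        ⟨mul_nonneg x.2.1 hθ.1.le, mul_le_one₀ x.2.2 hθ.1.le hθ.2⟩
      have e : unitExtend (gaussWeight (-M) * f) (x * θ) =
          Real.exp (M * (x * θ) ^ 2) * unitExtend f (x * θ) := by
        simp [unitExtend, gaussWeight, projIcc_of_mem _ hx]
      rw [e, gaussWeight, ContinuousMap.coe_mk, Real.norm_eq_abs, abs_mul, abs_mul, abs_mul,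
        Real.abs_exp, Real.abs_exp, abs_of_nonneg (pow_nonneg hθ.1.le _)]
      have e1 : Real.exp (-M * (x : ℝ) ^ 2) * Real.exp (M * (x * θ) ^ 2) ≤ 1 := by
        rw [← Real.exp_add, Real.exp_le_one_iff]
        have : θ ^ 2 ≤ 1 := pow_le_one₀ hθ.1.le hθ.2
        nlinarith [mul_nonneg (mul_nonneg hM (sq_nonneg (x : ℝ))) (sub_nonneg.2 this)]
      calc _ = θ ^ k * (Real.exp (-M * (x : ℝ) ^ 2) * Real.exp (M * (x * θ) ^ 2))
            * |unitExtend f (x * θ)| := by ring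
        _ ≤ 1 * 1 * ‖f‖ := by
          gcongr
          · exact pow_le_one₀ hθ.1.le hθ.2
          · exact abs_unitExtend_le f _
        _ = ‖f‖ := by ring)
  simpa using this

/-- The function `ρ²`. -/
def sqMap : C(I, ℝ) := ⟨fun x => (x : ℝ) ^ 2, by fun_prop⟩

/-- The operators `ρ² A_k`, `k ≥ 1`, are of Volterra type: they become small after conjugation with
a strong weight. -/
theorem norm_weighted_sqMap_mul_radialAverage_le {M : ℝ} (hM : 0 < M) {k : ℕ} (hk : 1 ≤ k)
    (f : C(I, ℝ)) :
    ‖gaussWeight M * (sqMap * radialAverage k (gaussWeight (-M) * f))‖ ≤ 1 / (2 * M) * ‖f‖ := by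
  rw [ContinuousMap.norm_le _ (by positivity)]
  intro x
  rw [ContinuousMap.mul_apply, ContinuousMap.mul_apply, radialAverage_apply,
    ← intervalIntegral.integral_const_mul, ← intervalIntegral.integral_const_mul]
  have hd : ∀ θ : ℝ, HasDerivAt
      (fun θ => ‖f‖ / (2 * M) * Real.exp (-M * (x : ℝ) ^ 2 * (1 - θ ^ 2)))
      (‖f‖ * ((x : ℝ) ^ 2 * θ * Real.exp (-M * (x : ℝ) ^ 2 * (1 - θ ^ 2)))) θ := fun θ => by
    refine (((((hasDerivAt_id θ).pow 2).const_sub 1).const_mul (-M * (x : ℝ) ^ 2)).exp.const_mul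
      (‖f‖ / (2 * M))).congr_deriv ?_
    simp
    field_simp
  have hint := intervalIntegral.integral_eq_sub_of_hasDerivAt (a := 0) (b := 1)
    (fun θ _ => hd θ) (Continuous.intervalIntegrable (by fun_prop) _ _)
  have hle := intervalIntegral.norm_integral_le_of_norm_le (μ := MeasureTheory.volume)
    (a := (0 : ℝ)) (b := 1) zero_le_one
    (f := fun θ => gaussWeight M x *
      (sqMap x * (θ ^ k * unitExtend (gaussWeight (-M) * f) (x * θ))))
    (g := fun θ => ‖f‖ * ((x : ℝ) ^ 2 * θ * Real.exp (-M * (x : ℝ) ^ 2 * (1 - θ ^ 2))))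
    (Filter.Eventually.of_forall fun θ hθ => by
      have hx : (x : ℝ) * θ ∈ Icc (0 : ℝ) 1 :=
        ⟨mul_nonneg x.2.1 hθ.1.le, mul_le_one₀ x.2.2 hθ.1.le hθ.2⟩
      have e : unitExtend (gaussWeight (-M) * f) (x * θ) =
          Real.exp (M * (x * θ) ^ 2) * unitExtend f (x * θ) := by
        simp [unitExtend, gaussWeight, projIcc_of_mem _ hx]
      rw [e, gaussWeight, sqMap, ContinuousMap.coe_mk, ContinuousMap.coe_mk, Real.norm_eq_abs,
        abs_mul, abs_mul, abs_mul, abs_mul, Real.abs_exp, Real.abs_exp,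
        abs_of_nonneg (pow_nonneg hθ.1.le _), abs_of_nonneg (sq_nonneg (x : ℝ))]
      have e1 : Real.exp (-M * (x : ℝ) ^ 2) * Real.exp (M * (x * θ) ^ 2) =
          Real.exp (-M * (x : ℝ) ^ 2 * (1 - θ ^ 2)) := by
        rw [← Real.exp_add]; ring_nf
      have hk' : θ ^ k ≤ θ := pow_le_of_le_one hθ.1.le hθ.2 (by omega)
      calc _ = |unitExtend f (x * θ)| * ((x : ℝ) ^ 2 * θ ^ k *
            (Real.exp (-M * (x : ℝ) ^ 2) * Real.exp (M * (x * θ) ^ 2))) := by ring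
        _ ≤ ‖f‖ * ((x : ℝ) ^ 2 * θ *
            (Real.exp (-M * (x : ℝ) ^ 2) * Real.exp (M * (x * θ) ^ 2))) := by
          have h0 : 0 ≤ θ := hθ.1.le
          gcongr
          exact abs_unitExtend_le f _
        _ = _ := by rw [e1])
    (Continuous.intervalIntegrable (by fun_prop) _ _)
  refine hle.trans ?_
  rw [hint]
  have h0 := Real.exp_pos (-M * (x : ℝ) ^ 2 * (1 - 0 ^ 2))
  have h1 : 0 ≤ ‖f‖ / (2 * M) := by positivity
  simp only [one_pow, sub_self, mul_zero, Real.exp_zero, mul_one]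
  calc _ ≤ ‖f‖ / (2 * M) := sub_le_self _ (mul_nonneg h1 h0.le)
    _ = _ := by ring

end Averaging

/-! ### The integral equation for orbits emanating from the good fill -/

section IntegralEquation

open unitInterval

/-- The nonlinear part of the soliton field in the chart, over a commutative real algebra `R`. The
terms of degree three carry the factor `τ`, so that for `u = τ ω` it is `τ⁻²` times the nonlinear
part at `u`. -/
noncomputable def solitonRem {R : Type*} [CommRing R] [Algebra ℝ R] (p₁ p₂ : ℕ) (lam d : ℝ) (τ : R)
    (ω : Fin 6 → R) : Fin 6 → R :=
  ![0,
    (-(2 * d)) • (ω 1 * ω 3),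
    (-lam) • (ω 0 * ((d • ω 4 - ω 5 - (p₂ * d) • ω 3) - (p₂ * d) • ω 3
      + τ * ((1 / p₁ : ℝ) • (d • ω 4 - ω 5 - (p₂ * d) • ω 3) ^ 2 + (p₂ * d ^ 2) • ω 3 ^ 2))),
    ω 5 * ω 3 - (lam * d ^ 2) • (ω 0 * ω 3),
    ω 5 * ω 4 - (lam * d) • (ω 0 * (d • ω 4 - ω 5)),
    (1 / p₁ : ℝ) • (d • ω 4 - ω 5 - (p₂ * d) • ω 3) ^ 2 + (p₂ * d ^ 2) • ω 3 ^ 2]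

/-- The off-diagonal linear part of the soliton field in the chart, up to the factor `d`. -/
noncomputable def solitonLin (R : Type*) [NormedCommRing R] [NormedAlgebra ℝ R] (p₂ : ℕ) (lam : ℝ) :
    (Fin 6 → R) →L[ℝ] (Fin 6 → R) :=
  ContinuousLinearMap.pi ![0, 0, 0,
    .proj 1 + lam • .proj 0, (2 : ℝ) • .proj 2 + (lam * p₂) • .proj 0,
    (2 : ℝ) • .proj 4 - (2 * p₂ : ℝ) • .proj 3]

/-- The rates of the linear part at the good fill: `2` three times, and the stable rates. -/
def solitonRate (p₁ : ℕ) : Fin 6 → ℝ := ![2, 2, 2, -(p₁ - 1), -(p₁ - 1), -1]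

/-- One more than the difference between the unstable rate `2` and the rates `solitonRate`. -/
def rateGap (p₁ : ℕ) : Fin 6 → ℕ := ![1, 1, 1, p₁ + 2, p₁ + 2, 4]

variable {p₁ p₂ : ℕ} {lam d : ℝ}

theorem solitonRate_eq (i : Fin 6) : solitonRate p₁ i = 3 - rateGap p₁ i := by
  fin_cases i <;> simp [solitonRate, rateGap] <;> ring

theorem one_le_rateGap (i : Fin 6) : 1 ≤ rateGap p₁ i := by
  fin_cases i <;> simp [rateGap]

theorem solitonChartField_eq (u : Fin 6 → ℝ) (i : Fin 6) : solitonChartField p₁ p₂ lam d u i =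
    solitonRate p₁ i * u i + d * solitonLin ℝ p₂ lam u i + solitonRem p₁ p₂ lam d 1 u i := by
  fin_cases i <;> simp [solitonChartField, solitonRate, solitonLin, solitonRem] <;> ring

theorem solitonRem_smul (τ : ℝ) (ω : Fin 6 → ℝ) (i : Fin 6) :
    solitonRem p₁ p₂ lam d 1 (τ • ω) i = τ ^ 2 * solitonRem p₁ p₂ lam d τ ω i := by
  fin_cases i <;> simp [solitonRem] <;> ring

theorem solitonRem_apply (τ : C(I, ℝ)) (ω : Fin 6 → C(I, ℝ)) (i : Fin 6) (x : I) :
    solitonRem p₁ p₂ lam d τ ω i x = solitonRem p₁ p₂ lam d (τ x) (fun j => ω j x) i := by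
  fin_cases i <;> simp [solitonRem]

theorem solitonLin_apply (ω : Fin 6 → C(I, ℝ)) (i : Fin 6) (x : I) :
    solitonLin C(I, ℝ) p₂ lam ω i x = solitonLin ℝ p₂ lam (fun j => ω j x) i := by
  fin_cases i <;> simp [solitonLin]

theorem contDiff_solitonRem {R : Type*} [NormedCommRing R] [NormedAlgebra ℝ R] {n : WithTop ℕ∞}
    (τ : R) : ContDiff ℝ n (solitonRem p₁ p₂ lam d τ) := by
  rw [contDiff_pi]
  intro i
  fin_cases i <;> simp only [solitonRem, Matrix.cons_val, Fin.reduceFinMk, Fin.zero_eta,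
    Fin.mk_one] <;> fun_prop

theorem solitonRem_zero {R : Type*} [CommRing R] [Algebra ℝ R] (τ : R) :
    solitonRem p₁ p₂ lam d τ 0 = 0 := by
  ext i
  fin_cases i <;> simp [solitonRem]

/-- Componentwise multiplication by a function. -/
noncomputable def mulOp (e : C(I, ℝ)) : (Fin 6 → C(I, ℝ)) →L[ℝ] (Fin 6 → C(I, ℝ)) :=
  ContinuousLinearMap.pi fun i => (ContinuousLinearMap.mul ℝ C(I, ℝ) e).comp (.proj i)

/-- The diagonal operator of radial averages that inverts the linear part. In the unstable rows,
where `solitonLin` vanishes, the exponent `rateGap - 2` is a truncated subtraction without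
significance. -/
noncomputable def averageOp (p₁ : ℕ) : (Fin 6 → C(I, ℝ)) →L[ℝ] (Fin 6 → C(I, ℝ)) :=
  ContinuousLinearMap.pi fun i => (radialAverage (rateGap p₁ i - 2)).comp (.proj i)

/-- The diagonal operator `ρ² A_k`. -/
noncomputable def sqAverageOp (p₁ : ℕ) : (Fin 6 → C(I, ℝ)) →L[ℝ] (Fin 6 → C(I, ℝ)) :=
  ContinuousLinearMap.pi fun i =>
    ((ContinuousLinearMap.mul ℝ C(I, ℝ) sqMap).comp (radialAverage (rateGap p₁ i))).comp (.proj i)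

/-- The map whose level sets over the constants `(ξ₀, ξ₁, ξ₂, 0, 0, 0)` are the orbits emanating
from the good fill: `u(t) = e^{2t} ω(e^t)`, and `ξ` is the unstable part of `ω(0)`. -/
noncomputable def solitonInt (p₁ p₂ : ℕ) (lam d : ℝ) (ω : Fin 6 → C(I, ℝ)) : Fin 6 → C(I, ℝ) :=
  ω - d • averageOp p₁ (solitonLin C(I, ℝ) p₂ lam ω)
    - sqAverageOp p₁ (solitonRem p₁ p₂ lam d sqMap ω)

theorem contDiff_solitonInt {n : WithTop ℕ∞} : ContDiff ℝ n (solitonInt p₁ p₂ lam d) := by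
  have := contDiff_solitonRem (p₁ := p₁) (p₂ := p₂) (lam := lam) (d := d) (n := n) sqMap
  unfold solitonInt
  fun_prop

theorem solitonInt_zero : solitonInt p₁ p₂ lam d 0 = 0 := by
  simp [solitonInt, solitonRem_zero]

/-- The derivative of the pointwise operator `solitonRem` commutes with multiplication by
functions. -/
theorem fderiv_solitonRem_mulOp (e : C(I, ℝ)) (ω : Fin 6 → C(I, ℝ)) :
    (fderiv ℝ (solitonRem p₁ p₂ lam d sqMap) ω).comp (mulOp e) =
      (mulOp e).comp (fderiv ℝ (solitonRem p₁ p₂ lam d sqMap) ω) := by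
  ext h i x
  let E : (Fin 6 → C(I, ℝ)) →L[ℝ] (Fin 6 → ℝ) :=
    ContinuousLinearMap.pi fun i => (ContinuousMap.evalCLM ℝ x).comp (.proj i)
  have hE : ∀ h j, E h j = h j x := fun h j => rfl
  have h1 := ((contDiff_solitonRem (p₁ := p₁) (p₂ := p₂) (lam := lam) (d := d) (n := 1)
    (sqMap : C(I, ℝ))).differentiable one_ne_zero ω).hasFDerivAt
  have h2 := ((contDiff_solitonRem (p₁ := p₁) (p₂ := p₂) (lam := lam) (d := d) (n := 1)
    (sqMap x)).differentiable one_ne_zero (E ω)).hasFDerivAt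
  have h3 := E.hasFDerivAt.comp ω h1
  have h4 := h2.comp ω E.hasFDerivAt
  have heq : (E : (Fin 6 → C(I, ℝ)) → Fin 6 → ℝ) ∘ solitonRem p₁ p₂ lam d sqMap =
      solitonRem p₁ p₂ lam d (sqMap x) ∘ E := by
    ext ω i
    exact solitonRem_apply _ _ _ _
  rw [heq] at h3
  have key := h3.unique h4
  have key' : ∀ h, E (fderiv ℝ (solitonRem p₁ p₂ lam d sqMap) ω h) =
      fderiv ℝ (solitonRem p₁ p₂ lam d (sqMap x)) (E ω) (E h) := fun h =>
    DFunLike.congr_fun key h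
  have hm : E (mulOp e h) = e x • E h := by
    ext j; simp [hE, mulOp]
  have := congrFun (key' (mulOp e h)) i
  rw [hm, map_smul, ← key' h, hE] at this
  simpa [mulOp, hE] using this

theorem solitonLin_mulOp (e : C(I, ℝ)) :
    (solitonLin C(I, ℝ) p₂ lam).comp (mulOp e) = (mulOp e).comp (solitonLin C(I, ℝ) p₂ lam) := by
  ext h i x
  fin_cases i <;> simp [solitonLin, mulOp] <;> ring

theorem mulOp_comp (e f : C(I, ℝ)) : (mulOp e).comp (mulOp f) = mulOp (e * f) := by
  ext h i x
  simp [mulOp, mul_assoc]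

/-- The identity minus `d A Λ + B F` is invertible if some weight `S` commuting with `Λ` and `F`
makes the conjugates of `A` and `B` small. -/
theorem isUnit_one_sub_of_weighted {𝔸 : Type*} [NormedRing 𝔸] [NormedAlgebra ℝ 𝔸]
    [HasSummableGeomSeries 𝔸] {S S' A B Λ F : 𝔸} {d c : ℝ} (hd : 0 ≤ d)
    (hSS' : S * S' = 1) (hS'S : S' * S = 1) (nA : ‖S * A * S'‖ ≤ 1) (nB : ‖S * B * S'‖ ≤ c)
    (cL : S * Λ * S' = Λ) (cF : S * F * S' = F) (hL : d * ‖Λ‖ ≤ 1 / 4) (hF : c * ‖F‖ ≤ 1 / 4) :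
    IsUnit (1 - (d • A * Λ + B * F)) := by
  have conj : S * (d • A * Λ + B * F) * S' = d • (S * A * S') * Λ + S * B * S' * F := by
    conv_rhs => rw [← cL, ← cF]
    rw [mul_add, add_mul]
    congr 1
    · calc _ = d • (S * A * 1 * Λ * S') := by
            simp only [smul_mul_assoc, mul_smul_comm, mul_assoc, one_mul]
        _ = _ := by rw [← hS'S]; simp only [smul_mul_assoc, mul_assoc]
    · calc _ = S * B * 1 * F * S' := by simp only [mul_assoc, one_mul]
        _ = _ := by rw [← hS'S]; simp only [mul_assoc]
  have small : ‖S * (d • A * Λ + B * F) * S'‖ < 1 := by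
    rw [conj]
    calc _ ≤ ‖d • (S * A * S') * Λ‖ + ‖S * B * S' * F‖ := norm_add_le _ _
      _ ≤ d * 1 * ‖Λ‖ + c * ‖F‖ := by
        refine add_le_add ((norm_mul_le _ _).trans ?_) ((norm_mul_le _ _).trans ?_)
        · rw [norm_smul, Real.norm_of_nonneg hd]; gcongr
        · gcongr
      _ < 1 := by linarith
  have hu := isUnit_one_sub_of_norm_lt_one small
  have e : 1 - (d • A * Λ + B * F) = S' * (1 - S * (d • A * Λ + B * F) * S') * S := by
    rw [mul_sub, sub_mul, mul_one, hS'S]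
    congr 1
    calc _ = (S' * S) * (d • A * Λ + B * F) * (S' * S) := by rw [hS'S, one_mul, mul_one]
      _ = _ := by simp only [mul_assoc]
  rw [e]
  exact ((isUnit_iff_exists.2 ⟨S, hS'S, hSS'⟩).mul hu).mul (isUnit_iff_exists.2 ⟨S', hSS', hS'S⟩)

/-- The derivative of `solitonInt` is invertible everywhere: after conjugation with a strong weight
it is a small perturbation of the identity. -/
theorem exists_hasFDerivAt_solitonInt (hd : 0 ≤ d)
    (hL : d * ‖solitonLin C(I, ℝ) p₂ lam‖ ≤ 1 / 4) (ω : Fin 6 → C(I, ℝ)) :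
    ∃ T : (Fin 6 → C(I, ℝ)) ≃L[ℝ] (Fin 6 → C(I, ℝ)),
      HasFDerivAt (solitonInt p₁ p₂ lam d) (T : (Fin 6 → C(I, ℝ)) →L[ℝ] (Fin 6 → C(I, ℝ))) ω := by
  set F := fderiv ℝ (solitonRem p₁ p₂ lam d (sqMap : C(I, ℝ))) ω with hF
  set Λ := solitonLin C(I, ℝ) p₂ lam with hΛ
  have h1 := ((contDiff_solitonRem (p₁ := p₁) (p₂ := p₂) (lam := lam) (d := d) (n := 1)
    (sqMap : C(I, ℝ))).differentiable one_ne_zero ω).hasFDerivAt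
  set M : ℝ := 2 * (‖F‖ + 1) with hM
  have hM0 : 0 < M := by positivity
  set S := mulOp (gaussWeight M) with hS
  set S' := mulOp (gaussWeight (-M)) with hS'
  have hw := gaussWeight_mul_neg M
  have one : mulOp 1 = 1 := by ext h i x; simp [mulOp]
  have hSS' : S * S' = 1 := by
    change S.comp S' = 1
    rw [hS, hS', mulOp_comp, hw, one]
  have hS'S : S' * S = 1 := by
    change S'.comp S = 1
    rw [hS, hS', mulOp_comp, mul_comm, hw, one]
  set T : (Fin 6 → C(I, ℝ)) →L[ℝ] (Fin 6 → C(I, ℝ)) := d • averageOp p₁ * Λ + sqAverageOp p₁ * F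
    with hT
  have hderiv : HasFDerivAt (solitonInt p₁ p₂ lam d) (1 - T) ω := by
    have h2 := ((hasFDerivAt_id (𝕜 := ℝ) ω).sub
      (((averageOp p₁).hasFDerivAt.comp ω Λ.hasFDerivAt).const_smul d)).sub
      ((sqAverageOp p₁).hasFDerivAt.comp ω h1)
    refine h2.congr_fderiv ?_
    ext h i x
    simp [hT, sub_sub]
    rfl
  have nA : ‖S * averageOp p₁ * S'‖ ≤ 1 := by
    refine ContinuousLinearMap.opNorm_le_bound _ zero_le_one fun h => ?_
    rw [one_mul, pi_norm_le_iff_of_nonneg (norm_nonneg _)]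
    intro i
    exact (norm_weighted_radialAverage_le hM0.le _ (h i)).trans (norm_le_pi_norm h i)
  have nB : ‖S * sqAverageOp p₁ * S'‖ ≤ 1 / (2 * M) := by
    refine ContinuousLinearMap.opNorm_le_bound _ (by positivity) fun h => ?_
    rw [pi_norm_le_iff_of_nonneg (by positivity)]
    intro i
    refine (norm_weighted_sqMap_mul_radialAverage_le hM0 (one_le_rateGap i) (h i)).trans ?_
    gcongr
    exact norm_le_pi_norm h i
  have cL : S * Λ * S' = Λ := by
    have : Λ * S' = S' * Λ := solitonLin_mulOp _
    rw [mul_assoc, this, ← mul_assoc, hSS', one_mul]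
  have cF : S * F * S' = F := by
    have : F * S' = S' * F := fderiv_solitonRem_mulOp _ _
    rw [mul_assoc, this, ← mul_assoc, hSS', one_mul]
  have hFM : 1 / (2 * M) * ‖F‖ ≤ 1 / 4 := by
    rw [hM, div_mul_eq_mul_div, div_le_iff₀ (by positivity)]
    nlinarith [norm_nonneg F]
  obtain ⟨U, hU⟩ : IsUnit (1 - T) :=
    isUnit_one_sub_of_weighted (S := S) (S' := S') (A := averageOp p₁) (B := sqAverageOp p₁)
      (Λ := Λ) (F := F) (c := 1 / (2 * M)) hd hSS' hS'S nA nB cL cF hL hFM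
  refine ⟨ContinuousLinearEquiv.unitsEquiv ℝ _ U, ?_⟩
  exact hderiv.congr_fderiv hU.symm

end IntegralEquation

/-! ### Orbits as solutions of the integral equation -/

section OrbitsFromIntegral

open unitInterval

variable {p₁ p₂ : ℕ} {lam d : ℝ}

/-- The curve `u(t) = e^{2t} ω(e^t)`, for `t ≤ 0`. -/
noncomputable def rescaledCurve (ω : Fin 6 → C(I, ℝ)) (t : ℝ) : Fin 6 → ℝ := fun i =>
  Real.exp (2 * t) * unitExtend (ω i) (Real.exp t)

/-- The point `e^t` of `[0, 1]`, for `t ≤ 0`. -/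
noncomputable def expI (t : ℝ) : I := projIcc 0 1 zero_le_one (Real.exp t)

theorem coe_expI {t : ℝ} (ht : t ≤ 0) : (expI t : ℝ) = Real.exp t := by
  rw [expI, projIcc_of_mem zero_le_one ⟨(Real.exp_pos t).le, Real.exp_le_one_iff.2 ht⟩]

/-- The integral terms of `solitonInt` in the variable `t = log ρ`. -/
noncomputable def integralTerm (p₁ p₂ : ℕ) (lam d : ℝ) (ω : Fin 6 → C(I, ℝ)) (i : Fin 6)
    (t : ℝ) : ℝ :=
  d * (∫ θ in (0 : ℝ)..1, θ ^ (rateGap p₁ i - 2) *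
      unitExtend (solitonLin C(I, ℝ) p₂ lam ω i) (Real.exp t * θ))
    + Real.exp (2 * t) * ∫ θ in (0 : ℝ)..1, θ ^ (rateGap p₁ i) *
      unitExtend (solitonRem p₁ p₂ lam d sqMap ω i) (Real.exp t * θ)

theorem solitonInt_expI (ω : Fin 6 → C(I, ℝ)) (i : Fin 6) {t : ℝ} (ht : t ≤ 0) :
    solitonInt p₁ p₂ lam d ω i (expI t) = ω i (expI t) - integralTerm p₁ p₂ lam d ω i t := by
  simp only [solitonInt, integralTerm, Pi.sub_apply, Pi.smul_apply, ContinuousMap.sub_apply,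
    ContinuousMap.smul_apply, averageOp, sqAverageOp, ContinuousLinearMap.pi_apply,
    ContinuousLinearMap.comp_apply, ContinuousLinearMap.proj_apply, ContinuousLinearMap.mul_apply',
    ContinuousMap.mul_apply, radialAverage_apply, coe_expI ht, sqMap, ContinuousMap.coe_mk,
    smul_eq_mul]
  rw [← Real.exp_nat_mul]
  push_cast
  ring

theorem hasDerivAt_integralTerm (ω : Fin 6 → C(I, ℝ)) (i : Fin 6) {t : ℝ} (ht : t ≤ 0) :
    HasDerivAt (integralTerm p₁ p₂ lam d ω i)
      (d * solitonLin ℝ p₂ lam (fun j => ω j (expI t)) i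
        + Real.exp (2 * t) * solitonRem p₁ p₂ lam d (Real.exp (2 * t)) (fun j => ω j (expI t)) i
        - (rateGap p₁ i - 1) * integralTerm p₁ p₂ lam d ω i t) t := by
  have h1 := hasDerivAt_integral_pow_mul_comp_exp (rateGap p₁ i - 2)
    (continuous_unitExtend (solitonLin C(I, ℝ) p₂ lam ω i)) t
  have h2 := hasDerivAt_integral_pow_mul_comp_exp (rateGap p₁ i)
    (continuous_unitExtend (solitonRem p₁ p₂ lam d sqMap ω i)) t
  have h3 : HasDerivAt (fun t : ℝ => Real.exp (2 * t)) (Real.exp (2 * t) * (2 * 1)) t :=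
    ((hasDerivAt_id t).const_mul 2).exp
  refine ((h1.const_mul d).add (h3.mul h2)).congr_deriv ?_
  have e1 : unitExtend (solitonLin C(I, ℝ) p₂ lam ω i) (Real.exp t) =
      solitonLin ℝ p₂ lam (fun j => ω j (expI t)) i := solitonLin_apply _ _ _
  have e2 : unitExtend (solitonRem p₁ p₂ lam d sqMap ω i) (Real.exp t) =
      solitonRem p₁ p₂ lam d (Real.exp (2 * t)) (fun j => ω j (expI t)) i := by
    have := solitonRem_apply (p₁ := p₁) (p₂ := p₂) (lam := lam) (d := d) sqMap ω i (expI t)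
    have hs : sqMap (expI t) = Real.exp (2 * t) := by
      rw [sqMap, ContinuousMap.coe_mk, coe_expI ht, ← Real.exp_nat_mul]; push_cast; ring_nf
    rw [hs] at this
    exact this
  rw [e1, e2, integralTerm]
  -- in the unstable rows the linear part vanishes, so the truncated exponent is irrelevant
  by_cases hk : rateGap p₁ i = 1
  · have hz : solitonLin C(I, ℝ) p₂ lam ω i = 0 := by
      fin_cases i <;> simp [rateGap] at hk <;> simp [solitonLin]
    have hz' : solitonLin ℝ p₂ lam (fun j => ω j (expI t)) i = 0 := by
      rw [← solitonLin_apply, hz]; rfl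
    have hz2 : ∀ r, unitExtend (0 : C(I, ℝ)) r = 0 := fun r => rfl
    simp only [hz, hz', hz2, mul_zero, intervalIntegral.integral_zero, hk]
    push_cast
    ring
  · have : ((rateGap p₁ i - 2 : ℕ) : ℝ) = rateGap p₁ i - 2 := by
      have := one_le_rateGap (p₁ := p₁) i
      rw [Nat.cast_sub (by omega)]; norm_num
    rw [this]
    ring

theorem rescaledCurve_apply (ω : Fin 6 → C(I, ℝ)) (t : ℝ) (i : Fin 6) :
    rescaledCurve ω t i = Real.exp (2 * t) * ω i (expI t) := rfl

/-- Solutions of the integral equation are orbits. -/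
theorem isIntegralCurveOn_rescaledCurve {ω : Fin 6 → C(I, ℝ)} {c : Fin 6 → ℝ}
    (hc : ∀ i, rateGap p₁ i ≠ 1 → c i = 0)
    (h : solitonInt p₁ p₂ lam d ω = fun i => ContinuousMap.const I (c i)) :
    IsIntegralCurveOn (rescaledCurve ω) (fun _ => solitonChartField p₁ p₂ lam d) (Iic 0) := by
  intro t ht
  rw [hasDerivWithinAt_pi]
  intro i
  have eq : ∀ s ≤ 0, ω i (expI s) = c i + integralTerm p₁ p₂ lam d ω i s := fun s hs => by
    have := solitonInt_expI (p₁ := p₁) (p₂ := p₂) (lam := lam) (d := d) ω i hs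
    rw [h, ContinuousMap.const_apply] at this
    linarith
  have h3 : HasDerivAt (fun t : ℝ => Real.exp (2 * t)) (Real.exp (2 * t) * (2 * 1)) t :=
    ((hasDerivAt_id t).const_mul 2).exp
  have h4 := (h3.mul ((hasDerivAt_integralTerm (p₁ := p₁) (p₂ := p₂) (lam := lam) (d := d) ω i
    ht).const_add (c i))).hasDerivWithinAt (s := Iic 0)
  refine (h4.congr_of_mem (f₁ := fun s => rescaledCurve ω s i) (fun s hs => ?_) ht).congr_deriv ?_
  · simp only [rescaledCurve_apply, eq s hs, Pi.mul_apply]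
  · have hcz : (rateGap p₁ i - 1 : ℝ) * c i = 0 := by
      by_cases hk : rateGap p₁ i = 1
      · simp [hk]
      · simp [hc i hk]
    have hr : rescaledCurve ω t = Real.exp (2 * t) • fun j => ω j (expI t) := rfl
    change _ = solitonChartField p₁ p₂ lam d (rescaledCurve ω t) i
    rw [solitonChartField_eq, hr, solitonRem_smul, map_smul, solitonRate_eq]
    simp only [Pi.smul_apply, smul_eq_mul, ← eq t ht]
    have := eq t ht
    set E := Real.exp (2 * t)
    linear_combination E * (rateGap p₁ i - 1) * this + E * hcz

/-- Orbits of the form `e^{2t} ω(e^t)` with `ω` continuous on `[0, 1]` solve the integral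
equation. -/
theorem exists_solitonInt_eq_const {ω : Fin 6 → C(I, ℝ)}
    (h : IsIntegralCurveOn (rescaledCurve ω) (fun _ => solitonChartField p₁ p₂ lam d) (Iic 0)) :
    ∃ c : Fin 6 → ℝ, (∀ i, rateGap p₁ i ≠ 1 → c i = 0) ∧
      solitonInt p₁ p₂ lam d ω = fun i => ContinuousMap.const I (c i) := by
  have hder : ∀ i, ∀ t ∈ Iic (0 : ℝ), HasDerivWithinAt
      (fun t => solitonInt p₁ p₂ lam d ω i (expI t))
      (-(rateGap p₁ i - 1) * solitonInt p₁ p₂ lam d ω i (expI t)) (Iic 0) t := by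
    intro i t ht
    have h1 : HasDerivWithinAt (fun s => rescaledCurve ω s i)
        (solitonChartField p₁ p₂ lam d (rescaledCurve ω t) i) (Iic 0) t :=
      hasDerivWithinAt_pi.1 (h t ht) i
    have h3 : HasDerivAt (fun t : ℝ => Real.exp (-(2 * t))) (Real.exp (-(2 * t)) * (-(2 * 1))) t :=
      ((hasDerivAt_id t).const_mul 2).neg.exp
    have h4 := (h3.hasDerivWithinAt.mul h1).sub (hasDerivAt_integralTerm (p₁ := p₁) (p₂ := p₂)
      (lam := lam) (d := d) ω i ht).hasDerivWithinAt
    refine (h4.congr_of_mem (f₁ := fun t => solitonInt p₁ p₂ lam d ω i (expI t))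
      (fun s hs => ?_) ht).congr_deriv ?_
    · simp only [solitonInt_expI ω i hs, Pi.sub_apply, Pi.mul_apply, rescaledCurve_apply,
        ← mul_assoc, ← Real.exp_add]
      simp
    · have hr : rescaledCurve ω t = Real.exp (2 * t) • fun j => ω j (expI t) := rfl
      have he : Real.exp (-(2 * t)) * Real.exp (2 * t) = 1 := by rw [← Real.exp_add]; simp
      rw [solitonChartField_eq, hr, solitonRem_smul, map_smul, solitonRate_eq,
        solitonInt_expI ω i ht]
      simp only [Pi.smul_apply, smul_eq_mul]
      set E := Real.exp (2 * t)
      set E' := Real.exp (-(2 * t))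
      linear_combination ((1 - rateGap p₁ i) * ω i (expI t) +
        d * solitonLin ℝ p₂ lam (fun j => ω j (expI t)) i
        + E * solitonRem p₁ p₂ lam d E (fun j => ω j (expI t)) i) * he
  have hexp : ∀ i, ∀ t ∈ Iic (0 : ℝ), solitonInt p₁ p₂ lam d ω i (expI t) =
      solitonInt p₁ p₂ lam d ω i (expI 0) * Real.exp (-(rateGap p₁ i - 1) * t) := fun i t ht =>
    eq_mul_exp_of_hasDerivWithinAt (f := fun t => solitonInt p₁ p₂ lam d ω i (expI t))
      (convex_Iic 0) (mem_Iic.2 le_rfl) (hder i) ht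
  have hzero : ∀ i, rateGap p₁ i ≠ 1 → solitonInt p₁ p₂ lam d ω i (expI 0) = 0 := by
    intro i hk
    by_contra hne
    have hk2 : (2 : ℝ) ≤ rateGap p₁ i := by
      have := one_le_rateGap (p₁ := p₁) i
      exact_mod_cast (by omega : 2 ≤ rateGap p₁ i)
    have hpos : 0 < |solitonInt p₁ p₂ lam d ω i (expI 0)| := abs_pos.2 hne
    set A := |solitonInt p₁ p₂ lam d ω i (expI 0)|
    set N := ‖solitonInt p₁ p₂ lam d ω i‖
    have hN : 0 ≤ N := norm_nonneg _
    have hbd : ∀ s ≥ 0, A * s ≤ N := by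
      intro s hs
      have h1 := hexp i (-s) (by simpa using hs)
      have h2 : |solitonInt p₁ p₂ lam d ω i (expI (-s))| ≤ N :=
        (solitonInt p₁ p₂ lam d ω i).norm_coe_le_norm _
      rw [h1, abs_mul, Real.abs_exp] at h2
      refine le_trans ?_ h2
      gcongr
      have := Real.add_one_le_exp (-((rateGap p₁ i : ℝ) - 1) * -s)
      nlinarith
    have := hbd ((N + 1) / A) (by positivity)
    rw [mul_div_cancel₀ _ hpos.ne'] at this
    linarith
  refine ⟨fun i => solitonInt p₁ p₂ lam d ω i (expI 0), hzero, ?_⟩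
  ext i x
  rw [ContinuousMap.const_apply]
  have hconst : ∀ t ≤ 0, solitonInt p₁ p₂ lam d ω i (expI t) =
      solitonInt p₁ p₂ lam d ω i (expI 0) := fun t ht => by
    rw [hexp i t ht]
    by_cases hk : rateGap p₁ i = 1
    · simp [hk]
    · rw [hzero i hk, zero_mul]
  -- the points `e^t` are dense in `[0, 1]`
  have hdense : x ∈ closure {y : I | (0 : ℝ) < (y : ℝ)} := by
    rw [Metric.mem_closure_iff]
    intro ε hε
    refine ⟨⟨max (x : ℝ) (min (ε / 2) 1),
      ⟨le_max_of_le_left x.2.1, max_le x.2.2 (min_le_right _ _)⟩⟩,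
      lt_max_of_lt_right (lt_min (half_pos hε) one_pos), ?_⟩
    rw [Subtype.dist_eq, Real.dist_eq, abs_sub_comm, abs_lt]
    have h1 := min_le_left (ε / 2) 1
    have h2 := x.2.1
    constructor
    · linarith [le_max_left (x : ℝ) (min (ε / 2) 1)]
    · rcases max_cases (x : ℝ) (min (ε / 2) 1) with h | h <;> linarith [h.1]
  refine closure_minimal (t := {y : I | solitonInt p₁ p₂ lam d ω i y =
    solitonInt p₁ p₂ lam d ω i (expI 0)}) ?_
    (isClosed_eq (map_continuous _) continuous_const) hdense
  intro y hy
  have hlog : Real.log y ≤ 0 := Real.log_nonpos y.2.1 y.2.2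
  have := hconst _ hlog
  rwa [show expI (Real.log y) = y from Subtype.ext (by rw [coe_expI hlog, Real.exp_log hy])] at this

/-- If `e^{-2t} u(t)` has a limit as `t → -∞`, then `u` is of the form `e^{2t} ω(e^t)` with `ω`
continuous on `[0, 1]`. -/
theorem exists_rescaledCurve_eq {u : ℝ → Fin 6 → ℝ} (hu : ContinuousOn u (Iic 0)) {ℓ : Fin 6 → ℝ}
    (hlim : Tendsto (fun t => Real.exp (-(2 * t)) • u t) atBot (𝓝 ℓ)) :
    ∃ ω : Fin 6 → C(I, ℝ), (∀ t ≤ 0, rescaledCurve ω t = u t) ∧ ∀ i, ω i 0 = ℓ i := by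
  classical
  set f : Fin 6 → I → ℝ := fun i x => if (x : ℝ) = 0 then ℓ i else
    Real.exp (-(2 * Real.log x)) * u (Real.log x) i with hf
  have hf0 : ∀ i (x : I), (x : ℝ) = 0 → f i x = ℓ i := fun i x hx => if_pos hx
  have hf1 : ∀ i (x : I), (x : ℝ) ≠ 0 → f i x =
    Real.exp (-(2 * Real.log x)) * u (Real.log x) i := fun i x hx => if_neg hx
  have hcont : ∀ i, Continuous (f i) := by
    intro i
    rw [continuous_iff_continuousAt]
    intro x
    by_cases hx : (x : ℝ) = 0
    · have hfx : f i x = ℓ i := hf0 i x hx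
      rw [ContinuousAt, hfx]
      rw [Metric.tendsto_nhds_nhds]
      intro ε hε
      have h1 := (tendsto_pi_nhds.1 hlim i)
      obtain ⟨T, hT⟩ := (Metric.tendsto_nhds.1 h1 ε hε).exists_forall_of_atBot
      refine ⟨Real.exp T, Real.exp_pos T, fun y hy => ?_⟩
      by_cases hy0 : (y : ℝ) = 0
      · rwa [hf0 i y hy0, dist_self]
      · have hypos : 0 < (y : ℝ) := lt_of_le_of_ne y.2.1 (Ne.symm hy0)
        rw [Subtype.dist_eq, hx, Real.dist_eq, sub_zero, abs_of_pos hypos] at hy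
        have := hT (Real.log y) (by rw [Real.log_le_iff_le_exp hypos]; exact hy.le)
        rwa [hf1 i y hy0]
    · have hxpos : 0 < (x : ℝ) := lt_of_le_of_ne x.2.1 (Ne.symm hx)
      have hlogc : ContinuousAt (fun y : I => Real.log (y : ℝ)) x :=
        (Real.continuousAt_log hx).comp continuous_subtype_val.continuousAt
      have hmaps : ∀ y : I, Real.log (y : ℝ) ∈ Iic (0 : ℝ) := fun y =>
        Real.log_nonpos y.2.1 y.2.2
      have huc : ContinuousAt (fun y : I => u (Real.log (y : ℝ))) x :=
        (hu _ (hmaps x)).tendsto.comp (tendsto_nhdsWithin_iff.2 ⟨hlogc, .of_forall hmaps⟩)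
      have h2 : ContinuousAt (fun y : I => Real.exp (-(2 * Real.log (y : ℝ))) *
          u (Real.log (y : ℝ)) i) x :=
        (Real.continuous_exp.continuousAt.comp (hlogc.const_mul 2).neg).mul
          ((continuous_apply i).continuousAt.comp huc)
      refine h2.congr ?_
      have : ∀ᶠ y : I in 𝓝 x, (0 : ℝ) < y :=
        continuous_subtype_val.continuousAt.eventually (lt_mem_nhds hxpos)
      filter_upwards [this] with y hy
      rw [hf1 i y hy.ne']
  refine ⟨fun i => ⟨f i, hcont i⟩, fun t ht => ?_, fun i => hf0 i 0 rfl⟩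
  ext i
  rw [rescaledCurve_apply, ContinuousMap.coe_mk]
  rw [hf1 i _ (by rw [coe_expI ht]; exact (Real.exp_pos t).ne'), coe_expI ht, Real.log_exp]
  rw [← mul_assoc, ← Real.exp_add]
  simp

end OrbitsFromIntegral

/-! ### Orbits near the good fill are determined by their unstable components -/

section ConeLemma

variable {p₁ p₂ : ℕ} {lam d : ℝ}

/-- The nonlinear part of the field is of second order. -/
theorem fderiv_solitonRem_zero : fderiv ℝ (solitonRem p₁ p₂ lam d (1 : ℝ)) 0 = 0 := by
  have h1 := ((contDiff_solitonRem (p₁ := p₁) (p₂ := p₂) (lam := lam) (d := d) (n := 1)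
    (1 : ℝ)).differentiable one_ne_zero 0).hasFDerivAt
  ext h i
  have h2 : HasDerivAt (fun τ : ℝ => τ • h) h 0 := by
    simpa using (hasDerivAt_id (0 : ℝ)).smul_const h
  have h1' : HasFDerivAt (solitonRem p₁ p₂ lam d (1 : ℝ))
      (fderiv ℝ (solitonRem p₁ p₂ lam d (1 : ℝ)) 0) ((0 : ℝ) • h) := by
    rw [zero_smul]; exact h1
  have h3 := hasDerivAt_pi.1 (h1'.comp_hasDerivAt (0 : ℝ) h2) i
  have h4 : Differentiable ℝ fun τ : ℝ => solitonRem p₁ p₂ lam d τ h i := by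
    fin_cases i <;> simp only [solitonRem, Matrix.cons_val, Fin.reduceFinMk, Fin.zero_eta,
      Fin.mk_one] <;> fun_prop
  have h5 := ((hasDerivAt_id (0 : ℝ)).pow 2).mul (h4 0).hasDerivAt
  have h6 : (fun τ : ℝ => solitonRem p₁ p₂ lam d 1 (τ • h) i) =
      (fun τ : ℝ => τ ^ 2 * solitonRem p₁ p₂ lam d τ h i) := funext fun τ => solitonRem_smul τ h i
  have h7 : HasDerivAt (fun τ : ℝ => solitonRem p₁ p₂ lam d 1 (τ • h) i) 0 0 := by
    rw [h6]
    exact h5.congr_deriv (by simp)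
  exact h3.unique h7

theorem exists_norm_solitonRem_sub_le {κ : ℝ} (hκ : 0 < κ) :
    ∃ ε > 0, ∀ u v, ‖u‖ ≤ ε → ‖v‖ ≤ ε →
      ‖solitonRem p₁ p₂ lam d (1 : ℝ) u - solitonRem p₁ p₂ lam d 1 v‖ ≤ κ * ‖u - v‖ := by
  have h1 := ((contDiff_solitonRem (p₁ := p₁) (p₂ := p₂) (lam := lam) (d := d) (n := 1)
    (1 : ℝ)).contDiffAt (x := 0)).hasStrictFDerivAt one_ne_zero
  rw [fderiv_solitonRem_zero] at h1
  obtain ⟨ε, hε, h⟩ := Metric.eventually_nhds_iff.1 (h1.isLittleO.def hκ)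
  refine ⟨ε / 2, by positivity, fun u v hu hv => ?_⟩
  have := h (y := (u, v)) (by
    rw [Prod.dist_eq, dist_zero_right, dist_zero_right]
    exact max_lt (by linarith) (by linarith))
  simpa using this

/-- Two orbits that stay close to the good fill for all negative times are equal if their unstable
components agree at time `0`: the difference `w` satisfies `(S - P)' ≤ -(S - P)`, where `S` and `P`
are the squared norms of its stable and unstable parts, and so `S ≤ P`. -/
theorem exists_eq_of_eq_unstable (hp₁ : 2 ≤ p₁) (hd : 0 ≤ d)
    (hL : d * ‖solitonLin ℝ p₂ lam‖ ≤ 1 / 24) :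
    ∃ ε > 0, ∀ u v : ℝ → Fin 6 → ℝ,
      IsIntegralCurveOn u (fun _ => solitonChartField p₁ p₂ lam d) (Iic 0) →
      IsIntegralCurveOn v (fun _ => solitonChartField p₁ p₂ lam d) (Iic 0) →
      (∀ t ≤ 0, ‖u t‖ ≤ ε) → (∀ t ≤ 0, ‖v t‖ ≤ ε) →
      u 0 0 = v 0 0 → u 0 1 = v 0 1 → u 0 2 = v 0 2 → u 0 = v 0 := by
  obtain ⟨ε, hε, hrem⟩ := exists_norm_solitonRem_sub_le (p₁ := p₁) (p₂ := p₂) (lam := lam) (d := d)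
    (by norm_num : (0 : ℝ) < 1 / 24)
  refine ⟨ε, hε, fun u v hu hv hub hvb e0 e1 e2 => ?_⟩
  have hp : (2 : ℝ) ≤ p₁ := by exact_mod_cast hp₁
  set g : ℝ → Fin 6 → ℝ := fun t => d • solitonLin ℝ p₂ lam (u t - v t) +
    (solitonRem p₁ p₂ lam d 1 (u t) - solitonRem p₁ p₂ lam d 1 (v t)) with hg
  have hgle : ∀ t ≤ 0, ‖g t‖ ≤ 1 / 12 * ‖u t - v t‖ := fun t ht => by
    have h1 : ‖d • solitonLin ℝ p₂ lam (u t - v t)‖ ≤ 1 / 24 * ‖u t - v t‖ := by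
      rw [norm_smul, Real.norm_of_nonneg hd]
      calc _ ≤ d * (‖solitonLin ℝ p₂ lam‖ * ‖u t - v t‖) := by
            gcongr; exact ContinuousLinearMap.le_opNorm _ _
        _ = d * ‖solitonLin ℝ p₂ lam‖ * ‖u t - v t‖ := by ring
        _ ≤ _ := by gcongr
    have h2 := hrem _ _ (hub t ht) (hvb t ht)
    calc _ ≤ _ := norm_add_le _ _
      _ ≤ _ := by linarith
  have hder : ∀ i, ∀ t ∈ Iic (0 : ℝ), HasDerivWithinAt (fun t => u t i - v t i)
      (solitonRate p₁ i * (u t i - v t i) + g t i) (Iic 0) t := fun i t ht => by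
    have h1 := (hasDerivWithinAt_pi.1 (hu t ht) i).sub (hasDerivWithinAt_pi.1 (hv t ht) i)
    refine h1.congr_deriv ?_
    change solitonChartField p₁ p₂ lam d (u t) i - solitonChartField p₁ p₂ lam d (v t) i = _
    rw [solitonChartField_eq, solitonChartField_eq]
    simp only [hg, map_sub, Pi.add_apply, Pi.smul_apply, Pi.sub_apply, smul_eq_mul]
    ring
  set f : ℝ → ℝ := fun t => (u t 3 - v t 3) ^ 2 + (u t 4 - v t 4) ^ 2 + (u t 5 - v t 5) ^ 2
    - ((u t 0 - v t 0) ^ 2 + (u t 1 - v t 1) ^ 2 + (u t 2 - v t 2) ^ 2) with hf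
  have hfder := fun t ht => (((((hder 3 t ht).pow 2).add ((hder 4 t ht).pow 2)).add
    ((hder 5 t ht).pow 2)).sub ((((hder 0 t ht).pow 2).add ((hder 1 t ht).pow 2)).add
    ((hder 2 t ht).pow 2)))
  have key : f 0 ≤ 0 := by
    refine nonpos_of_hasDerivWithinAt_le_neg (f := f) (M := 3 * (2 * ε) ^ 2) hfder ?_ ?_ le_rfl
    · intro t ht
      set w := u t - v t with hw
      have hwi : ∀ i, u t i - v t i = w i := fun i => rfl
      have hn : ‖w‖ ^ 2 ≤ w 0 ^ 2 + w 1 ^ 2 + w 2 ^ 2 + (w 3 ^ 2 + w 4 ^ 2 + w 5 ^ 2) := by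
        have : ‖w‖ ≤ √(w 0 ^ 2 + w 1 ^ 2 + w 2 ^ 2 + (w 3 ^ 2 + w 4 ^ 2 + w 5 ^ 2)) := by
          rw [pi_norm_le_iff_of_nonneg (Real.sqrt_nonneg _)]
          intro i
          rw [Real.norm_eq_abs]
          refine Real.abs_le_sqrt ?_
          fin_cases i <;> simp only [Fin.reduceFinMk, Fin.zero_eta, Fin.mk_one] <;>
            linarith [sq_nonneg (w 0), sq_nonneg (w 1), sq_nonneg (w 2), sq_nonneg (w 3),
              sq_nonneg (w 4), sq_nonneg (w 5)]
        calc ‖w‖ ^ 2 ≤ _ := pow_le_pow_left₀ (norm_nonneg _) this 2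
          _ = _ := Real.sq_sqrt (by positivity)
      have hwg : ∀ i, |w i * g t i| ≤ 1 / 12 * ‖w‖ ^ 2 := fun i => by
        have h1 : |w i| ≤ ‖w‖ := norm_le_pi_norm w i
        have h2 : |g t i| ≤ 1 / 12 * ‖w‖ := (norm_le_pi_norm (g t) i).trans (hgle t ht)
        rw [abs_mul]
        calc _ ≤ ‖w‖ * (1 / 12 * ‖w‖) := by gcongr
          _ = _ := by ring
      have a0 := neg_le_of_abs_le (hwg 0)
      have a1 := neg_le_of_abs_le (hwg 1)
      have a2 := neg_le_of_abs_le (hwg 2)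
      have a3 := le_of_abs_le (hwg 3)
      have a4 := le_of_abs_le (hwg 4)
      have a5 := le_of_abs_le (hwg 5)
      have b3 : (p₁ - 1 : ℝ) * w 3 ^ 2 ≥ w 3 ^ 2 :=
        le_mul_of_one_le_left (sq_nonneg _) (by linarith)
      have b4 : (p₁ - 1 : ℝ) * w 4 ^ 2 ≥ w 4 ^ 2 :=
        le_mul_of_one_le_left (sq_nonneg _) (by linarith)
      simp only [hf, hwi, solitonRate, Matrix.cons_val]
      norm_num
      nlinarith [sq_nonneg (w 0), sq_nonneg (w 1), sq_nonneg (w 2)]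
    · intro t ht
      have : ∀ i, (u t i - v t i) ^ 2 ≤ (2 * ε) ^ 2 := fun i => by
        rw [← sq_abs]
        gcongr
        calc |u t i - v t i| ≤ ‖u t - v t‖ := norm_le_pi_norm (u t - v t) i
          _ ≤ ‖u t‖ + ‖v t‖ := norm_sub_le _ _
          _ ≤ 2 * ε := by linarith [hub t ht, hvb t ht]
      simp only [hf]
      linarith [this 3, this 4, this 5, sq_nonneg (u t 0 - v t 0), sq_nonneg (u t 1 - v t 1),
        sq_nonneg (u t 2 - v t 2)]
  simp only [hf, e0, e1, e2] at key
  have s3 := sq_nonneg (u 0 3 - v 0 3)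
  have s4 := sq_nonneg (u 0 4 - v 0 4)
  have s5 := sq_nonneg (u 0 5 - v 0 5)
  have z3 : (u 0 3 - v 0 3) ^ 2 = 0 := by linarith
  have z4 : (u 0 4 - v 0 4) ^ 2 = 0 := by linarith
  have z5 : (u 0 5 - v 0 5) ^ 2 = 0 := by linarith
  ext i
  fin_cases i
  · exact e0
  · exact e1
  · exact e2
  · exact sub_eq_zero.1 (pow_eq_zero_iff two_ne_zero |>.1 z3)
  · exact sub_eq_zero.1 (pow_eq_zero_iff two_ne_zero |>.1 z4)
  · exact sub_eq_zero.1 (pow_eq_zero_iff two_ne_zero |>.1 z5)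

end ConeLemma

/-! ### The Böhm orbit -/

section BoehmOrbit

open unitInterval

variable {p₁ p₂ : ℕ} {lam d : ℝ}

theorem norm_rescaledCurve_le (ω : Fin 6 → C(I, ℝ)) (t : ℝ) :
    ‖rescaledCurve ω t‖ ≤ Real.exp (2 * t) * ‖ω‖ := by
  rw [pi_norm_le_iff_of_nonneg (by positivity)]
  intro i
  rw [rescaledCurve, norm_mul, Real.norm_eq_abs, Real.abs_exp]
  gcongr
  exact (abs_unitExtend_le _ _).trans (norm_le_pi_norm ω i)

theorem tendsto_exp_two_mul_atBot : Tendsto (fun t : ℝ => Real.exp (2 * t)) atBot (𝓝 0) :=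
  Real.tendsto_exp_atBot.comp (tendsto_id.const_mul_atBot two_pos)

theorem tendsto_rescaledCurve_atBot (ω : Fin 6 → C(I, ℝ)) :
    Tendsto (rescaledCurve ω) atBot (𝓝 0) := by
  refine squeeze_zero_norm (norm_rescaledCurve_le ω) ?_
  simpa using tendsto_exp_two_mul_atBot.mul_const ‖ω‖

theorem tendsto_exp_smul_rescaledCurve (ω : Fin 6 → C(I, ℝ)) :
    Tendsto (fun t => Real.exp (-(2 * t)) • rescaledCurve ω t) atBot (𝓝 fun i => ω i 0) := by
  rw [tendsto_pi_nhds]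
  intro i
  have h1 : Tendsto (fun t => unitExtend (ω i) (Real.exp t)) atBot (𝓝 (unitExtend (ω i) 0)) :=
    (continuous_unitExtend (ω i)).continuousAt.tendsto.comp Real.tendsto_exp_atBot
  have h2 : unitExtend (ω i) 0 = ω i 0 := unitExtend_coe (ω i) 0
  rw [h2] at h1
  refine h1.congr fun t => ?_
  rw [Pi.smul_apply, smul_eq_mul, rescaledCurve, ← mul_assoc, ← Real.exp_add]
  simp

/-- The triples `ξ` of unstable components, as constant functions in the unstable rows. -/
noncomputable def unstableConst : (Fin 3 → ℝ) →L[ℝ] (Fin 6 → C(I, ℝ)) :=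
  let κ : ℝ →L[ℝ] C(I, ℝ) := ContinuousLinearMap.toSpanSingleton ℝ 1
  ContinuousLinearMap.pi ![κ ∘L .proj 0, κ ∘L .proj 1, κ ∘L .proj 2, 0, 0, 0]

theorem unstableConst_apply (ξ : Fin 3 → ℝ) :
    unstableConst ξ = fun i => ContinuousMap.const I (![ξ 0, ξ 1, ξ 2, 0, 0, 0] i) := by
  ext i x
  fin_cases i <;> simp [unstableConst]

theorem exists_unstableConst_eq {c : Fin 6 → ℝ} (hc : ∀ i, rateGap p₁ i ≠ 1 → c i = 0) :
    unstableConst ![c 0, c 1, c 2] = fun i => ContinuousMap.const I (c i) := by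
  rw [unstableConst_apply]
  have h3 : c 3 = 0 := hc 3 (by simp [rateGap])
  have h4 : c 4 = 0 := hc 4 (by simp [rateGap])
  have h5 : c 5 = 0 := hc 5 (by simp [rateGap])
  ext i x
  fin_cases i <;> simp [h3, h4, h5]

theorem isIntegralCurveOn_rescaledCurve_of_unstableConst {ω : Fin 6 → C(I, ℝ)} {ξ : Fin 3 → ℝ}
    (h : solitonInt p₁ p₂ lam d ω = unstableConst ξ) :
    IsIntegralCurveOn (rescaledCurve ω) (fun _ => solitonChartField p₁ p₂ lam d) (Iic 0) := by
  rw [unstableConst_apply] at h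
  refine isIntegralCurveOn_rescaledCurve (fun i hi => ?_) h
  fin_cases i <;> simp [rateGap] at hi ⊢

/-- The triple `ξ` is the unstable part of `ω(0)`. -/
theorem apply_zero_of_solitonInt_eq {ω : Fin 6 → C(I, ℝ)} {ξ : Fin 3 → ℝ}
    (h : solitonInt p₁ p₂ lam d ω = unstableConst ξ) (i : Fin 3) :
    ω (i.castLE (by norm_num)) 0 = ξ i := by
  rw [unstableConst_apply] at h
  have key : ∀ j, solitonLin C(I, ℝ) p₂ lam ω j = 0 →
      ω j 0 = ![ξ 0, ξ 1, ξ 2, 0, 0, 0] j := fun j hj => by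
    have h1 := DFunLike.congr_fun (congrFun h j) 0
    simp [solitonInt, averageOp, sqAverageOp, sqMap, hj] at h1
    exact h1
  fin_cases i
  · exact key 0 (by simp [solitonLin])
  · exact key 1 (by simp [solitonLin])
  · exact key 2 (by simp [solitonLin])

/-- The component of `σ` is constant, since its equation is `σ' = 2 σ`. -/
theorem apply_of_solitonInt_eq {ω : Fin 6 → C(I, ℝ)} {ξ : Fin 3 → ℝ}
    (h : solitonInt p₁ p₂ lam d ω = unstableConst ξ) : ω 0 = ContinuousMap.const I (ξ 0) := by
  rw [unstableConst_apply] at h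
  simpa [solitonInt, averageOp, sqAverageOp, solitonLin, solitonRem] using congrFun h 0

/-- If `σ = 0` then the component of `J` is constant, too. -/
theorem apply_two_of_solitonInt_eq {ω : Fin 6 → C(I, ℝ)} {ξ : Fin 3 → ℝ}
    (h : solitonInt p₁ p₂ lam d ω = unstableConst ξ) (h0 : ξ 0 = 0) :
    ω 2 = ContinuousMap.const I (ξ 2) := by
  have hω : ω 0 = 0 := by rw [apply_of_solitonInt_eq h, h0]; rfl
  rw [unstableConst_apply] at h
  simpa [solitonInt, averageOp, sqAverageOp, solitonLin, solitonRem, hω] using congrFun h 2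

/-- By the inverse function theorem the solutions of the integral equation form a `C¹` family,
parametrized by their unstable parts. -/
theorem exists_family (hd : 0 ≤ d) (hL : d * ‖solitonLin C(I, ℝ) p₂ lam‖ ≤ 1 / 4)
    {ω : Fin 6 → C(I, ℝ)} {ξ : Fin 3 → ℝ} (h : solitonInt p₁ p₂ lam d ω = unstableConst ξ) :
    ∃ Ω : (Fin 3 → ℝ) → Fin 6 → C(I, ℝ), Ω ξ = ω ∧ ContDiffAt ℝ 1 Ω ξ ∧
      ∀ᶠ η in 𝓝 ξ, solitonInt p₁ p₂ lam d (Ω η) = unstableConst η := by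
  obtain ⟨T, hT⟩ := exists_hasFDerivAt_solitonInt (p₁ := p₁) hd hL ω
  have hc : ContDiffAt ℝ 1 (solitonInt p₁ p₂ lam d) ω := contDiff_solitonInt.contDiffAt
  have hs := hc.hasStrictFDerivAt' hT one_ne_zero
  have hinv := hc.to_localInverse hT one_ne_zero
  rw [h] at hinv
  have hright := hs.eventually_right_inverse
  rw [h] at hright
  refine ⟨hc.localInverse hT one_ne_zero ∘ unstableConst, ?_, ?_, ?_⟩
  · rw [Function.comp_apply, ← h, hc.localInverse_apply_image hT one_ne_zero]
  · exact hinv.comp ξ unstableConst.contDiff.contDiffAt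
  · exact unstableConst.continuous.continuousAt.eventually hright

/-- The two fixed points are joined by an orbit, which emanates from the good fill with the
leading rate. -/
theorem exists_boehmOrbit (hp₁ : 2 ≤ p₁) (hp₂ : 2 ≤ p₂) (hn : p₁ + p₂ ≤ 8) (hd : 0 < d)
    (hL : d * ‖solitonLin C(I, ℝ) p₂ lam‖ ≤ 1 / 4) :
    ∃ B : ℝ → Fin 6 → ℝ, IsIntegralCurve B (fun _ => solitonField p₁ p₂ lam) ∧
      Tendsto B atBot (𝓝 (goodFill p₁)) ∧ Tendsto B atTop (𝓝 (ricciFlatCone p₁ p₂)) ∧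
      ∃ ℓ, Tendsto (fun t => Real.exp (-(2 * t)) • solitonChart p₁ p₂ d (B t)) atBot (𝓝 ℓ) := by
  have hp : (2 : ℝ) ≤ p₁ := by exact_mod_cast hp₁
  have hp₁0 : p₁ ≠ 0 := by omega
  -- a member of the family with `σ = J = 0` and `x₂ > 0`
  obtain ⟨s, hs, ω, hω⟩ : ∃ s > 0, ∃ ω, solitonInt p₁ p₂ lam d ω = unstableConst ![0, s, 0] := by
    obtain ⟨Ω, -, -, hΩ⟩ := exists_family (p₁ := p₁) (p₂ := p₂) (lam := lam) (ω := 0) (ξ := 0)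
      hd.le hL (by rw [solitonInt_zero, map_zero])
    have hlim : Tendsto (fun s : ℝ => ![0, s, 0]) (𝓝[>] 0) (𝓝 (0 : Fin 3 → ℝ)) := by
      have : Continuous fun s : ℝ => (![0, s, 0] : Fin 3 → ℝ) := by fun_prop
      have h := this.tendsto 0
      rw [show (![0, 0, 0] : Fin 3 → ℝ) = 0 by ext i; fin_cases i <;> rfl] at h
      exact h.mono_left nhdsWithin_le_nhds
    obtain ⟨s, h1, h2⟩ := ((hlim.eventually hΩ).and self_mem_nhdsWithin).exists
    exact ⟨s, h2, _, h1⟩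
  set u := rescaledCurve ω with hu
  have hu' : IsIntegralCurveOn u (fun _ => solitonChartField p₁ p₂ lam d) (Iic 0) :=
    isIntegralCurveOn_rescaledCurve_of_unstableConst hω
  have hulim : Tendsto u atBot (𝓝 0) := tendsto_rescaledCurve_atBot ω
  have hu0 : ∀ t, u t 0 = 0 := fun t => by
    simp [hu, rescaledCurve, apply_of_solitonInt_eq hω, unitExtend]
  have hu2 : ∀ t, u t 2 = 0 := fun t => by
    simp [hu, rescaledCurve, apply_two_of_solitonInt_eq hω rfl, unitExtend]
  have hu1 : ∀ᶠ t in atBot, 0 < u t 1 := by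
    have h1 := tendsto_pi_nhds.1 (tendsto_exp_smul_rescaledCurve ω) 1
    have h2 : ω 1 0 = s := apply_zero_of_solitonInt_eq hω 1
    rw [h2] at h1
    filter_upwards [h1.eventually (lt_mem_nhds hs)] with t ht
    exact pos_of_mul_pos_right ht (Real.exp_pos _).le
  -- `Z' = (Γ + 1) Z` with `Γ + 1 → 1 - p₁ < 0`, so that `Z` vanishes because it is bounded
  have hu4 : ∀ᶠ t in atBot, u t 4 = 0 := by
    have h5 : ∀ᶠ t in atBot, u t 5 ≤ 1 / 2 := by
      have := tendsto_pi_nhds.1 hulim 5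
      filter_upwards [this.eventually (gt_mem_nhds (by norm_num : (0 : ℝ) < 1 / 2))] with t ht
        using le_of_lt ht
    obtain ⟨T, hT, hT0⟩ := ((eventually_forall_le_atBot.2 h5).and (eventually_le_atBot 0)).exists
    have hm : MapsTo (· + T) (Iic (0 : ℝ)) (Iic 0) := fun t ht => by
      simp only [mem_Iic] at ht ⊢; linarith
    have hder : ∀ t ∈ Iic (0 : ℝ), HasDerivWithinAt (fun t => u (t + T) 4)
        (-(p₁ - 1) * u (t + T) 4 + u (t + T) 5 * u (t + T) 4) (Iic 0) t := fun t ht => by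
      have h1 : HasDerivWithinAt (fun t => u (t + T) 4)
          (solitonChartField p₁ p₂ lam d (u (t + T)) 4) (Iic 0) t :=
        hasDerivWithinAt_pi.1 (hu'.shift T hm t ht) 4
      refine h1.congr_deriv ?_
      simp only [solitonChartField, Matrix.cons_val, hu0, hu2]
      ring
    filter_upwards [eventually_le_atBot T] with t ht
    have := nonpos_of_hasDerivWithinAt_le_neg (f := fun t => u (t + T) 4 ^ 2) (M := ‖ω‖ ^ 2)
      (t := t - T) (fun t ht => (hder t ht).pow 2) (fun t ht => ?_) (fun t ht => ?_) (by linarith)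
    · simp only [sub_add_cancel] at this
      exact pow_eq_zero_iff two_ne_zero |>.1 (le_antisymm this (sq_nonneg _))
    · have h1 := hT (t + T) (by have : t ≤ 0 := ht; linarith)
      norm_num
      nlinarith [mul_nonneg (sq_nonneg (u (t + T) 4)) (sub_nonneg.2 h1),
        mul_nonneg (sq_nonneg (u (t + T) 4)) (sub_nonneg.2 hp)]
    · rw [← sq_abs]
      have h2 : t + T ≤ 0 := hm ht
      gcongr
      calc _ ≤ ‖u (t + T)‖ := norm_le_pi_norm (u (t + T)) 4
        _ ≤ Real.exp (2 * (t + T)) * ‖ω‖ := norm_rescaledCurve_le _ _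
        _ ≤ 1 * ‖ω‖ := by
          gcongr
          exact Real.exp_le_one_iff.2 (by linarith)
        _ = ‖ω‖ := one_mul _
  set b : ℝ → Fin 6 → ℝ := fun t => solitonChartInv p₁ p₂ d (u t) with hb
  have hb' : IsIntegralCurveOn b (fun _ => solitonField p₁ p₂ lam) (Iic 0) := fun t ht =>
    hasDerivWithinAt_solitonChartInv hp₁0 (hu' t ht)
  have hblim : Tendsto b atBot (𝓝 (goodFill p₁)) := by
    rw [← solitonChartInv_zero (p₂ := p₂) hp₁0 hd.ne']
    exact (contDiff_solitonChartInv (n := 0)).continuous.continuousAt.tendsto.comp hulim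
  have hbu : ∀ t, solitonChart p₁ p₂ d (b t) = u t := fun t =>
    solitonChart_solitonChartInv hp₁0 hd.ne' _
  have hdata : ∀ᶠ t in atBot, IsRicciFlatData p₁ p₂ (b t) := by
    have l0 := tendsto_pi_nhds.1 hblim 0
    have l4 := tendsto_pi_nhds.1 hblim 4
    simp only [goodFill, Matrix.cons_val] at l0 l4
    filter_upwards [hu1, hu4, l0.eventually (lt_mem_nhds (by linarith : (0 : ℝ) < p₁ - 1)),
      l4.eventually (gt_mem_nhds (by linarith : -(p₁ : ℝ) < -1)),
      l4.eventually (lt_mem_nhds (by linarith : -(p₁ + 1 : ℝ) < -p₁))] with t h1 h4 hx1 ha hc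
    have e := hbu t
    have e2 := congrFun e 2
    have e4 := congrFun e 4
    simp only [solitonChart, Matrix.cons_val, hu2, h4, div_eq_zero_iff, hd.ne', pow_eq_zero_iff,
      ne_eq, OfNat.ofNat_ne_zero, not_false_eq_true, or_false] at e2 e4
    refine ⟨?_, e2, e4, hx1, ?_, by linarith, by linarith [(Nat.cast_nonneg p₂ : (0 : ℝ) ≤ p₂)]⟩
    · simp [hb, solitonChartInv, solitonSigma, hu0]
    · simp only [hb, solitonChartInv, Matrix.cons_val]
      positivity
  obtain ⟨T, hT, hT0⟩ := (hdata.and (eventually_le_atBot 0)).exists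
  obtain ⟨ζ, hζ0, hζ, hζlim⟩ := hT.exists_orbit (lam := lam) hp₁ hp₂ hn
  have hs : IsIntegralCurveOn (fun t => ζ (t + -T)) (fun _ => solitonField p₁ p₂ lam)
      (univ ∩ Ici T) := hζ.shift _ fun t ht => by
    simpa using ht.2
  have hB := IsIntegralCurveOn.concat (a := T) (S := univ)
    (hb'.mono fun t ht => (show t ≤ T from ht.2).trans hT0) hs (by simp [hζ0])
  have hBb : (fun t => if t ≤ T then b t else ζ (t + -T)) =ᶠ[atBot] b := by
    filter_upwards [eventually_le_atBot T] with t ht using if_pos ht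
  refine ⟨_, isIntegralCurveOn_univ.1 hB, hblim.congr' hBb.symm, ?_, fun i => ω i 0, ?_⟩
  · refine (hζlim.comp (tendsto_id.atTop_add (tendsto_const_nhds (x := -T)))).congr' ?_
    filter_upwards [eventually_gt_atTop T] with t ht
    simp [not_le.2 ht]
  · refine (tendsto_exp_smul_rescaledCurve ω).congr' ?_
    filter_upwards [hBb] with t ht
    rw [ht, hbu]

end BoehmOrbit

/-! ### The intersection of the unstable and the stable manifold -/

section Intersection

variable {p₁ p₂ : ℕ} {lam d : ℝ}

/-- The sign of `x₂` is constant along orbits. -/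
theorem exists_pos_x₂_eq {z : ℝ → Fin 6 → ℝ} {S : Set ℝ} {π : ℝ → ℝ} (hS : Convex ℝ S) (h0 : 0 ∈ S)
    (hπ : Continuous π) (hπS : ∀ t, π t ∈ S) (hid : ∀ t ∈ S, π t = t)
    (hz : IsIntegralCurveOn z (fun _ => solitonField p₁ p₂ lam) S) {t : ℝ} (ht : t ∈ S) :
    ∃ c > 0, z t 2 = z 0 2 * c :=
  exists_pos_eq_mul_of_hasDerivWithinAt (f := fun t => z t 2) (a := fun t => -2 * z t 3) hS h0 hπ
    hπS hid (continuousOn_const.mul ((continuous_apply 3).comp_continuousOn hz.continuousOn))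
    (fun t ht => (hasDerivWithinAt_pi.1 (hz t ht) 2).congr_deriv
      (by simp only [solitonField, Matrix.cons_val]; ring)) ht

/-- A point in both manifolds, followed backwards in time, has `σ = J = 0` and `x₂ > 0`. -/
theorem backward_orbit_of_mem_stableManifold (hp₁ : 2 ≤ p₁) {z : ℝ → Fin 6 → ℝ}
    (hz : IsIntegralCurveOn z (fun _ => solitonField p₁ p₂ lam) (Iic 0))
    (h0 : z 0 ∈ stableManifold (solitonField p₁ p₂ lam) (ricciFlatCone p₁ p₂)) {t : ℝ}
    (ht : t ≤ 0) :
    solitonSigma (z t) = 0 ∧ solitonJ p₁ p₂ (z t) = 0 ∧ 0 < z t 2 := by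
  have hp : (2 : ℝ) ≤ p₁ := by exact_mod_cast hp₁
  obtain ⟨γ, hγ0, hγ, hγlim⟩ := h0
  obtain ⟨hσ, hJ⟩ := solitonSigma_solitonJ_eq_zero hγ hγlim
  rw [hγ0] at hσ hJ
  refine ⟨?_, ?_, ?_⟩
  · rw [solitonSigma_eq_mul_exp hz (convex_Iic 0) self_mem_Iic ht, hσ, zero_mul]
  · rw [solitonJ_eq_mul_exp hz (convex_Iic 0) self_mem_Iic hσ ht, hJ, zero_mul]
  · have hpos : 0 < γ 0 2 := by
      have h1 := tendsto_pi_nhds.1 hγlim 2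
      simp only [ricciFlatCone, Matrix.cons_val] at h1
      have h2 : (0 : ℝ) < p₁ + p₂ - 1 := by linarith [(Nat.cast_nonneg p₂ : (0 : ℝ) ≤ p₂)]
      obtain ⟨s, hs, hs0⟩ := ((h1.eventually (lt_mem_nhds h2)).and (eventually_ge_atTop 0)).exists
      obtain ⟨c, hc, e⟩ := exists_pos_x₂_eq (π := fun t => max t 0) (convex_Ici 0) self_mem_Ici
        (by fun_prop) (fun t => mem_Ici.2 (le_max_right _ _)) (fun t ht => max_eq_left ht) hγ hs0
      rw [e] at hs
      exact pos_of_mul_pos_left hs hc.le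
    rw [hγ0] at hpos
    obtain ⟨c, hc, e⟩ := exists_pos_x₂_eq (π := fun t => min t 0) (convex_Iic 0) self_mem_Iic
      (by fun_prop) (fun t => mem_Iic.2 (min_le_right _ _)) (fun t ht => min_eq_left ht) hz ht
    rw [e]
    positivity

theorem exists_forall_norm_solitonChart_le {z : ℝ → Fin 6 → ℝ}
    (hlim : Tendsto z atBot (𝓝 (goodFill p₁))) {ε : ℝ} (hε : 0 < ε) :
    ∃ a ≤ 0, ∀ t ≤ a, ‖solitonChart p₁ p₂ d (z t)‖ ≤ ε := by
  have h1 : Tendsto (fun t => solitonChart p₁ p₂ d (z t)) atBot (𝓝 0) := by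
    rw [← solitonChart_goodFill (p₁ := p₁) (p₂ := p₂) (d := d)]
    exact continuous_solitonChart.continuousAt.tendsto.comp hlim
  have h2 := h1.norm.eventually (ge_mem_nhds (by simpa using hε))
  obtain ⟨a, ha, ha0⟩ := ((eventually_forall_le_atBot.2 h2).and (eventually_le_atBot 0)).exists
  exact ⟨a, ha0, ha⟩

/-- Two orbits in the intersection of the manifolds agree up to a shift of time. Both are asymptotic
to the good fill, where they are determined by `x₂`, and `x₂` takes equal values on them. -/
theorem exists_eq_of_mem_stableManifold (hp₁ : 2 ≤ p₁) (hd : 0 < d)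
    (hL : d * ‖solitonLin ℝ p₂ lam‖ ≤ 1 / 24) {z w : ℝ → Fin 6 → ℝ}
    (hz : IsIntegralCurveOn z (fun _ => solitonField p₁ p₂ lam) (Iic 0))
    (hzl : Tendsto z atBot (𝓝 (goodFill p₁)))
    (hz0 : z 0 ∈ stableManifold (solitonField p₁ p₂ lam) (ricciFlatCone p₁ p₂))
    (hw : IsIntegralCurveOn w (fun _ => solitonField p₁ p₂ lam) (Iic 0))
    (hwl : Tendsto w atBot (𝓝 (goodFill p₁)))
    (hw0 : w 0 ∈ stableManifold (solitonField p₁ p₂ lam) (ricciFlatCone p₁ p₂)) :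
    ∃ s ≤ 0, ∃ t ≤ 0, z s = w t := by
  obtain ⟨ε, hε, key⟩ := exists_eq_of_eq_unstable (p₁ := p₁) (p₂ := p₂) (lam := lam) hp₁ hd.le hL
  obtain ⟨a, ha0, ha⟩ := exists_forall_norm_solitonChart_le (p₂ := p₂) (d := d) hzl hε
  obtain ⟨b, hb0, hb⟩ := exists_forall_norm_solitonChart_le (p₂ := p₂) (d := d) hwl hε
  -- equality of the values of `x₂` at times before `a` and `b` is enough
  suffices ∃ s ≤ a, ∃ t ≤ b, z s 2 = w t 2 by
    obtain ⟨s, hs, t, ht, e⟩ := this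
    refine ⟨s, hs.trans ha0, t, ht.trans hb0, ?_⟩
    have hm : ∀ r c : ℝ, c ≤ 0 → r ≤ c → MapsTo (· + r) (Iic (0 : ℝ)) (Iic 0) :=
      fun r c hc hr x hx => by simp only [mem_Iic] at hx ⊢; linarith
    have hσ := backward_orbit_of_mem_stableManifold hp₁ hz hz0 (hs.trans ha0)
    have hσ' := backward_orbit_of_mem_stableManifold hp₁ hw hw0 (ht.trans hb0)
    have := key (fun r => solitonChart p₁ p₂ d (z (r + s)))
      (fun r => solitonChart p₁ p₂ d (w (r + t)))
      (fun r hr => hasDerivWithinAt_solitonChart (by omega) hd.ne'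
        (hz.shift s (hm s a ha0 hs) r hr))
      (fun r hr => hasDerivWithinAt_solitonChart (by omega) hd.ne'
        (hw.shift t (hm t b hb0 ht) r hr))
      (fun r hr => ha _ (by linarith)) (fun r hr => hb _ (by linarith))
      (by
        have h1 : z s 5 = 0 := hσ.1
        have h2 : w t 5 = 0 := hσ'.1
        simp [solitonChart, h1, h2])
      (by simp [solitonChart, e]) (by simp [solitonChart, hσ.2.1, hσ'.2.1])
    simp only [zero_add] at this
    rw [← solitonChartInv_solitonChart (p₁ := p₁) (p₂ := p₂) (by omega) hd.ne' (z s), this,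
      solitonChartInv_solitonChart (by omega) hd.ne']
  have hzero : ∀ f : ℝ → Fin 6 → ℝ, Tendsto f atBot (𝓝 (goodFill p₁)) →
      Tendsto (fun t => f t 2) atBot (𝓝 0) := fun f hf => by
    simpa [goodFill] using tendsto_pi_nhds.1 hf 2
  have ivt : ∀ (f : ℝ → Fin 6 → ℝ) (c : ℝ) (m : ℝ), c ≤ 0 →
      IsIntegralCurveOn f (fun _ => solitonField p₁ p₂ lam) (Iic 0) →
      Tendsto f atBot (𝓝 (goodFill p₁)) → 0 < m → m ≤ f c 2 → ∃ s ≤ c, f s 2 = m := by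
    intro f c m hc hf hfl hm hmc
    obtain ⟨r, hr, hrc⟩ := (((hzero f hfl).eventually (gt_mem_nhds hm)).and
      (eventually_le_atBot c)).exists
    have hcont : ContinuousOn (fun t => f t 2) (Icc r c) :=
      (continuous_apply 2).comp_continuousOn (hf.continuousOn.mono fun x hx => hx.2.trans hc)
    obtain ⟨s, hs, e⟩ := intermediate_value_Icc hrc hcont ⟨hr.le, hmc⟩
    exact ⟨s, hs.2, e⟩
  have hza := (backward_orbit_of_mem_stableManifold hp₁ hz hz0 ha0).2.2
  have hwb := (backward_orbit_of_mem_stableManifold hp₁ hw hw0 hb0).2.2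
  rcases le_total (z a 2) (w b 2) with h | h
  · obtain ⟨t, ht, e⟩ := ivt w b _ hb0 hw hwl hza h
    exact ⟨a, le_rfl, t, ht, e.symm⟩
  · obtain ⟨s, hs, e⟩ := ivt z a _ ha0 hz hzl hwb h
    exact ⟨s, hs, b, le_rfl, e⟩

/-- The intersection of the two manifolds is a single orbit. -/
theorem unstableManifold_inter_stableManifold (hp₁ : 2 ≤ p₁) (hd : 0 < d)
    (hL : d * ‖solitonLin ℝ p₂ lam‖ ≤ 1 / 24) {B : ℝ → Fin 6 → ℝ}
    (hB : IsIntegralCurve B (fun _ => solitonField p₁ p₂ lam))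
    (hB₁ : Tendsto B atBot (𝓝 (goodFill p₁))) (hB₂ : Tendsto B atTop (𝓝 (ricciFlatCone p₁ p₂))) :
    unstableManifold (solitonField p₁ p₂ lam) (goodFill p₁) ∩
      stableManifold (solitonField p₁ p₂ lam) (ricciFlatCone p₁ p₂) = Set.range B := by
  have hshift₁ : ∀ a, Tendsto (fun t => B (t + a)) atBot (𝓝 (goodFill p₁)) := fun a =>
    hB₁.comp (tendsto_id.atBot_add tendsto_const_nhds)
  have hshift₂ : ∀ a, B a ∈ stableManifold (solitonField p₁ p₂ lam) (ricciFlatCone p₁ p₂) :=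
    fun a => ⟨fun t => B (t + a), by simp, hB.isIntegralCurveOn_shift a _,
      hB₂.comp (tendsto_id.atTop_add tendsto_const_nhds)⟩
  apply Subset.antisymm
  · rintro p ⟨⟨z, rfl, hz, hzl⟩, hps⟩
    have hB0 := hB.isIntegralCurveOn_shift 0 (Iic 0)
    simp only [add_zero] at hB0
    obtain ⟨s, hs, t, -, e⟩ := exists_eq_of_mem_stableManifold hp₁ hd hL hz hzl hps hB0 hB₁
      (hshift₂ 0)
    refine ⟨t - s, ?_⟩
    have := IsIntegralCurveOn.eq_zero_of_eq (contDiff_solitonField p₁ p₂ lam) hs hz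
      (hB.isIntegralCurveOn_shift (t - s) (Iic 0)) (by simpa using e)
    simpa using this.symm
  · rintro _ ⟨a, rfl⟩
    exact ⟨⟨fun t => B (t + a), by simp, hB.isIntegralCurveOn_shift a _, hshift₁ a⟩, hshift₂ a⟩

end Intersection

/-! ### The tangent space of the unstable manifold -/

section UnstableTangent

open unitInterval Asymptotics

/-- The range of a linear map of a finite-dimensional space is closed, and so a velocity `v` of a
curve that runs in it to first order belongs to it. -/
theorem ContinuousLinearMap.mem_range_of_isLittleO {E F : Type*} [NormedAddCommGroup E]
    [NormedSpace ℝ E] [NormedAddCommGroup F] [NormedSpace ℝ F] [FiniteDimensional ℝ E]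
    {D : E →L[ℝ] F} {x : ℝ → E} {v : F} (h : (fun r => D (x r) - r • v) =o[𝓝 0] fun r : ℝ => r) :
    v ∈ LinearMap.range (D : E →ₗ[ℝ] F) := by
  have hcl : IsClosed (LinearMap.range (D : E →ₗ[ℝ] F) : Set F) :=
    Submodule.closed_of_finiteDimensional _
  have h1 := (h.mono (nhdsWithin_le_nhds (s := {0}ᶜ))).tendsto_inv_smul_nhds_zero
  have h2 : Tendsto (fun r : ℝ => D (r⁻¹ • x r)) (𝓝[≠] 0) (𝓝 v) := by
    rw [← tendsto_sub_nhds_zero_iff]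
    refine h1.congr' ?_
    filter_upwards [self_mem_nhdsWithin] with r hr
    have hr0 : r ≠ 0 := hr
    rw [smul_sub, smul_smul, inv_mul_cancel₀ hr0, one_smul, map_smul]
  exact hcl.mem_of_tendsto h2 (.of_forall fun r => ⟨_, rfl⟩)

variable {p₁ p₂ : ℕ} {lam d : ℝ} {Ω : (Fin 3 → ℝ) → Fin 6 → C(I, ℝ)} {ξ : Fin 3 → ℝ}

/-- The orbits of a family of solutions of the integral equation. -/
noncomputable def familyOrbit (p₁ p₂ : ℕ) (d : ℝ) (Ω : (Fin 3 → ℝ) → Fin 6 → C(I, ℝ))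
    (η : Fin 3 → ℝ) (t : ℝ) : Fin 6 → ℝ :=
  solitonChartInv p₁ p₂ d (rescaledCurve (Ω η) t)

theorem isIntegralCurveOn_familyOrbit (hp₁ : p₁ ≠ 0) {η : Fin 3 → ℝ}
    (h : solitonInt p₁ p₂ lam d (Ω η) = unstableConst η) :
    IsIntegralCurveOn (familyOrbit p₁ p₂ d Ω η) (fun _ => solitonField p₁ p₂ lam) (Iic 0) :=
  fun t ht => hasDerivWithinAt_solitonChartInv hp₁
    (isIntegralCurveOn_rescaledCurve_of_unstableConst h t ht)

theorem solitonChart_familyOrbit (hp₁ : p₁ ≠ 0) (hd : d ≠ 0) (η : Fin 3 → ℝ) (t : ℝ) :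
    solitonChart p₁ p₂ d (familyOrbit p₁ p₂ d Ω η t) = rescaledCurve (Ω η) t :=
  solitonChart_solitonChartInv hp₁ hd _

theorem contDiffAt_rescaledCurve (hΩ : ContDiffAt ℝ 1 Ω ξ) (t : ℝ) :
    ContDiffAt ℝ 1 (fun η => rescaledCurve (Ω η) t) ξ := by
  rw [contDiffAt_pi]
  intro i
  have h1 : ContDiffAt ℝ 1 (fun η => Ω η i) ξ := contDiffAt_pi.1 hΩ i
  have h2 := (ContinuousMap.evalCLM ℝ (expI t)).contDiff.contDiffAt.comp ξ h1
  exact contDiffAt_const.mul h2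

theorem contDiffAt_familyOrbit (hΩ : ContDiffAt ℝ 1 Ω ξ) (t : ℝ) :
    ContDiffAt ℝ 1 (fun η => familyOrbit p₁ p₂ d Ω η t) ξ :=
  contDiff_solitonChartInv.contDiffAt.comp ξ (contDiffAt_rescaledCurve hΩ t)

theorem eventually_norm_le (hΩ : ContDiffAt ℝ 1 Ω ξ) : ∀ᶠ η in 𝓝 ξ, ‖Ω η‖ ≤ ‖Ω ξ‖ + 1 :=
  hΩ.continuousAt.norm.eventually (ge_mem_nhds (lt_add_one _))

/-- At sufficiently early times the unstable components are local coordinates of the family, since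
they are so in the limit `t → -∞`. -/
theorem eventually_exists_hasStrictFDerivAt (hΩ : ContDiffAt ℝ 1 Ω ξ)
    (hG : ∀ᶠ η in 𝓝 ξ, solitonInt p₁ p₂ lam d (Ω η) = unstableConst η) :
    ∀ᶠ t in atBot, ∃ L : (Fin 3 → ℝ) ≃L[ℝ] (Fin 3 → ℝ),
      HasStrictFDerivAt (fun η (i : Fin 3) => rescaledCurve (Ω η) t (i.castLE (by norm_num)))
        (L : (Fin 3 → ℝ) →L[ℝ] (Fin 3 → ℝ)) ξ := by
  have hs := hΩ.hasStrictFDerivAt one_ne_zero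
  set Ω' := fderiv ℝ Ω ξ
  let ev : I → (Fin 6 → C(I, ℝ)) →L[ℝ] (Fin 3 → ℝ) := fun x => ContinuousLinearMap.pi fun i =>
    ContinuousMap.evalCLM ℝ x ∘L .proj (i.castLE (by norm_num))
  let A : I → (Fin 3 → ℝ) →L[ℝ] (Fin 3 → ℝ) := fun x => ev x ∘L Ω'
  have hA : Continuous A := by
    rw [continuous_clm_apply]
    intro h
    exact continuous_pi fun i => (Ω' h (i.castLE (by norm_num))).continuous
  have hA0 : A 0 = 1 := by
    have h1 : HasFDerivAt (fun η => ev 0 (Ω η)) (A 0) ξ := (ev 0).hasFDerivAt.comp ξ hs.hasFDerivAt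
    have h2 : (fun η => ev 0 (Ω η)) =ᶠ[𝓝 ξ] id := by
      filter_upwards [hG] with η hη
      ext i
      exact apply_zero_of_solitonInt_eq hη i
    exact (h1.congr_of_eventuallyEq h2.symm).unique (hasFDerivAt_id ξ)
  have hunit : ∀ᶠ x in 𝓝 (0 : I), IsUnit (A x) := by
    refine hA.continuousAt.eventually (Units.isOpen.mem_nhds ?_)
    rw [hA0]
    exact isUnit_one
  have hexp : Tendsto expI atBot (𝓝 0) := by
    have h : Tendsto expI atBot (𝓝 (projIcc 0 1 zero_le_one (0 : ℝ))) :=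
      continuous_projIcc.continuousAt.tendsto.comp Real.tendsto_exp_atBot
    rw [projIcc_left] at h
    exact h
  filter_upwards [hexp.eventually hunit] with t ht
  obtain ⟨U, hU⟩ := ht
  have hne : Real.exp (2 * t) ≠ 0 := (Real.exp_pos _).ne'
  refine ⟨(ContinuousLinearEquiv.unitsEquiv ℝ _ U).trans
    (ContinuousLinearEquiv.smulLeft (Units.mk0 _ hne)), ?_⟩
  have h1 := ((ev (expI t)).hasStrictFDerivAt.comp ξ hs).const_smul (Real.exp (2 * t))
  refine h1.congr_fderiv ?_
  change Real.exp (2 * t) • A (expI t) = _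
  rw [← hU]
  rfl

/-- The derivative of the end points of the family. -/
noncomputable def familyDeriv (p₁ p₂ : ℕ) (d : ℝ) (Ω : (Fin 3 → ℝ) → Fin 6 → C(I, ℝ))
    (ξ : Fin 3 → ℝ) : (Fin 3 → ℝ) →L[ℝ] (Fin 6 → ℝ) :=
  fderiv ℝ (fun η => familyOrbit p₁ p₂ d Ω η 0) ξ

theorem hasStrictFDerivAt_familyOrbit (hΩ : ContDiffAt ℝ 1 Ω ξ) :
    HasStrictFDerivAt (fun η => familyOrbit p₁ p₂ d Ω η 0) (familyDeriv p₁ p₂ d Ω ξ) ξ :=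
  (contDiffAt_familyOrbit hΩ 0).hasStrictFDerivAt one_ne_zero

theorem hasDerivAt_add_smul (ξ h : Fin 3 → ℝ) : HasDerivAt (fun r : ℝ => ξ + r • h) h 0 := by
  simpa using ((hasDerivAt_id (0 : ℝ)).smul_const h).const_add ξ

theorem tendsto_add_smul (ξ h : Fin 3 → ℝ) : Tendsto (fun r : ℝ => ξ + r • h) (𝓝 0) (𝓝 ξ) := by
  simpa using (hasDerivAt_add_smul ξ h).continuousAt.tendsto

/-- The family runs in the unstable manifold. -/
theorem familyDeriv_mem_unstableTangent (hp₁ : p₁ ≠ 0) (hd : d ≠ 0) (hΩ : ContDiffAt ℝ 1 Ω ξ)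
    (hG : ∀ᶠ η in 𝓝 ξ, solitonInt p₁ p₂ lam d (Ω η) = unstableConst η) (h : Fin 3 → ℝ) :
    familyDeriv p₁ p₂ d Ω ξ h ∈ unstableTangent (solitonField p₁ p₂ lam) (goodFill p₁)
      (familyOrbit p₁ p₂ d Ω ξ 0) := by
  have hev := (tendsto_add_smul ξ h).eventually (hG.and ((eventually_norm_le hΩ).and
    ((contDiffAt_familyOrbit (p₁ := p₁) (p₂ := p₂) (d := d) hΩ 0).eventually (by simp))))
  obtain ⟨ε, hε, hball⟩ := Metric.eventually_nhds_iff_ball.1 hev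
  rw [Real.ball_eq_Ioo, zero_sub, zero_add] at hball
  refine ⟨ε, hε, fun r => familyOrbit p₁ p₂ d Ω (ξ + r • h) 0,
    fun r => familyOrbit p₁ p₂ d Ω (ξ + r • h),
    fun r hr => ?_, by simp, ?_, fun r hr => ⟨rfl, ?_⟩, ?_⟩
  · refine ContDiffAt.contDiffWithinAt ?_
    exact ContDiffAt.comp (g := fun η => familyOrbit p₁ p₂ d Ω η 0) r (hball r hr).2.2
      (by fun_prop : ContDiff ℝ 1 fun r : ℝ => ξ + r • h).contDiffAt
  · have h1 : HasFDerivAt (fun η => familyOrbit p₁ p₂ d Ω η 0) (familyDeriv p₁ p₂ d Ω ξ)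
        (ξ + (0 : ℝ) • h) := by
      simpa using (hasStrictFDerivAt_familyOrbit hΩ).hasFDerivAt
    exact h1.comp_hasDerivAt 0 (hasDerivAt_add_smul ξ h)
  · exact isIntegralCurveOn_familyOrbit hp₁ (hball r hr).1
  · rw [Metric.tendstoUniformlyOn_iff]
    intro ε' hε'
    have hc := (contDiff_solitonChartInv (p₁ := p₁) (p₂ := p₂) (d := d)
      (n := 0)).continuous.continuousAt (x := 0)
    obtain ⟨δ, hδ, hc⟩ := Metric.continuousAt_iff.1 hc ε' hε'
    have hlim := tendsto_exp_two_mul_atBot.mul_const (‖Ω ξ‖ + 1)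
    rw [zero_mul] at hlim
    filter_upwards [hlim.eventually (gt_mem_nhds hδ)] with t ht r hr
    rw [dist_comm, ← solitonChartInv_zero (p₂ := p₂) hp₁ hd]
    refine hc ?_
    rw [dist_zero_right]
    refine (norm_rescaledCurve_le _ _).trans_lt (lt_of_le_of_lt ?_ ht)
    gcongr
    exact (hball r hr).2.1

/-- Backward in time the difference of two orbits of the family is controlled by the difference of
their end points. -/
theorem isBigO_familyOrbit (hp₁ : p₁ ≠ 0) (hΩ : ContDiffAt ℝ 1 Ω ξ)
    (hG : ∀ᶠ η in 𝓝 ξ, solitonInt p₁ p₂ lam d (Ω η) = unstableConst η) {s : ℝ} (hs : s ≤ 0) :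
    (fun η => familyOrbit p₁ p₂ d Ω η s - familyOrbit p₁ p₂ d Ω ξ s) =O[𝓝 ξ]
      fun η => familyOrbit p₁ p₂ d Ω η 0 - familyOrbit p₁ p₂ d Ω ξ 0 := by
  obtain ⟨C, -, δ, hδ, hC⟩ := IsIntegralCurveOn.exists_norm_sub_le_of_Iic
    (contDiff_solitonField p₁ p₂ lam) (isIntegralCurveOn_familyOrbit hp₁ hG.self_of_nhds) hs
  refine IsBigO.of_bound C ?_
  have hc := (contDiffAt_familyOrbit (p₁ := p₁) (p₂ := p₂) (d := d) hΩ 0).continuousAt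
  filter_upwards [hG, hc.eventually (Metric.ball_mem_nhds _ hδ)] with η h1 h2
  rw [dist_eq_norm] at h2
  exact hC _ (isIntegralCurveOn_familyOrbit hp₁ h1) h2

theorem injective_familyDeriv (hp₁ : p₁ ≠ 0) (hd : d ≠ 0) (hΩ : ContDiffAt ℝ 1 Ω ξ)
    (hG : ∀ᶠ η in 𝓝 ξ, solitonInt p₁ p₂ lam d (Ω η) = unstableConst η) :
    Function.Injective (familyDeriv p₁ p₂ d Ω ξ) := by
  rw [injective_iff_map_eq_zero]
  intro h hh
  obtain ⟨s, ⟨L, hL⟩, hs⟩ := ((eventually_exists_hasStrictFDerivAt hΩ hG).and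
    (eventually_le_atBot 0)).exists
  have hdir : ∀ {G : Type} [NormedAddCommGroup G] [NormedSpace ℝ G] {f : (Fin 3 → ℝ) → G}
      {f' : (Fin 3 → ℝ) →L[ℝ] G}, HasStrictFDerivAt f f' ξ →
      HasDerivAt (fun r : ℝ => f (ξ + r • h)) (f' h) 0 := fun {G} _ _ {f f'} hf => by
    have h1 : HasFDerivAt f f' (ξ + (0 : ℝ) • h) := by simpa using hf.hasFDerivAt
    exact h1.comp_hasDerivAt 0 (hasDerivAt_add_smul ξ h)
  -- the derivative at time `s` vanishes in the direction of `h`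
  have h1 := hdir (hasStrictFDerivAt_familyOrbit (p₁ := p₁) (p₂ := p₂) (d := d) hΩ)
  rw [hh, hasDerivAt_iff_isLittleO_nhds_zero] at h1
  have h2 := (isBigO_familyOrbit hp₁ hΩ hG hs).comp_tendsto (tendsto_add_smul ξ h)
  have h3 : HasDerivAt (fun r : ℝ => familyOrbit p₁ p₂ d Ω (ξ + r • h) s) 0 0 := by
    rw [hasDerivAt_iff_isLittleO_nhds_zero]
    simp only [zero_add, zero_smul, add_zero, smul_zero, sub_zero] at h1 ⊢
    exact h2.trans_isLittleO h1
  have h4 := ((contDiff_solitonChart (p₁ := p₁) (p₂ := p₂) (d := d) (n := 1)).differentiable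
    one_ne_zero _).hasFDerivAt.comp_hasDerivAt 0 h3
  rw [map_zero] at h4
  have h5 : HasDerivAt (fun (r : ℝ) (i : Fin 3) => rescaledCurve (Ω (ξ + r • h)) s
      (i.castLE (by norm_num))) 0 0 := by
    rw [hasDerivAt_pi]
    intro i
    have := hasDerivAt_pi.1 h4 (i.castLE (by norm_num))
    simp only [Function.comp_apply, solitonChart_familyOrbit hp₁ hd] at this
    exact this
  have h6 := (hdir hL).unique h5
  exact L.injective (by rw [map_zero]; exact h6)

/-- Every curve in the unstable manifold runs locally in the family: at an early time its points are
recognized by their unstable components. -/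
theorem mem_range_familyDeriv (hp₁ : 2 ≤ p₁) (hd : 0 < d)
    (hLd : d * ‖solitonLin ℝ p₂ lam‖ ≤ 1 / 24) (hΩ : ContDiffAt ℝ 1 Ω ξ)
    (hG : ∀ᶠ η in 𝓝 ξ, solitonInt p₁ p₂ lam d (Ω η) = unstableConst η) {v : Fin 6 → ℝ}
    (hv : v ∈ unstableTangent (solitonField p₁ p₂ lam) (goodFill p₁)
      (familyOrbit p₁ p₂ d Ω ξ 0)) :
    v ∈ LinearMap.range (familyDeriv p₁ p₂ d Ω ξ : (Fin 3 → ℝ) →ₗ[ℝ] (Fin 6 → ℝ)) := by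
  have hp₁0 : p₁ ≠ 0 := by omega
  obtain ⟨ε, hε, c, orb, -, hc0, hcv, horb, hunif⟩ := hv
  have h0mem : (0 : ℝ) ∈ Ioo (-ε) ε := ⟨by linarith, hε⟩
  have hnhds : Ioo (-ε) ε ∈ 𝓝 (0 : ℝ) := Ioo_mem_nhds h0mem.1 h0mem.2
  have hz := isIntegralCurveOn_familyOrbit hp₁0 hG.self_of_nhds
  set z := familyOrbit p₁ p₂ d Ω ξ
  have horb0 : EqOn (orb 0) z (Iic 0) :=
    IsIntegralCurveOn.eqOn_Iic (contDiff_solitonField p₁ p₂ lam) (horb 0 h0mem).2 hz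
      (by rw [(horb 0 h0mem).1, hc0])
  obtain ⟨ε₀, hε₀, hcone⟩ :=
    exists_eq_of_eq_unstable (p₁ := p₁) (p₂ := p₂) (lam := lam) hp₁ hd.le hLd
  -- a time before which all orbits are close to the good fill
  have hearly : ∀ᶠ t in atBot, ∀ r ∈ Ioo (-ε) ε, ‖solitonChart p₁ p₂ d (orb r t)‖ ≤ ε₀ := by
    have h1 := (continuous_solitonChart (p₁ := p₁) (p₂ := p₂) (d := d)).norm.continuousAt
      (x := goodFill p₁)
    have h2 := h1.eventually (ge_mem_nhds
      (by simpa [solitonChart_goodFill] using hε₀ : ‖solitonChart p₁ p₂ d (goodFill p₁)‖ < ε₀))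
    obtain ⟨δ, hδ, h3⟩ := Metric.eventually_nhds_iff.1 h2
    filter_upwards [Metric.tendstoUniformlyOn_iff.1 hunif δ hδ] with t ht r hr
    exact h3 (by rw [dist_comm]; exact ht r hr)
  have hearly' : ∀ᶠ t in atBot, Real.exp (2 * t) * (‖Ω ξ‖ + 1) ≤ ε₀ := by
    have h1 := tendsto_exp_two_mul_atBot.mul_const (‖Ω ξ‖ + 1)
    rw [zero_mul] at h1
    exact h1.eventually (ge_mem_nhds hε₀)
  obtain ⟨s, ⟨⟨hs1, hs2⟩, ⟨L, hL⟩⟩, hs0⟩ := (((eventually_forall_le_atBot.2 hearly).and hearly').and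
    (eventually_exists_hasStrictFDerivAt hΩ hG)).and (eventually_le_atBot 0) |>.exists
  -- the unstable components at time `s` along the curve
  have hOr : (fun r => orb r s - z s) =O[𝓝 0] fun r : ℝ => r := by
    obtain ⟨C, -, δ, hδ, hC⟩ := IsIntegralCurveOn.exists_norm_sub_le_of_Iic
      (contDiff_solitonField p₁ p₂ lam) hz hs0
    have h1 : (fun r => orb r s - z s) =O[𝓝 0] fun r => c r - c 0 := by
      refine IsBigO.of_bound C ?_
      filter_upwards [hnhds, hcv.continuousAt.eventually (Metric.ball_mem_nhds _ hδ)] with r hr h2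
      rw [dist_eq_norm, hc0] at h2
      rw [hc0, ← (horb r hr).1] at *
      exact hC _ (horb r hr).2 h2
    simpa using h1.trans hcv.isBigO_sub
  have hlim : Tendsto (fun r => orb r s) (𝓝 0) (𝓝 (z s)) := by
    have := (hOr.trans_tendsto tendsto_id).add_const (z s)
    simpa using this
  set K : (Fin 3 → ℝ) → Fin 3 → ℝ := fun η i =>
    rescaledCurve (Ω η) s (i.castLE (by norm_num))
  set y : ℝ → Fin 3 → ℝ := fun r i =>
    solitonChart p₁ p₂ d (orb r s) (i.castLE (by norm_num))
  have hyO : (fun r => y r - K ξ) =O[𝓝 0] fun r : ℝ => r := by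
    have h1 := ((contDiff_solitonChart (p₁ := p₁) (p₂ := p₂) (d := d) (n := 1)).differentiable
      one_ne_zero (z s)).hasFDerivAt.isBigO_sub.comp_tendsto hlim
    refine IsBigO.trans (IsBigO.of_bound 1 (.of_forall fun r => ?_)) (h1.trans hOr)
    rw [one_mul, pi_norm_le_iff_of_nonneg (norm_nonneg _)]
    intro i
    simp only [Function.comp_apply, z, solitonChart_familyOrbit hp₁0 hd.ne']
    exact norm_le_pi_norm (solitonChart p₁ p₂ d (orb r s) - rescaledCurve (Ω ξ) s) _
  have hylim : Tendsto y (𝓝 0) (𝓝 (K ξ)) := by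
    have := (hyO.trans_tendsto tendsto_id).add_const (K ξ)
    simpa using this
  -- the parameters of the points of the curve
  set x : ℝ → Fin 3 → ℝ := fun r => hL.localInverse K L ξ (y r)
  have hxlim : Tendsto x (𝓝 0) (𝓝 ξ) := hL.localInverse_tendsto.comp hylim
  have hxO : (fun r => x r - ξ) =O[𝓝 0] fun r : ℝ => r := by
    have h1 := hL.to_localInverse.hasFDerivAt.isBigO_sub.comp_tendsto hylim
    rw [hL.localInverse_apply_image] at h1
    exact h1.trans hyO
  have hmem : ∀ᶠ r in 𝓝 (0 : ℝ), c r = familyOrbit p₁ p₂ d Ω (x r) 0 := by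
    filter_upwards [hnhds, hylim.eventually hL.eventually_right_inverse, hxlim.eventually hG,
      hxlim.eventually (eventually_norm_le hΩ)] with r hr hKr hGr hnr
    have hm : MapsTo (· + s) (Iic (0 : ℝ)) (Iic 0) := fun t ht => by
      simp only [mem_Iic] at ht ⊢; linarith
    have hyi : ∀ i : Fin 3, rescaledCurve (Ω (x r)) s (i.castLE (by norm_num)) =
        solitonChart p₁ p₂ d (orb r s) (i.castLE (by norm_num)) := fun i => congrFun hKr i
    have := hcone (fun t => rescaledCurve (Ω (x r)) (t + s))
      (fun t => solitonChart p₁ p₂ d (orb r (t + s)))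
      ((isIntegralCurveOn_rescaledCurve_of_unstableConst hGr).shift s hm)
      (fun t ht => hasDerivWithinAt_solitonChart hp₁0 hd.ne' ((horb r hr).2.shift s hm t ht))
      (fun t ht => ?_) (fun t ht => hs1 _ (by linarith) r hr)
      (by simpa using hyi 0) (by simpa using hyi 1) (by simpa using hyi 2)
    · simp only [zero_add] at this
      have e : orb r s = familyOrbit p₁ p₂ d Ω (x r) s := by
        rw [familyOrbit, this, solitonChartInv_solitonChart hp₁0 hd.ne']
      rw [← (horb r hr).1]
      exact IsIntegralCurveOn.eq_zero_of_eq (contDiff_solitonField p₁ p₂ lam) hs0 (horb r hr).2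
        (isIntegralCurveOn_familyOrbit hp₁0 hGr) e
    · refine (norm_rescaledCurve_le _ _).trans (le_trans ?_ hs2)
      gcongr
      linarith
  refine ContinuousLinearMap.mem_range_of_isLittleO (x := fun r => x r - ξ) ?_
  have h1 := ((hasStrictFDerivAt_familyOrbit (p₁ := p₁) (p₂ := p₂) (d := d)
    hΩ).hasFDerivAt.isLittleO.comp_tendsto hxlim).trans_isBigO hxO
  have h2 := hasDerivAt_iff_isLittleO_nhds_zero.1 hcv
  refine (h2.sub h1).congr' ?_ .rfl
  filter_upwards [hmem] with r hr
  simp only [Function.comp_apply, zero_add, ← hr, hc0, z]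
  abel

end UnstableTangent

/-! ### Transversality -/

section Transversality

open unitInterval

variable {p₁ p₂ : ℕ} {lam d : ℝ} {Ω : (Fin 3 → ℝ) → Fin 6 → C(I, ℝ)} {ξ : Fin 3 → ℝ}

theorem familyOrbit_zero_five {η : Fin 3 → ℝ}
    (h : solitonInt p₁ p₂ lam d (Ω η) = unstableConst η) :
    familyOrbit p₁ p₂ d Ω η 0 5 = d ^ 2 * η 0 := by
  simp [familyOrbit, solitonChartInv, rescaledCurve, apply_of_solitonInt_eq h, unitExtend]

theorem solitonJ_familyOrbit_zero (hp₁ : p₁ ≠ 0) (hd : d ≠ 0) {η : Fin 3 → ℝ}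
    (h : solitonInt p₁ p₂ lam d (Ω η) = unstableConst η) (h0 : η 0 = 0) :
    solitonJ p₁ p₂ (familyOrbit p₁ p₂ d Ω η 0) = d ^ 2 * η 2 := by
  have h1 := congrFun (solitonChart_familyOrbit (p₂ := p₂) (Ω := Ω) hp₁ hd η 0) 2
  simp only [solitonChart, Matrix.cons_val] at h1
  rw [div_eq_iff (pow_ne_zero 2 hd)] at h1
  rw [h1]
  simp [rescaledCurve, apply_two_of_solitonInt_eq h h0, unitExtend, mul_comm]

theorem familyDeriv_five (hΩ : ContDiffAt ℝ 1 Ω ξ)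
    (hG : ∀ᶠ η in 𝓝 ξ, solitonInt p₁ p₂ lam d (Ω η) = unstableConst η) (h : Fin 3 → ℝ) :
    familyDeriv p₁ p₂ d Ω ξ h 5 = d ^ 2 * h 0 := by
  have h1 : HasFDerivAt (fun η => familyOrbit p₁ p₂ d Ω η 0) (familyDeriv p₁ p₂ d Ω ξ)
      (ξ + (0 : ℝ) • h) := by
    simpa using (hasStrictFDerivAt_familyOrbit hΩ).hasFDerivAt
  have h2 := hasDerivAt_pi.1 (h1.comp_hasDerivAt 0 (hasDerivAt_add_smul ξ h)) 5
  refine h2.unique (HasDerivAt.congr_of_eventuallyEq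
    ((hasDerivAt_pi.1 (hasDerivAt_add_smul ξ h) 0).const_mul (d ^ 2)) ?_)
  filter_upwards [(tendsto_add_smul ξ h).eventually hG] with r hr
  exact familyOrbit_zero_five hr

theorem fderiv_solitonJ_familyDeriv (hp₁ : p₁ ≠ 0) (hd : d ≠ 0) (hΩ : ContDiffAt ℝ 1 Ω ξ)
    (hG : ∀ᶠ η in 𝓝 ξ, solitonInt p₁ p₂ lam d (Ω η) = unstableConst η) (hξ : ξ 0 = 0)
    {h : Fin 3 → ℝ} (h0 : h 0 = 0) :
    fderiv ℝ (solitonJ p₁ p₂) (familyOrbit p₁ p₂ d Ω ξ 0) (familyDeriv p₁ p₂ d Ω ξ h) =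
      d ^ 2 * h 2 := by
  have h1 : HasFDerivAt (fun η => solitonJ p₁ p₂ (familyOrbit p₁ p₂ d Ω η 0))
      (fderiv ℝ (solitonJ p₁ p₂) (familyOrbit p₁ p₂ d Ω ξ 0) ∘L familyDeriv p₁ p₂ d Ω ξ)
      (ξ + (0 : ℝ) • h) := by
    rw [zero_smul, add_zero]
    exact (differentiable_solitonJ _).hasFDerivAt.comp ξ
      (hasStrictFDerivAt_familyOrbit hΩ).hasFDerivAt
  have h2 := h1.comp_hasDerivAt 0 (hasDerivAt_add_smul ξ h)
  refine h2.unique (HasDerivAt.congr_of_eventuallyEq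
    ((hasDerivAt_pi.1 (hasDerivAt_add_smul ξ h) 2).const_mul (d ^ 2)) ?_)
  filter_upwards [(tendsto_add_smul ξ h).eventually hG] with r hr
  exact solitonJ_familyOrbit_zero hp₁ hd hr (by simp [hξ, h0])

/-- Every orbit that leaves the good fill with the leading rate belongs to a family of solutions
of the integral equation. -/
theorem exists_family_of_tendsto (hp₁ : p₁ ≠ 0) (hd : 0 < d)
    (hL : d * ‖solitonLin C(I, ℝ) p₂ lam‖ ≤ 1 / 4) {z : ℝ → Fin 6 → ℝ}
    (hz : IsIntegralCurveOn z (fun _ => solitonField p₁ p₂ lam) (Iic 0)) {ℓ : Fin 6 → ℝ}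
    (hlim : Tendsto (fun t => Real.exp (-(2 * t)) • solitonChart p₁ p₂ d (z t)) atBot (𝓝 ℓ)) :
    ∃ Ω ξ, familyOrbit p₁ p₂ d Ω ξ 0 = z 0 ∧ ContDiffAt ℝ 1 Ω ξ ∧
      ∀ᶠ η in 𝓝 ξ, solitonInt p₁ p₂ lam d (Ω η) = unstableConst η := by
  obtain ⟨ω, hω, -⟩ := exists_rescaledCurve_eq
    (continuous_solitonChart.comp_continuousOn hz.continuousOn) hlim
  have hcurve : IsIntegralCurveOn (rescaledCurve ω)
      (fun _ => solitonChartField p₁ p₂ lam d) (Iic 0) := fun t ht => by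
    have h1 := hasDerivWithinAt_solitonChart hp₁ hd.ne' (hz t ht)
    rw [show solitonChart p₁ p₂ d (z t) = rescaledCurve ω t from (hω t ht).symm] at h1
    exact h1.congr_of_mem (fun s hs => hω s hs) ht
  obtain ⟨c, hc, hcω⟩ := exists_solitonInt_eq_const hcurve
  rw [← exists_unstableConst_eq hc] at hcω
  obtain ⟨Ω, hΩω, hΩ, hG⟩ := exists_family hd.le hL hcω
  refine ⟨Ω, _, ?_, hΩ, hG⟩
  rw [familyOrbit, hΩω, hω 0 le_rfl, Function.comp_apply, solitonChartInv_solitonChart hp₁ hd.ne']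

/-- The unstable tangent space is a three-dimensional space complementary to the level set
`σ = J = 0` along orbits that lie in it and leave the good fill with the leading rate. -/
theorem exists_transversal_tangents (hp₁ : 2 ≤ p₁) (hp₂ : 2 ≤ p₂) (hn : p₁ + p₂ ≤ 8) (hd : 0 < d)
    (hL : d * ‖solitonLin C(I, ℝ) p₂ lam‖ ≤ 1 / 4) (hL' : d * ‖solitonLin ℝ p₂ lam‖ ≤ 1 / 24)
    {z : ℝ → Fin 6 → ℝ} (hz : IsIntegralCurveOn z (fun _ => solitonField p₁ p₂ lam) (Iic 0))
    {ℓ : Fin 6 → ℝ}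
    (hlim : Tendsto (fun t => Real.exp (-(2 * t)) • solitonChart p₁ p₂ d (z t)) atBot (𝓝 ℓ))
    (hs : z 0 ∈ stableManifold (solitonField p₁ p₂ lam) (ricciFlatCone p₁ p₂)) :
    ∃ Tu Ts : Submodule ℝ (Fin 6 → ℝ),
      (Tu : Set (Fin 6 → ℝ)) = unstableTangent (solitonField p₁ p₂ lam) (goodFill p₁) (z 0) ∧
      (Ts : Set (Fin 6 → ℝ)) =
        stableTangent (solitonField p₁ p₂ lam) (ricciFlatCone p₁ p₂) (z 0) ∧
      Module.finrank ℝ Tu = 3 ∧ Module.finrank ℝ Ts = 4 ∧ Tu ⊔ Ts = ⊤ := by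
  have hp₁0 : p₁ ≠ 0 := by omega
  obtain ⟨Ω, ξ, hz0, hΩ, hG⟩ := exists_family_of_tendsto hp₁0 hd hL hz hlim
  rw [← hz0] at hs ⊢
  set p := familyOrbit p₁ p₂ d Ω ξ 0
  set D := familyDeriv p₁ p₂ d Ω ξ
  have hξ : ξ 0 = 0 := by
    obtain ⟨γ, hγ0, hγ, hγl⟩ := hs
    have h1 : γ 0 5 = 0 := (solitonSigma_solitonJ_eq_zero hγ hγl).1
    rw [hγ0] at h1
    have h2 := familyOrbit_zero_five hG.self_of_nhds
    have h3 : d ^ 2 * ξ 0 = 0 := h2.symm.trans h1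
    simpa [hd.ne'] using h3
  let Φ : (Fin 6 → ℝ) →L[ℝ] ℝ × ℝ := (ContinuousLinearMap.proj 5).prod (fderiv ℝ (solitonJ p₁ p₂) p)
  -- the differentials of `σ` and `J` are independent on the unstable tangent space
  have hΦD : ∀ w : ℝ × ℝ, ∃ h, Φ (D h) = w := by
    intro w
    have hd2 : d ^ 2 ≠ 0 := pow_ne_zero 2 hd.ne'
    set a : Fin 3 → ℝ := ![w.1 / d ^ 2, 0, 0] with ha
    set b : Fin 3 → ℝ := ![0, 0, (w.2 - fderiv ℝ (solitonJ p₁ p₂) p (D a)) / d ^ 2] with hb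
    have h1 := familyDeriv_five hΩ hG a
    have h2 := familyDeriv_five hΩ hG b
    have h3 := fderiv_solitonJ_familyDeriv hp₁0 hd.ne' hΩ hG hξ (h := b) (by simp [hb])
    simp only [ha, hb, Matrix.cons_val, mul_zero, mul_div_cancel₀ _ hd2] at h1 h2 h3
    refine ⟨a + b, ?_⟩
    rw [map_add, map_add]
    refine Prod.ext ?_ ?_
    · change D a 5 + D b 5 = w.1
      rw [h1, h2, add_zero]
    · change fderiv ℝ (solitonJ p₁ p₂) p (D a) + fderiv ℝ (solitonJ p₁ p₂) p (D b) = w.2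
      rw [h3]
      ring
  refine ⟨LinearMap.range (D : (Fin 3 → ℝ) →ₗ[ℝ] (Fin 6 → ℝ)),
    LinearMap.ker (Φ : (Fin 6 → ℝ) →ₗ[ℝ] ℝ × ℝ), ?_, ?_, ?_, ?_, ?_⟩
  · refine Subset.antisymm ?_ fun v hv => mem_range_familyDeriv hp₁ hd hL' hΩ hG hv
    rintro _ ⟨h, rfl⟩
    exact familyDeriv_mem_unstableTangent hp₁0 hd.ne' hΩ hG h
  · rw [stableTangent_eq hp₁ hp₂ hn hs]
    ext v
    simp [Φ]
  · rw [LinearMap.finrank_range_of_inj (injective_familyDeriv hp₁0 hd.ne' hΩ hG)]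
    simp
  · have h1 := LinearMap.finrank_range_add_finrank_ker (Φ : (Fin 6 → ℝ) →ₗ[ℝ] ℝ × ℝ)
    have h2 : LinearMap.range (Φ : (Fin 6 → ℝ) →ₗ[ℝ] ℝ × ℝ) = ⊤ :=
      LinearMap.range_eq_top.2 fun w => (hΦD w).imp' D fun h hh => hh
    rw [h2, finrank_top] at h1
    simp at h1
    omega
  · rw [eq_top_iff]
    intro v _
    obtain ⟨h, hh⟩ := hΦD (Φ v)
    rw [Submodule.mem_sup]
    refine ⟨D h, ⟨h, rfl⟩, v - D h, ?_, by abel⟩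
    rw [LinearMap.mem_ker]
    change Φ (v - D h) = 0
    rw [map_sub, hh, sub_self]

end Transversality

theorem mainTheorem6 (p₁ p₂ : ℕ) (hp₁ : 2 ≤ p₁) (hp₂ : 2 ≤ p₂) (hn : p₁ + p₂ ≤ 8) (lam : ℝ) :
    (∃ B : ℝ → Fin 6 → ℝ,
      IsIntegralCurve B (fun _ => solitonField p₁ p₂ lam) ∧
      Tendsto B atBot (𝓝 (goodFill p₁)) ∧
      Tendsto B atTop (𝓝 (ricciFlatCone p₁ p₂)) ∧
      unstableManifold (solitonField p₁ p₂ lam) (goodFill p₁) ∩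
        stableManifold (solitonField p₁ p₂ lam) (ricciFlatCone p₁ p₂) = Set.range B ∧
      ∀ t : ℝ, ∃ Tu Ts : Submodule ℝ (Fin 6 → ℝ),
        (Tu : Set (Fin 6 → ℝ)) =
          unstableTangent (solitonField p₁ p₂ lam) (goodFill p₁) (B t) ∧
        (Ts : Set (Fin 6 → ℝ)) =
          stableTangent (solitonField p₁ p₂ lam) (ricciFlatCone p₁ p₂) (B t) ∧
        Module.finrank ℝ Tu = 3 ∧ Module.finrank ℝ Ts = 4 ∧ Tu ⊔ Ts = ⊤) ∧
    (∀ p ∈ stableManifold (solitonField p₁ p₂ lam) (ricciFlatCone p₁ p₂),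
      solitonSigma p = 0 ∧ solitonJ p₁ p₂ p = 0 ∧
      ∃ N ∈ 𝓝 p,
        stableManifold (solitonField p₁ p₂ lam) (ricciFlatCone p₁ p₂) ∩ N =
          {z | solitonSigma z = 0 ∧ solitonJ p₁ p₂ z = 0} ∩ N) := by
  refine ⟨?_, fun p hp => ?_⟩
  · obtain ⟨d, hd, hL, hL'⟩ : ∃ d > 0, d * ‖solitonLin C(unitInterval, ℝ) p₂ lam‖ ≤ 1 / 4 ∧
        d * ‖solitonLin ℝ p₂ lam‖ ≤ 1 / 24 := by
      have h1 := norm_nonneg (solitonLin C(unitInterval, ℝ) p₂ lam)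
      have h2 := norm_nonneg (solitonLin ℝ p₂ lam)
      refine ⟨1 / (24 * (‖solitonLin C(unitInterval, ℝ) p₂ lam‖ + ‖solitonLin ℝ p₂ lam‖ + 1)),
        by positivity, ?_, ?_⟩ <;>
      · rw [one_div_mul_eq_div, div_le_iff₀ (by positivity)]
        linarith
    obtain ⟨B, hB, hB₁, hB₂, ℓ, hℓ⟩ := exists_boehmOrbit (lam := lam) hp₁ hp₂ hn hd hL
    have hrange := unstableManifold_inter_stableManifold hp₁ hd hL' hB hB₁ hB₂
    refine ⟨B, hB, hB₁, hB₂, hrange, fun t₀ => ?_⟩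
    have hlim : Tendsto (fun t => Real.exp (-(2 * t)) • solitonChart p₁ p₂ d (B (t + t₀))) atBot
        (𝓝 (Real.exp (2 * t₀) • ℓ)) := by
      refine ((hℓ.comp (tendsto_id.atBot_add (tendsto_const_nhds (x := t₀)))).const_smul
        (Real.exp (2 * t₀))).congr fun t => ?_
      simp only [Function.comp_apply, id, smul_smul, ← Real.exp_add]
      ring_nf
    have hs : B t₀ ∈ stableManifold (solitonField p₁ p₂ lam) (ricciFlatCone p₁ p₂) :=
      (hrange.symm.subset (mem_range_self t₀)).2
    simpa using exists_transversal_tangents hp₁ hp₂ hn hd hL hL'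
      (hB.isIntegralCurveOn_shift t₀ (Iic 0)) hlim (by simpa using hs)
  · obtain ⟨γ, rfl, hγ, hγl⟩ := id hp
    obtain ⟨hσ, hJ⟩ := solitonSigma_solitonJ_eq_zero hγ hγl
    exact ⟨hσ, hJ, stableManifold_inter_eq hp₁ hp₂ hn hp⟩
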